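/- **Qutrit stabilizer quantum mechanics is Mermin local.** *The category.* Let $\mathbf{Stab}_3$ be the $\dagger$-symmetric monoidal category whose objects are finite registers of qutrits (tensor powers of $\mathbb C^3$) and whose morphisms are the linear maps, taken up to a global phase, that are generated under composition, tensor product and adjoint by the state $|0\rangle$, all Clifford unitaries (unitaries normalising the Pauli group generated by $X|x\rangle=|x+1\rangle$, $Z|x\rangle=\omega^x|x\rangle$ on the individual qutrits and the scalar $\omega=e^{2\pi i/3}$), relabellings of wires and complex scalars. The dagger is the adjoint. *Definitions, in a $\dagger$-symmetric monoidal category $\mathcal C$.* A $\dagger$-qSCFA on $A$ is a commutative monoid $(\mu,\eta)$ on $A$ that, with $\delta=\mu^\dagger$, $\varepsilon=\eta^\dagger$, satisfies the Frobenius law, and for which $\mu\circ\delta$ is an invertible scalar times $1_A$. Two $\dagger$-qSCFAs $Z,X$ on $A$ are strongly complementary if $\delta_Z\mu_X=(\mu_X\otimes\mu_X)(1\otimes\sigma\otimes1)(\delta_Z\otimes\delta_Z)$, $\delta_Z\eta_X=\eta_X\otimes\eta_X$ and $\varepsilon_Z\mu_X=\varepsilon_Z\otimes\varepsilon_Z$.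 A state $j$ of $A$ is an $X$-classical point if $\delta_X j=j\otimes j$; a state $\alpha$ is a $Z$-phase state if $(1\otimes\alpha^\dagger)\delta_Z\alpha=\eta_Z$. Phase states are added by $\alpha+\beta=\mu_Z(\alpha\otimes\beta)$, and act on $A$ as the phases $\mu_Z(\alpha\otimes-)$. An $N$-partite Mermin measurement is given by $Z$-phase states $\alpha_1,\dots,\alpha_N$ whose sum is an $X$-classical point. It is the state of $A^{\otimes N}$ obtained by applying the phases to the $N$-partite GHZ state of $Z$ (the $Z$-node with no input and $N$ outputs), doubling the resulting state $\psi$, and measuring each component in $X$: explicitly $(1\otimes\psi^\dagger)\,\delta_X^{\otimes N}\,\psi$, where $\psi^\dagger$ acts on the second outputs of the $\delta_X$. A Mermin scenario is a non-empty finite family of $N$-partite Mermin measurements $\alpha^1,\dots,\alpha^S$; let $a_1,\dots,a_M$ be the distinct phases that appear in it. Its local map $A^{\otimes MN}\to A^{\otimes NS}$ has input wires $(r,i)$ with $r\le M$, $i\le N$ and output wires $(i,s)$ with $i\le N$, $s\le S$; it consists of one $X$-node for each input wire $(r,i)$, connected to exactly those output wires $(i,s)$ for which $\alpha^s_i=a_r$.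 A local hidden variable model is a state $\Lambda'$ of $A^{\otimes MN}$ such that, for each $s$, applying the local map to $\Lambda'$ and then $\varepsilon_X$ to the outputs of all measurements other than $s$ gives the $s$-th Mermin measurement. $\mathcal C$ is Mermin local if every Mermin scenario of every strongly complementary pair of $\dagger$-qSCFAs in $\mathcal C$ has a local hidden variable model. An abelian group $G$ is a trivial algebraic extension of a subgroup $H$ if every finite system of equations $\sum_j n^p_j x_j=h^p$ with $n^p_j\in\mathbb Z$, $h^p\in H$ that has a solution in $G$ has a solution in $H$. *Statement.* 1. On a single qutrit, the structures $Z$ with $\mu_Z|a,b\rangle=\delta_{ab}|a\rangle$, $\eta_Z=|0\rangle+|1\rangle+|2\rangle$ and $X$ with $\mu_X|a,b\rangle=|a+b\rangle$, $\eta_X=|0\rangle$ are a strongly complementary pair of $\dagger$-qSCFAs in $\mathbf{Stab}_3$. The $Z$-phase states form an abelian group under addition, all nonzero $X$-classical points are $Z$-phase states, and they form a subgroup. There is an isomorphism from the phase group to $\mathbb Z_3\times\mathbb Z_3$ that takes this subgroup to $\mathbb Z_3\times\{0\}$. The phase group is a trivial algebraic extension of the subgroup. 2. $\mathbf{Stab}_3$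 is Mermin local. -/

import Mathlib

/-!
# Mermin locality for dagger symmetric monoidal categories, and qutrit stabilizer quantum mechanics
-/

namespace Mermin

open CategoryTheory MonoidalCategory

universe v u

/-! ## Dagger symmetric monoidal categories -/

/-- A dagger on a symmetric monoidal category: an identity-on-objects involutive contravariant
functor, compatible with the tensor product, for which all structural isomorphisms are unitary. -/
class DaggerSMC (C : Type u) [Category.{v} C] [MonoidalCategory C] [SymmetricCategory C] where
  dag : ∀ {A B : C}, (A ⟶ B) → (B ⟶ A)
  dag_id : ∀ A : C, dag (𝟙 A) = 𝟙 A
  dag_comp : ∀ {A B D : C} (f : A ⟶ B) (g : B ⟶ D), dag (f ≫ g) = dag g ≫ dag f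
  dag_dag : ∀ {A B : C} (f : A ⟶ B), dag (dag f) = f
  dag_tensor : ∀ {A B A' B' : C} (f : A ⟶ B) (g : A' ⟶ B'), dag (f ⊗ₘ g) = dag f ⊗ₘ dag g
  dag_associator : ∀ A B D : C, dag (α_ A B D).hom = (α_ A B D).inv
  dag_leftUnitor : ∀ A : C, dag (λ_ A).hom = (λ_ A).inv
  dag_rightUnitor : ∀ A : C, dag (ρ_ A).hom = (ρ_ A).inv
  dag_braiding : ∀ A B : C, dag (β_ A B).hom = (β_ A B).inv

section Abstract

variable {C : Type u} [Category.{v} C] [MonoidalCategory C] [SymmetricCategory C] [DaggerSMC C]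

/-- A state of the system `A`. -/
abbrev State (A : C) := 𝟙_ C ⟶ A

/-- Multiplication of a morphism by a scalar. -/
def scalarMul {A B : C} (c : 𝟙_ C ⟶ 𝟙_ C) (f : A ⟶ B) : A ⟶ B :=
  (λ_ A).inv ≫ (c ⊗ₘ f) ≫ (λ_ B).hom

/-- A quasi-special commutative dagger Frobenius algebra: a commutative monoid which, together with
the comonoid obtained by applying the dagger, satisfies the Frobenius law, and for which
multiplication after comultiplication is an invertible scalar times the identity. -/
structure QSCFA (A : C) where
  mul : A ⊗ A ⟶ A
  one : 𝟙_ C ⟶ A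
  mul_assoc : (mul ▷ A) ≫ mul = (α_ A A A).hom ≫ (A ◁ mul) ≫ mul
  one_mul : (one ▷ A) ≫ mul = (λ_ A).hom
  mul_one : (A ◁ one) ≫ mul = (ρ_ A).hom
  mul_comm : (β_ A A).hom ≫ mul = mul
  frobenius_left :
    (A ◁ DaggerSMC.dag mul) ≫ (α_ A A A).inv ≫ (mul ▷ A) = mul ≫ DaggerSMC.dag mul
  frobenius_right :
    (DaggerSMC.dag mul ▷ A) ≫ (α_ A A A).hom ≫ (A ◁ mul) = mul ≫ DaggerSMC.dag mul
  quasiSpecial : ∃ c : 𝟙_ C ⟶ 𝟙_ C, IsIso c ∧ DaggerSMC.dag mul ≫ mul = scalarMul c (𝟙 A)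

namespace QSCFA

variable {A : C}

/-- The comultiplication. -/
def comul (Z : QSCFA A) : A ⟶ A ⊗ A := DaggerSMC.dag Z.mul

/-- The counit. -/
def counit (Z : QSCFA A) : A ⟶ 𝟙_ C := DaggerSMC.dag Z.one

/-- Classical states (classical points): the states copied by the comultiplication. -/
def IsClassical (X : QSCFA A) (j : State A) : Prop :=
  j ≫ X.comul = (λ_ (𝟙_ C)).inv ≫ (j ⊗ₘ j)

/-- Phase states: multiplying `α` with its conjugate gives the unit. The wire of the conjugate of
`α` is bent, so that it is an output of the comultiplication that is fed into the effect `α†`. -/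
def IsPhaseState (Z : QSCFA A) (α : State A) : Prop :=
  α ≫ Z.comul ≫ (A ◁ DaggerSMC.dag α) ≫ (ρ_ A).hom = Z.one

/-- The multiplication that `Z` induces on states; it is the addition of phase states. -/
def add (Z : QSCFA A) (α β : State A) : State A :=
  (λ_ (𝟙_ C)).inv ≫ (α ⊗ₘ β) ≫ Z.mul

/-- The sum of a finite sequence of states. -/
def sum (Z : QSCFA A) : (n : ℕ) → (Fin n → State A) → State A
  | 0, _ => Z.one
  | n + 1, α => Z.add (α 0) (Z.sum n fun i => α i.succ)

/-- The phase (a map `A ⟶ A`) of a phase state: multiplication by that state. -/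
def phaseMap (Z : QSCFA A) (α : State A) : A ⟶ A :=
  (λ_ A).inv ≫ (α ▷ A) ≫ Z.mul

/-- The type of phase states. -/
def PhaseState (Z : QSCFA A) := {α : State A // Z.IsPhaseState α}

end QSCFA

/-- Strong complementarity: the bialgebra equation and the two coherence equations. (The versions
with the roles of `Z` and `X` exchanged are the daggers of these.) -/
structure StronglyComplementary {A : C} (Z X : QSCFA A) : Prop where
  bialgebra : X.mul ≫ Z.comul = (Z.comul ⊗ₘ Z.comul) ≫ tensorμ A A A A ≫ (X.mul ⊗ₘ X.mul)
  unit_copy : X.one ≫ Z.comul = (λ_ (𝟙_ C)).inv ≫ (X.one ⊗ₘ X.one)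
  counit_copy : X.mul ≫ Z.counit = (Z.counit ⊗ₘ Z.counit) ≫ (λ_ (𝟙_ C)).hom

/-! ### Tensor powers -/

/-- The tensor power `A ⊗ (A ⊗ (⋯ ⊗ (A ⊗ 𝟙)))` with `n` factors `A`. -/
def tpow (A : C) : ℕ → C
  | 0 => 𝟙_ C
  | n + 1 => A ⊗ tpow A n

/-- The tensor product of `n` morphisms. -/
def tpowMap {A B : C} : (n : ℕ) → (Fin n → (A ⟶ B)) → (tpow A n ⟶ tpow B n)
  | 0, _ => 𝟙 (𝟙_ C)
  | n + 1, f => f 0 ⊗ₘ tpowMap n fun i => f i.succ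

/-- The rearrangement of wires `(A ⊗ B)^⊗n ⟶ A^⊗n ⊗ B^⊗n`. -/
def unzip (A B : C) : (n : ℕ) → (tpow (A ⊗ B) n ⟶ tpow A n ⊗ tpow B n)
  | 0 => (λ_ (𝟙_ C)).inv
  | n + 1 => ((A ⊗ B) ◁ unzip A B n) ≫ tensorμ A B (tpow A n) (tpow B n)

/-- The effect `A^⊗n ⟶ 𝟙` that applies the effect `e` to all the wires. -/
def discardAll {A : C} (e : A ⟶ 𝟙_ C) : (n : ℕ) → (tpow A n ⟶ 𝟙_ C)
  | 0 => 𝟙 (𝟙_ C)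
  | n + 1 => (e ⊗ₘ discardAll e n) ≫ (λ_ (𝟙_ C)).hom

/-- The map `A^⊗n ⟶ A` that applies the effect `e` to all the wires except the one with number
`s`. -/
def keep {A : C} (e : A ⟶ 𝟙_ C) : (n : ℕ) → Fin n → (tpow A n ⟶ A)
  | n + 1, s =>
    Fin.cases (motive := fun _ => tpow A (n + 1) ⟶ A)
      ((A ◁ discardAll e n) ≫ (ρ_ A).hom)
      (fun t => (e ▷ tpow A n) ≫ (λ_ (tpow A n)).hom ≫ keep e n t) s

namespace QSCFA

variable {A : C}

/-- The node with one input and `n` outputs. -/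
def copies (Z : QSCFA A) : (n : ℕ) → (A ⟶ tpow A n)
  | 0 => Z.counit
  | n + 1 => Z.comul ≫ (A ◁ Z.copies n)

/-- The `n`-partite GHZ state: the node with no input and `n` outputs. -/
def ghz (Z : QSCFA A) (n : ℕ) : State (tpow A n) := Z.one ≫ Z.copies n

/-- Copy the wire number `r` out of `n` wires; the new copy comes first. -/
def copyWire (X : QSCFA A) : (n : ℕ) → Fin n → (tpow A n ⟶ A ⊗ tpow A n)
  | n + 1, r =>
    Fin.cases (motive := fun _ => tpow A (n + 1) ⟶ A ⊗ tpow A (n + 1))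
      ((X.comul ▷ tpow A n) ≫ (α_ A A (tpow A n)).hom)
      (fun t => (A ◁ X.copyWire n t) ≫ (α_ A A (tpow A n)).inv ≫
        ((β_ A A).hom ▷ tpow A n) ≫ (α_ A A (tpow A n)).hom) r

end QSCFA

/-! ### Mermin measurements, scenarios, and local hidden variable models -/

/-- The GHZ state of `Z` after the phases `α i` have been applied to its components. -/
def phasedGHZ {A : C} (Z : QSCFA A) (N : ℕ) (α : Fin N → State A) : State (tpow A N) :=
  Z.ghz N ≫ tpowMap N fun i => Z.phaseMap (α i)

/-- The (doubled) Mermin measurement: the pure state `phasedGHZ Z N α` and its conjugate, with each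
component measured in the structure `X`. The wires of the conjugate are bent, as in the definition
of phase states. -/
def merminMeasurement {A : C} (Z X : QSCFA A) (N : ℕ) (α : Fin N → State A) : State (tpow A N) :=
  phasedGHZ Z N α ≫ (tpowMap N fun _ => X.comul) ≫ unzip A A N ≫
    (tpow A N ◁ DaggerSMC.dag (phasedGHZ Z N α)) ≫ (ρ_ (tpow A N)).hom

/-- An `N`-partite Mermin measurement scenario with measurements `s = 0, …, S - 1`, where `S > 0`.
The distinct phases that appear are `a 0, …, a (M - 1)`; the `s`-th measurement applies the phase
`a (idx s i)` to the `i`-th system. The phases of each measurement sum to an `X`-classical point. -/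
structure Scenario {A : C} (Z X : QSCFA A) where
  N : ℕ
  S : ℕ
  S_pos : 0 < S
  M : ℕ
  a : Fin M → State A
  a_phase : ∀ r, Z.IsPhaseState (a r)
  a_injective : Function.Injective a
  idx : Fin S → Fin N → Fin M
  idx_surjective : ∀ r, ∃ s i, idx s i = r
  sum_classical : ∀ s, X.IsClassical (Z.sum N fun i => a (idx s i))

/-- For one measurement, given by `idx : Fin N → Fin M`: from `N` groups of `M` wires, copy out of
the `i`-th group the wire `idx i`, for all `i`. -/
def copyOut {A : C} (X : QSCFA A) (N M : ℕ) (idx : Fin N → Fin M) :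
    tpow (tpow A M) N ⟶ tpow A N ⊗ tpow (tpow A M) N :=
  (tpowMap N fun i => X.copyWire M (idx i)) ≫ unzip A (tpow A M) N

/-- The local map, from `N` groups of `M` wires (the `r`-th wire of the `i`-th group is the `a r`
input wire for system `i`) to `S` groups of `N` wires (the `i`-th wire of the `s`-th group is the
`i`-th output wire for measurement `s`). Each input wire is connected to an `X` node, which is
connected to the `i`-th output wire for measurement `s` for exactly those `s` with `idx s i = r`:
the node is built by copying the wire once for each such `s` and discarding it in the end. -/
def localMap {A : C} (X : QSCFA A) (N M : ℕ) :
    (S : ℕ) → (Fin S → Fin N → Fin M) → (tpow (tpow A M) N ⟶ tpow (tpow A N) S)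
  | 0, _ => discardAll (discardAll X.counit M) N
  | S + 1, idx => copyOut X N M (idx 0) ≫
      (tpow A N ◁ localMap X N M S fun s => idx s.succ)

/-- The state `Λ'` gives a local hidden variable model: for each `s`, applying the local map, and
then the counit of `X` to the output wires of all measurements other than `s`, gives the `s`-th
Mermin measurement. -/
def Scenario.IsLHV {A : C} {Z X : QSCFA A} (σ : Scenario Z X)
    (Λ' : State (tpow (tpow A σ.M) σ.N)) : Prop :=
  ∀ s : Fin σ.S,
    merminMeasurement Z X σ.N (fun i => σ.a (σ.idx s i)) =
      Λ' ≫ localMap X σ.N σ.M σ.S σ.idx ≫ keep (discardAll X.counit σ.N) σ.S s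

end Abstract

/-- A dagger symmetric monoidal category is Mermin local if every Mermin scenario, for every
strongly complementary pair of quasi-special commutative dagger Frobenius algebras, has a local
hidden variable model. -/
def MerminLocal (C : Type u) [Category.{v} C] [MonoidalCategory C] [SymmetricCategory C]
    [DaggerSMC C] : Prop :=
  ∀ (A : C) (Z X : QSCFA A), StronglyComplementary Z X →
    ∀ σ : Scenario Z X, ∃ Λ' : State (tpow (tpow A σ.M) σ.N), σ.IsLHV Λ'

/-- The abelian group `G` is a trivial algebraic extension of its subgroup `H`: every finite system
of equations `∑ j, n p j • x j = h p`, with integers `n p j` and with `h p ∈ H`, which has a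
solution in `G` has a solution in `H`. -/
def TrivialAlgebraicExtension {G : Type*} [AddCommGroup G] (H : AddSubgroup G) : Prop :=
  ∀ (k l : ℕ) (n : Fin k → Fin l → ℤ) (h : Fin k → H),
    (∃ x : Fin l → G, ∀ p, ∑ j, n p j • x j = (h p : G)) →
    ∃ y : Fin l → H, ∀ p, ∑ j, n p j • y j = h p

/-! ## Qutrit stabilizer quantum mechanics -/

/-- A register of qutrits, labelled by a finite set. -/
structure Register where
  wires : Type
  [fintype : Fintype wires]
  [decidableEq : DecidableEq wires]

attribute [instance] Register.fintype Register.decidableEq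

/-- The labels of the computational basis vectors of a register. -/
abbrev Register.Basis (A : Register) := A.wires → ZMod 3

/-- The empty register. -/
abbrev Register.empty : Register := ⟨Empty⟩

/-- A single qutrit. -/
abbrev Register.qutrit : Register := ⟨Unit⟩

/-- Two registers next to each other. -/
abbrev Register.tensor (A B : Register) : Register := ⟨A.wires ⊕ B.wires⟩

/-- Linear maps from the register `A` to the register `B`, in the computational basis. -/
abbrev LinMap (A B : Register) := Matrix B.Basis A.Basis ℂ

/-- The tensor product (Kronecker product) of linear maps. -/
def LinMap.tensor {A B A' B' : Register} (f : LinMap A B) (g : LinMap A' B') :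
    LinMap (A.tensor A') (B.tensor B') :=
  fun y x => f (fun i => y (Sum.inl i)) (fun i => x (Sum.inl i)) *
    g (fun i => y (Sum.inr i)) (fun i => x (Sum.inr i))

/-- The relabelling of a register. -/
def LinMap.relabel {A B : Register} (e : A.wires ≃ B.wires) : LinMap A B :=
  fun y x => if x = y ∘ e then 1 else 0

/-- The state `|0⟩` of a qutrit. -/
def LinMap.ketZero : LinMap Register.empty Register.qutrit :=
  fun y _ => if y = 0 then 1 else 0

open scoped Matrix in
/-- The generalised Pauli operator that sends `|x⟩` to `ω ^ (∑ i, b i * x i) |x + a⟩`, where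
`ω = exp (2 π i / 3)`. -/
noncomputable def pauli {A : Register} (a b : A.Basis) : LinMap A A :=
  fun y x => if y = x + a then ZMod.stdAddChar (b ⬝ᵥ x) else 0

open scoped Matrix in
/-- Clifford unitaries: the unitaries that normalise the Pauli group
`{ω ^ k • pauli a b | k, a, b}`. -/
def IsClifford {A : Register} (U : LinMap A A) : Prop :=
  U ∈ Matrix.unitaryGroup A.Basis ℂ ∧
    ∀ a b : A.Basis, ∃ (k : ZMod 3) (a' b' : A.Basis),
      U * pauli a b * Uᴴ = (ZMod.stdAddChar k : ℂ) • pauli a' b'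

open scoped Matrix in
/-- Stabilizer maps: the linear maps that are generated by the preparation of `|0⟩`, Clifford
unitaries and scalars under composition, tensor products and adjoints (which give
post-selected measurement outcomes); relabellings of the wires are structural. -/
inductive IsStabilizer : {A B : Register} → LinMap A B → Prop
  | ketZero : IsStabilizer LinMap.ketZero
  | clifford {A : Register} (U : LinMap A A) : IsClifford U → IsStabilizer U
  | relabel {A B : Register} (e : A.wires ≃ B.wires) : IsStabilizer (LinMap.relabel e)
  | smul {A B : Register} (c : ℂ) (f : LinMap A B) : IsStabilizer f → IsStabilizer (c • f)
  | comp {A B D : Register} (f : LinMap A B) (g : LinMap B D) :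
      IsStabilizer f → IsStabilizer g → IsStabilizer (g * f)
  | tensor {A B A' B' : Register} (f : LinMap A B) (g : LinMap A' B') :
      IsStabilizer f → IsStabilizer g → IsStabilizer (f.tensor g)
  | adjoint {A B : Register} (f : LinMap A B) : IsStabilizer f → IsStabilizer fᴴ

/-- Equality of stabilizer maps up to a global phase. -/
instance phaseSetoid (A B : Register) : Setoid {f : LinMap A B // IsStabilizer f} where
  r f g := ∃ c : ℂ, ‖c‖ = 1 ∧ g.1 = c • f.1
  iseqv :=
    { refl := fun f => ⟨1, by simp, by simp⟩
      symm := by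
        rintro f g ⟨c, hc, h⟩
        have h0 : c ≠ 0 := by
          rintro rfl
          simp at hc
        exact ⟨c⁻¹, by simp [hc], by rw [h, smul_smul, inv_mul_cancel₀ h0, one_smul]⟩
      trans := by
        rintro f g k ⟨c, hc, h⟩ ⟨d, hd, h'⟩
        exact ⟨d * c, by simp [hc, hd], by rw [h', h, smul_smul]⟩ }

/-- The morphisms of qutrit stabilizer quantum mechanics: stabilizer maps up to a global phase. -/
def StabHom (A B : Register) := Quotient (phaseSetoid A B)

namespace StabHom

/-- The morphism given by a stabilizer map. -/
def mk {A B : Register} (f : LinMap A B) (hf : IsStabilizer f) : StabHom A B :=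
  Quotient.mk (phaseSetoid A B) ⟨f, hf⟩

/-- The matrix `f` represents the morphism `φ`. -/
def Represents {A B : Register} (f : LinMap A B) (φ : StabHom A B) : Prop :=
  ∃ hf : IsStabilizer f, φ = mk f hf

theorem exists_rep {A B : Register} (φ : StabHom A B) : ∃ f hf, φ = mk f hf :=
  Quotient.inductionOn (motive := fun φ => ∃ f hf, φ = mk f hf) φ fun f => ⟨f.1, f.2, rfl⟩

theorem mk_congr {A B : Register} {f g : LinMap A B} {hf : IsStabilizer f} {hg : IsStabilizer g}
    (h : f = g) : mk f hf = mk g hg := by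
  subst h
  rfl

/-- The relabelling of a register. -/
def relabel {A B : Register} (e : A.wires ≃ B.wires) : StabHom A B :=
  mk (LinMap.relabel e) (.relabel e)

/-- Composition, in diagrammatic order. -/
def comp {A B D : Register} : StabHom A B → StabHom B D → StabHom A D :=
  Quotient.map₂ (fun f g => ⟨g.1 * f.1, .comp f.1 g.1 f.2 g.2⟩) (by
    rintro f f' ⟨c, hc, h⟩ g g' ⟨d, hd, h'⟩
    refine ⟨c * d, by simp [hc, hd], ?_⟩
    simp only [h, h', Matrix.smul_mul, Matrix.mul_smul, smul_smul])

theorem LinMap_smul_tensor_smul {A B A' B' : Register} (c d : ℂ) (f : LinMap A B)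
    (g : LinMap A' B') : (c • f).tensor (d • g) = (c * d) • f.tensor g := by
  ext y x
  simp only [LinMap.tensor, Matrix.smul_apply, smul_eq_mul]
  ring

/-- The tensor product of morphisms. -/
def tensor {A B A' B' : Register} :
    StabHom A B → StabHom A' B' → StabHom (A.tensor A') (B.tensor B') :=
  Quotient.map₂ (fun f g => ⟨f.1.tensor g.1, .tensor f.1 g.1 f.2 g.2⟩) (by
    rintro f f' ⟨c, hc, h⟩ g g' ⟨d, hd, h'⟩
    refine ⟨c * d, by simp [hc, hd], ?_⟩
    simp only [h, h', LinMap_smul_tensor_smul])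

open scoped Matrix in
/-- The adjoint of a morphism. -/
def adjoint {A B : Register} : StabHom A B → StabHom B A :=
  Quotient.map (fun f => ⟨f.1ᴴ, .adjoint f.1 f.2⟩) (by
    rintro f f' ⟨c, hc, h⟩
    exact ⟨star c, by simp [hc], by simp only [h, Matrix.conjTranspose_smul]⟩)

end StabHom

/-! ### The category of qutrit stabilizer maps -/

section Lemmas

open scoped Matrix

variable {A B D A' B' D' : Register}

theorem relabel_mul_apply (e : B.wires ≃ D.wires) (f : LinMap A B) (y : D.Basis) (x : A.Basis) :
    ((LinMap.relabel e : LinMap B D) * f) y x = f (y ∘ e) x := by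
  simp [Matrix.mul_apply, LinMap.relabel]

theorem mul_relabel_apply (e : A.wires ≃ B.wires) (f : LinMap B D) (y : D.Basis) (x : A.Basis) :
    (f * (LinMap.relabel e : LinMap A B)) y x = f y (x ∘ e.symm) := by
  rw [Matrix.mul_apply, Finset.sum_eq_single (x ∘ e.symm)]
  · simp [LinMap.relabel, Function.comp_assoc]
  · intro b _ hb
    have : x ≠ b ∘ e := by
      rintro rfl
      exact hb (by simp [Function.comp_assoc])
    simp [LinMap.relabel, this]
  · simp

theorem relabel_refl : (LinMap.relabel (Equiv.refl A.wires) : LinMap A A) = 1 := by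
  ext y x
  simp [LinMap.relabel, Matrix.one_apply, eq_comm]

theorem relabel_trans (e : A.wires ≃ B.wires) (e' : B.wires ≃ D.wires) :
    (LinMap.relabel (e.trans e') : LinMap A D) =
      (LinMap.relabel e' : LinMap B D) * (LinMap.relabel e : LinMap A B) := by
  ext y x
  rw [relabel_mul_apply]
  rfl

theorem relabel_conjTranspose (e : A.wires ≃ B.wires) :
    (LinMap.relabel e : LinMap A B)ᴴ = (LinMap.relabel e.symm : LinMap B A) := by
  ext y x
  have : y = x ∘ e ↔ x = y ∘ e.symm :=
    ⟨fun h => by simp [h, Function.comp_assoc], fun h => by simp [h, Function.comp_assoc]⟩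
  by_cases h : y = x ∘ e
  · simp [LinMap.relabel, Matrix.conjTranspose_apply, h, Function.comp_assoc]
  · rw [Matrix.conjTranspose_apply]
    simp only [LinMap.relabel, if_neg h, if_neg (fun k => h (this.2 k)), star_zero]

theorem tensor_mul (f : LinMap A B) (g : LinMap B D) (f' : LinMap A' B') (g' : LinMap B' D') :
    LinMap.tensor (A := A) (B := D) (A' := A') (B' := D') (g * f) (g' * f') = (g.tensor g') * (f.tensor f') := by
  ext y x
  rw [Matrix.mul_apply]
  rw [← (Equiv.sumArrowEquivProdArrow B.wires B'.wires (ZMod 3)).symm.sum_comp]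
  simp only [LinMap.tensor, Matrix.mul_apply, Fintype.sum_prod_type, Finset.sum_mul_sum]
  refine Finset.sum_congr rfl fun u _ => Finset.sum_congr rfl fun v _ => ?_
  simp only [Equiv.sumArrowEquivProdArrow_symm_apply_inl,
    Equiv.sumArrowEquivProdArrow_symm_apply_inr]
  ring

theorem relabel_tensor (e : A.wires ≃ B.wires) (e' : A'.wires ≃ B'.wires) :
    (LinMap.relabel e : LinMap A B).tensor (LinMap.relabel e' : LinMap A' B') =
      (LinMap.relabel (Equiv.sumCongr e e') : LinMap (A.tensor A') (B.tensor B')) := by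
  ext y x
  have : x = y ∘ (Equiv.sumCongr e e') ↔
      ((fun i => x (Sum.inl i)) = (fun i => y (Sum.inl i)) ∘ e ∧
        (fun i => x (Sum.inr i)) = (fun i => y (Sum.inr i)) ∘ e') := by
    constructor
    · rintro rfl
      exact ⟨rfl, rfl⟩
    · rintro ⟨h, h'⟩
      funext i
      rcases i with i | i
      · exact congrFun h i
      · exact congrFun h' i
  simp only [LinMap.relabel, LinMap.tensor, mul_ite, _root_.mul_one, mul_zero]
  by_cases h : x = y ∘ (Equiv.sumCongr e e')
  · rw [if_pos h, if_pos (this.1 h).2, if_pos (this.1 h).1]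
  · rw [if_neg h]
    split_ifs with h1 h2
    · exact absurd (this.2 ⟨h2, h1⟩) h
    · rfl
    · rfl

/-- The associator. -/
def LinMap.assoc (A B D : Register) :
    LinMap ((A.tensor B).tensor D) (A.tensor (B.tensor D)) :=
  LinMap.relabel (A := (A.tensor B).tensor D) (B := A.tensor (B.tensor D))
    (Equiv.sumAssoc A.wires B.wires D.wires)

/-- The left unitor. -/
def LinMap.leftUnitor (A : Register) : LinMap (Register.empty.tensor A) A :=
  LinMap.relabel (A := Register.empty.tensor A) (B := A) (Equiv.emptySum Empty A.wires)

/-- The right unitor. -/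
def LinMap.rightUnitor (A : Register) : LinMap (A.tensor Register.empty) A :=
  LinMap.relabel (A := A.tensor Register.empty) (B := A) (Equiv.sumEmpty A.wires Empty)

/-- The braiding. -/
def LinMap.braiding (A B : Register) : LinMap (A.tensor B) (B.tensor A) :=
  LinMap.relabel (A := A.tensor B) (B := B.tensor A) (Equiv.sumComm A.wires B.wires)

theorem associator_natural (f : LinMap A A') (g : LinMap B B') (k : LinMap D D') :
    LinMap.assoc A' B' D' * (f.tensor g).tensor k =
      f.tensor (g.tensor k) * LinMap.assoc A B D := by
  ext y x
  rw [LinMap.assoc, LinMap.assoc, relabel_mul_apply, mul_relabel_apply]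
  simp only [LinMap.tensor, mul_assoc]
  rfl

theorem leftUnitor_natural (f : LinMap A B) :
    LinMap.leftUnitor B *
        LinMap.tensor (LinMap.relabel (Equiv.refl Register.empty.wires) :
          LinMap Register.empty Register.empty) f =
      f * LinMap.leftUnitor A := by
  ext y x
  rw [LinMap.leftUnitor, LinMap.leftUnitor, relabel_mul_apply, mul_relabel_apply, relabel_refl]
  simp only [LinMap.tensor, Matrix.one_apply]
  rw [if_pos (Subsingleton.elim (α := Empty → ZMod 3) _ _), _root_.one_mul]
  rfl

theorem rightUnitor_natural (f : LinMap A B) :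
    LinMap.rightUnitor B *
        LinMap.tensor f (LinMap.relabel (Equiv.refl Register.empty.wires) :
          LinMap Register.empty Register.empty) =
      f * LinMap.rightUnitor A := by
  ext y x
  rw [LinMap.rightUnitor, LinMap.rightUnitor, relabel_mul_apply, mul_relabel_apply, relabel_refl]
  simp only [LinMap.tensor, Matrix.one_apply]
  rw [if_pos (Subsingleton.elim (α := Empty → ZMod 3) _ _), _root_.mul_one]
  rfl

theorem braiding_natural (f : LinMap A A') (g : LinMap B B') :
    LinMap.braiding A' B' * f.tensor g = g.tensor f * LinMap.braiding A B := by
  ext y x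
  rw [LinMap.braiding, LinMap.braiding, relabel_mul_apply, mul_relabel_apply]
  simp only [LinMap.tensor, mul_comm]
  rfl

theorem tensor_conjTranspose (f : LinMap A B) (g : LinMap A' B') :
    (f.tensor g)ᴴ = LinMap.tensor fᴴ gᴴ := by
  ext y x
  simp [LinMap.tensor, Matrix.conjTranspose_apply]

end Lemmas

namespace StabHom

variable {A B D A' B' D' : Register}

theorem comp_mk (f : LinMap A B) (hf) (g : LinMap B D) (hg) :
    comp (mk f hf) (mk g hg) = mk (g * f) (.comp f g hf hg) := rfl

theorem tensor_mk (f : LinMap A B) (hf) (g : LinMap A' B') (hg) :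
    tensor (mk f hf) (mk g hg) = mk (f.tensor g) (.tensor f g hf hg) := rfl

open scoped Matrix in
theorem adjoint_mk (f : LinMap A B) (hf) : adjoint (mk f hf) = mk fᴴ (.adjoint f hf) := rfl

/-- The identity. -/
def id (A : Register) : StabHom A A := relabel (Equiv.refl A.wires)

/-- The associator. -/
def assoc (A B D : Register) : StabHom ((A.tensor B).tensor D) (A.tensor (B.tensor D)) :=
  relabel (Equiv.sumAssoc A.wires B.wires D.wires)

/-- The inverse of the associator. -/
def assocInv (A B D : Register) : StabHom (A.tensor (B.tensor D)) ((A.tensor B).tensor D) :=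
  relabel (Equiv.sumAssoc A.wires B.wires D.wires).symm

/-- The left unitor. -/
def leftUnitor (A : Register) : StabHom (Register.empty.tensor A) A :=
  relabel (Equiv.emptySum Empty A.wires)

/-- The right unitor. -/
def rightUnitor (A : Register) : StabHom (A.tensor Register.empty) A :=
  relabel (Equiv.sumEmpty A.wires Empty)

/-- The braiding. -/
def braiding (A B : Register) : StabHom (A.tensor B) (B.tensor A) :=
  relabel (Equiv.sumComm A.wires B.wires)

theorem comp_relabel (e : A.wires ≃ B.wires) (e' : B.wires ≃ D.wires) :
    comp (relabel e) (relabel e') = relabel (e.trans e') :=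
  mk_congr (relabel_trans e e').symm

theorem tensor_relabel (e : A.wires ≃ B.wires) (e' : A'.wires ≃ B'.wires) :
    tensor (relabel e) (relabel e') =
      (relabel (Equiv.sumCongr e e') : StabHom (A.tensor A') (B.tensor B')) :=
  mk_congr (relabel_tensor e e')

theorem adjoint_relabel (e : A.wires ≃ B.wires) :
    adjoint (relabel e : StabHom A B) = (relabel e.symm : StabHom B A) :=
  mk_congr (relabel_conjTranspose e)

theorem relabel_congr {e e' : A.wires ≃ B.wires} (h : ∀ i, e i = e' i) :
    (relabel e : StabHom A B) = relabel e' := by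
  rw [Equiv.ext h]

end StabHom

open CategoryTheory MonoidalCategory

/-- Qutrit stabilizer quantum mechanics as a category. -/
instance : Category Register where
  Hom := StabHom
  id := StabHom.id
  comp := StabHom.comp
  id_comp φ := by
    obtain ⟨f, hf, rfl⟩ := StabHom.exists_rep φ
    refine StabHom.mk_congr ?_
    exact (congrArg (f * ·) relabel_refl).trans (Matrix.mul_one f)
  comp_id φ := by
    obtain ⟨f, hf, rfl⟩ := StabHom.exists_rep φ
    refine StabHom.mk_congr ?_
    exact (congrArg (· * f) relabel_refl).trans (Matrix.one_mul f)
  assoc φ χ ψ := by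
    obtain ⟨f, hf, rfl⟩ := StabHom.exists_rep φ
    obtain ⟨g, hg, rfl⟩ := StabHom.exists_rep χ
    obtain ⟨k, hk, rfl⟩ := StabHom.exists_rep ψ
    exact StabHom.mk_congr (Matrix.mul_assoc _ _ _).symm

/-- The isomorphism given by a relabelling. -/
def relabelIso {A B : Register} (e : A.wires ≃ B.wires) : A ≅ B where
  hom := StabHom.relabel e
  inv := StabHom.relabel e.symm
  hom_inv_id := (StabHom.comp_relabel e e.symm).trans (StabHom.relabel_congr fun i => by simp)
  inv_hom_id := (StabHom.comp_relabel e.symm e).trans (StabHom.relabel_congr fun i => by simp)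

instance : MonoidalCategoryStruct Register where
  tensorObj := Register.tensor
  tensorUnit := Register.empty
  tensorHom φ χ := StabHom.tensor φ χ
  whiskerLeft A _ _ φ := StabHom.tensor (StabHom.id A) φ
  whiskerRight φ A := StabHom.tensor φ (StabHom.id A)
  associator A B D := relabelIso (Equiv.sumAssoc A.wires B.wires D.wires)
  leftUnitor A := relabelIso (Equiv.emptySum Empty A.wires)
  rightUnitor A := relabelIso (Equiv.sumEmpty A.wires Empty)

instance : MonoidalCategory Register := MonoidalCategory.ofTensorHom
  (id_tensorHom_id := fun A B => (StabHom.tensor_relabel _ _).trans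
    (StabHom.relabel_congr fun i => by rcases i with i | i <;> rfl))
  (tensorHom_comp_tensorHom := fun φ φ' χ χ' => by
    obtain ⟨f, hf, rfl⟩ := StabHom.exists_rep φ
    obtain ⟨f', hf', rfl⟩ := StabHom.exists_rep φ'
    obtain ⟨g, hg, rfl⟩ := StabHom.exists_rep χ
    obtain ⟨g', hg', rfl⟩ := StabHom.exists_rep χ'
    exact StabHom.mk_congr (tensor_mul _ _ _ _).symm)
  (associator_naturality := fun φ φ' φ'' => by
    obtain ⟨f, hf, rfl⟩ := StabHom.exists_rep φ
    obtain ⟨f', hf', rfl⟩ := StabHom.exists_rep φ'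
    obtain ⟨f'', hf'', rfl⟩ := StabHom.exists_rep φ''
    exact StabHom.mk_congr (associator_natural f f' f''))
  (leftUnitor_naturality := fun φ => by
    obtain ⟨f, hf, rfl⟩ := StabHom.exists_rep φ
    exact StabHom.mk_congr (leftUnitor_natural f))
  (rightUnitor_naturality := fun φ => by
    obtain ⟨f, hf, rfl⟩ := StabHom.exists_rep φ
    exact StabHom.mk_congr (rightUnitor_natural f))
  (pentagon := fun W X Y Z => by
    change StabHom.comp (StabHom.tensor (StabHom.assoc W X Y) (StabHom.id Z))
      (StabHom.comp (StabHom.assoc W (X.tensor Y) Z)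
        (StabHom.tensor (StabHom.id W) (StabHom.assoc X Y Z))) =
      StabHom.comp (StabHom.assoc (W.tensor X) Y Z) (StabHom.assoc W X (Y.tensor Z))
    simp only [StabHom.assoc, StabHom.id, StabHom.tensor_relabel, StabHom.comp_relabel]
    refine StabHom.relabel_congr fun i => ?_
    rcases i with ((i | i) | i) | i <;> rfl)
  (triangle := fun X Y => by
    change StabHom.comp (StabHom.assoc X Register.empty Y)
        (StabHom.tensor (StabHom.id X) (StabHom.leftUnitor Y)) =
      StabHom.tensor (StabHom.rightUnitor X) (StabHom.id Y)
    simp only [StabHom.assoc, StabHom.leftUnitor, StabHom.rightUnitor, StabHom.id,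
      StabHom.tensor_relabel, StabHom.comp_relabel]
    refine StabHom.relabel_congr fun i => ?_
    rcases i with (i | i) | i
    · rfl
    · exact i.elim
    · rfl)

instance : SymmetricCategory Register where
  braiding A B := relabelIso (A := A.tensor B) (B := B.tensor A)
    (Equiv.sumComm A.wires B.wires)
  braiding_naturality_right A _ _ φ := by
    obtain ⟨f, hf, rfl⟩ := StabHom.exists_rep φ
    exact StabHom.mk_congr (braiding_natural _ f)
  braiding_naturality_left φ B := by
    obtain ⟨f, hf, rfl⟩ := StabHom.exists_rep φ
    exact StabHom.mk_congr (braiding_natural f _)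
  hexagon_forward X Y Z := by
    change StabHom.comp (StabHom.assoc X Y Z)
      (StabHom.comp (StabHom.braiding X (Y.tensor Z)) (StabHom.assoc Y Z X)) =
      StabHom.comp (StabHom.tensor (StabHom.braiding X Y) (StabHom.id Z))
        (StabHom.comp (StabHom.assoc Y X Z)
          (StabHom.tensor (StabHom.id Y) (StabHom.braiding X Z)))
    simp only [StabHom.assoc, StabHom.braiding, StabHom.id,
      StabHom.tensor_relabel, StabHom.comp_relabel]
    refine StabHom.relabel_congr fun i => ?_
    rcases i with (i | i) | i <;> rfl
  hexagon_reverse X Y Z := by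
    change StabHom.comp (StabHom.assocInv X Y Z)
      (StabHom.comp (StabHom.braiding (X.tensor Y) Z) (StabHom.assocInv Z X Y)) =
      StabHom.comp (StabHom.tensor (StabHom.id X) (StabHom.braiding Y Z))
        (StabHom.comp (StabHom.assocInv X Z Y)
          (StabHom.tensor (StabHom.braiding X Z) (StabHom.id Y)))
    simp only [StabHom.assocInv, StabHom.braiding, StabHom.id,
      StabHom.tensor_relabel, StabHom.comp_relabel]
    refine StabHom.relabel_congr fun i => ?_
    rcases i with i | i | i <;> rfl
  symmetry X Y := by
    change StabHom.comp (StabHom.braiding X Y) (StabHom.braiding Y X) = StabHom.id (X.tensor Y)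
    simp only [StabHom.braiding, StabHom.id, StabHom.comp_relabel]
    refine StabHom.relabel_congr fun i => ?_
    rcases i with i | i <;> rfl

/-- Qutrit stabilizer quantum mechanics is a dagger symmetric monoidal category; the dagger is the
adjoint. -/
noncomputable instance : DaggerSMC Register where
  dag := StabHom.adjoint
  dag_id A := StabHom.adjoint_relabel (Equiv.refl A.wires)
  dag_comp φ χ := by
    obtain ⟨f, hf, rfl⟩ := StabHom.exists_rep φ
    obtain ⟨g, hg, rfl⟩ := StabHom.exists_rep χ
    exact StabHom.mk_congr (Matrix.conjTranspose_mul g f)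
  dag_dag φ := by
    obtain ⟨f, hf, rfl⟩ := StabHom.exists_rep φ
    exact StabHom.mk_congr (Matrix.conjTranspose_conjTranspose f)
  dag_tensor φ χ := by
    obtain ⟨f, hf, rfl⟩ := StabHom.exists_rep φ
    obtain ⟨g, hg, rfl⟩ := StabHom.exists_rep χ
    exact StabHom.mk_congr (tensor_conjTranspose f g)
  dag_associator A B D := StabHom.adjoint_relabel (A := (A.tensor B).tensor D)
    (B := A.tensor (B.tensor D)) (Equiv.sumAssoc A.wires B.wires D.wires)
  dag_leftUnitor A := StabHom.adjoint_relabel (A := Register.empty.tensor A) (B := A)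
    (Equiv.emptySum Empty A.wires)
  dag_rightUnitor A := StabHom.adjoint_relabel (A := A.tensor Register.empty) (B := A)
    (Equiv.sumEmpty A.wires Empty)
  dag_braiding A B := StabHom.adjoint_relabel (A := A.tensor B) (B := B.tensor A)
    (Equiv.sumComm A.wires B.wires)

/-- The dagger symmetric monoidal category of qutrit stabilizer quantum mechanics. -/
abbrev QutritStab := Register

/-! ### The two observables of a qutrit -/

/-- The linear map with `|a⟩ ⊗ |b⟩ ↦ |a⟩` if `a = b`, and `|a⟩ ⊗ |b⟩ ↦ 0` otherwise, whose adjoint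
copies the computational basis. -/
def zMul : LinMap (Register.qutrit.tensor Register.qutrit) Register.qutrit :=
  fun y x => if x (Sum.inl ()) = y () ∧ x (Sum.inr ()) = y () then 1 else 0

/-- The vector `|0⟩ + |1⟩ + |2⟩`. -/
def zOne : LinMap Register.empty Register.qutrit := fun _ _ => 1

/-- The linear map `|a⟩ ⊗ |b⟩ ↦ |a + b⟩`, whose adjoint copies the Fourier basis
`∑ z, ω ^ (k * z) |z⟩`. Its unit is `|0⟩`. -/
def xMul : LinMap (Register.qutrit.tensor Register.qutrit) Register.qutrit :=
  fun y x => if x (Sum.inl ()) + x (Sum.inr ()) = y () then 1 else 0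

end Mermin

/-! Locality. By the Frobenius law phases slide through the GHZ node and fuse, so a Mermin
measurement depends only on the sum of its phases (`QSCFA.phasedGHZ_eq`). Hence a scenario is local
as soon as its phases can be replaced, without changing the sums, by unitary phases that commute
with copying in `X` and are absorbed by its counit. Such phases act on measurement outcomes: measure
the bare GHZ state, copy every outcome once for each `r`, and apply the `r`-th new phase to the
`r`-th copy (`Scenario.exists_isLHV`). What is needed is a homomorphic projection of phases onto
classical phases, for every pair on every register.

The structure maps of a pair satisfy their laws only up to global phases, but the phases can be
normalised away. Multiplications in a commutative dagger Frobenius algebra are normal operators, so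
the `Z`-algebra is reduced and its characters give an orthogonal basis of copied vectors, the
points. Strong complementarity makes the points an abelian group `G` under the multiplication of
`X`; its order is a power of 3. A state becomes a function on `G`: addition of states is the
pointwise product, phase states are unimodular functions, and classical phase states are characters
up to a scalar.

The stabilizer input is `IsStabilizer.exists_isCompanion`: in the coordinates `(x + x', x - x')`,
two copies of a stabilizer map `f` split as the conjugate of `f` tensored with another map. The
reason is that this rotation turns two equal Pauli operators into one conjugate Pauli operator on
the first factor, because `-2 = 1` modulo 3. The splitting is compatible with composition and can
therefore be transported from basis labels to points: `F (m + d) * F (m - d) = P m * R d` for the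
function `F` of a stabilizer state (`IsComplementary.exists_product`). So phases are quadratic. The
odd part `F g * star (F (-g))` is then a character, and it is again given by a stabilizer state. Its
power with exponent `(|G| + 1) / 2`, the inverse of 2 modulo `|G|`, is the required projection: it
is multiplicative in `F` and returns a classical phase up to its global phase
(`smul_eq_pow_of_quasi_character`).

For a single qutrit the same companion identity makes the cube of a unimodular stabilizer vector
constant. After normalisation its entries are cube roots of unity, and every such function on three
labels is `ω ^ (l x + q x²)`. Thus the phase group is `ℤ₃ × ℤ₃`, the classical points are given by
`q = 0`, and forgetting `q` is a retraction, which carries solutions of equations into the subgroup.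
-/

namespace Mermin

open CategoryTheory MonoidalCategory

universe v u

set_option linter.unusedSectionVars false

/-! ### Fusion of phases in a dagger symmetric monoidal category -/

section Abstract

variable {C : Type u} [Category.{v} C] [MonoidalCategory C] [SymmetricCategory C] [DaggerSMC C]

namespace QSCFA

variable {A : C}

/-- The Frobenius law says that comultiplication is a map of modules, so multiplication by a state
may be done before or after it. -/
theorem phaseMap_comul_left (Z : QSCFA A) (a : State A) :
    Z.comul ≫ (Z.phaseMap a ▷ A) = Z.phaseMap a ≫ Z.comul := by
  have h := Z.frobenius_left
  simp only [phaseMap, comul, Category.assoc, ← h, comp_whiskerRight]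
  rw [← whisker_exchange_assoc, leftUnitor_inv_whiskerRight, Category.assoc,
    id_whiskerLeft_assoc, Iso.inv_hom_id_assoc, ← associator_inv_naturality_left_assoc]

theorem comul_comm (Z : QSCFA A) : Z.comul ≫ (β_ A A).hom = Z.comul := by
  have h := congrArg DaggerSMC.dag Z.mul_comm
  rw [DaggerSMC.dag_comp, DaggerSMC.dag_braiding] at h
  rw [comul]
  conv_lhs => rw [← h]
  simp

theorem phaseMap_comul_right (Z : QSCFA A) (a : State A) :
    Z.comul ≫ (A ◁ Z.phaseMap a) = Z.phaseMap a ≫ Z.comul := by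
  rw [← Z.comul_comm, Category.assoc, ← BraidedCategory.braiding_naturality_left,
    ← Category.assoc, phaseMap_comul_left, Category.assoc]

theorem phaseMap_add (Z : QSCFA A) (a b : State A) :
    Z.phaseMap (Z.add a b) = Z.phaseMap b ≫ Z.phaseMap a := by
  have h := Z.mul_assoc
  simp only [phaseMap, add, comp_whiskerRight, Category.assoc]
  rw [h, leftUnitor_inv_naturality_assoc, whisker_exchange_assoc]
  simp only [← Category.assoc]
  congr 2
  simp only [MonoidalCategory.tensorHom_def']
  monoidal

theorem phaseMap_one (Z : QSCFA A) : Z.phaseMap Z.one = 𝟙 A := by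
  rw [phaseMap, Z.one_mul, Iso.inv_hom_id]

theorem one_phaseMap (Z : QSCFA A) (a : State A) : Z.one ≫ Z.phaseMap a = a := by
  have h := Z.mul_one
  rw [phaseMap, leftUnitor_inv_naturality_assoc, whisker_exchange_assoc, h]
  simp [unitors_inv_equal]

/-- Each phase on an output leg can be pulled back to the input, where successive phases add up. -/
theorem copies_phaseMap (Z : QSCFA A) (n : ℕ) (a : Fin n → State A) :
    Z.copies n ≫ tpowMap n (fun i => Z.phaseMap (a i)) = Z.phaseMap (Z.sum n a) ≫ Z.copies n := by
  induction n with
  | zero =>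
    simp only [copies, tpowMap, sum, phaseMap_one]
    exact (Category.comp_id _).trans (Category.id_comp _).symm
  | succ n ih =>
    change (Z.comul ≫ (A ◁ Z.copies n)) ≫
        (Z.phaseMap (a 0) ⊗ₘ tpowMap n fun i => Z.phaseMap (a i.succ)) =
      Z.phaseMap (Z.add (a 0) (Z.sum n fun i => a i.succ)) ≫ (Z.comul ≫ (A ◁ Z.copies n))
    have hl := Z.phaseMap_comul_left (a 0)
    have hr := Z.phaseMap_comul_right (Z.sum n fun i => a i.succ)
    rw [phaseMap_add, Category.assoc, Category.assoc, ← reassoc_of% hl, ← reassoc_of% hr,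
      MonoidalCategory.tensorHom_def', ← whiskerLeft_comp_assoc, ih, whiskerLeft_comp_assoc,
      whisker_exchange]

/-- The right-hand side no longer sees the individual phases; this is what allows them to be
replaced by others with the same sum. -/
theorem phasedGHZ_eq (Z : QSCFA A) (n : ℕ) (a : Fin n → State A) :
    phasedGHZ Z n a = Z.sum n a ≫ Z.copies n := by
  rw [phasedGHZ, ghz, Category.assoc, copies_phaseMap, ← Category.assoc, one_phaseMap]

end QSCFA

theorem merminMeasurement_congr {A : C} (Z X : QSCFA A) (n : ℕ) {a b : Fin n → State A}
    (h : Z.sum n a = Z.sum n b) : merminMeasurement Z X n a = merminMeasurement Z X n b := by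
  simp only [merminMeasurement, QSCFA.phasedGHZ_eq, h]

/-! ### Wirewise maps, rearrangements and effects on tensor powers -/

theorem tpowMap_comp {A B D : C} (n : ℕ) (f : Fin n → (A ⟶ B)) (g : Fin n → (B ⟶ D)) :
    tpowMap n f ≫ tpowMap n g = tpowMap n fun i => f i ≫ g i := by
  induction n with
  | zero => exact Category.comp_id _
  | succ n ih =>
    change (f 0 ⊗ₘ tpowMap n fun i => f i.succ) ≫ (g 0 ⊗ₘ tpowMap n fun i => g i.succ) =
      ((f 0 ≫ g 0) ⊗ₘ tpowMap n fun i => f i.succ ≫ g i.succ)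
    rw [tensorHom_comp_tensorHom, ih]

theorem tpowMap_id (A : C) (n : ℕ) : tpowMap n (fun _ => 𝟙 A) = 𝟙 (tpow A n) := by
  induction n with
  | zero => rfl
  | succ n ih =>
    change (𝟙 A ⊗ₘ tpowMap n fun _ => 𝟙 A) = 𝟙 (A ⊗ tpow A n)
    rw [ih, id_tensorHom_id]

theorem dag_tpowMap {A B : C} (n : ℕ) (f : Fin n → (A ⟶ B)) :
    DaggerSMC.dag (tpowMap n f) = tpowMap n fun i => DaggerSMC.dag (f i) := by
  induction n with
  | zero => exact DaggerSMC.dag_id _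
  | succ n ih =>
    change DaggerSMC.dag (f 0 ⊗ₘ tpowMap n fun i => f i.succ) =
      (DaggerSMC.dag (f 0) ⊗ₘ tpowMap n fun i => DaggerSMC.dag (f i.succ))
    rw [DaggerSMC.dag_tensor, ih]

theorem tpowMap_unzip {A B A' B' : C} (n : ℕ) (f : Fin n → (A ⟶ A')) (g : Fin n → (B ⟶ B')) :
    tpowMap n (fun i => f i ⊗ₘ g i) ≫ unzip A' B' n =
      unzip A B n ≫ (tpowMap n f ⊗ₘ tpowMap n g) := by
  induction n with
  | zero =>
    change 𝟙 (𝟙_ C) ≫ (λ_ (𝟙_ C)).inv = (λ_ (𝟙_ C)).inv ≫ (𝟙 (𝟙_ C) ⊗ₘ 𝟙 (𝟙_ C))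
    simp
  | succ n ih =>
    change ((f 0 ⊗ₘ g 0) ⊗ₘ tpowMap n fun i => f i.succ ⊗ₘ g i.succ) ≫
        ((A' ⊗ B') ◁ unzip A' B' n) ≫ tensorμ A' B' (tpow A' n) (tpow B' n) =
      (((A ⊗ B) ◁ unzip A B n) ≫ tensorμ A B (tpow A n) (tpow B n)) ≫
        ((f 0 ⊗ₘ tpowMap n fun i => f i.succ) ⊗ₘ (g 0 ⊗ₘ tpowMap n fun i => g i.succ))
    rw [Category.assoc, ← tensorμ_natural, ← id_tensorHom, ← id_tensorHom,
      tensorHom_comp_tensorHom_assoc, tensorHom_comp_tensorHom_assoc, ih]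
    simp only [Category.id_comp, Category.comp_id]

theorem unzip_discard_left {A B : C} (e : A ⟶ 𝟙_ C) (n : ℕ) :
    unzip A B n ≫ (discardAll e n ▷ tpow B n) ≫ (λ_ (tpow B n)).hom =
      tpowMap n fun _ => (e ▷ B) ≫ (λ_ B).hom := by
  induction n with
  | zero =>
    change (λ_ (𝟙_ C)).inv ≫ (𝟙 (𝟙_ C) ▷ 𝟙_ C) ≫ (λ_ (𝟙_ C)).hom = 𝟙 (𝟙_ C)
    simp
  | succ n ih =>
    change (((A ⊗ B) ◁ unzip A B n) ≫ tensorμ A B (tpow A n) (tpow B n)) ≫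
        (((e ⊗ₘ discardAll e n) ≫ (λ_ (𝟙_ C)).hom) ▷ (B ⊗ tpow B n)) ≫
          (λ_ (B ⊗ tpow B n)).hom =
      (((e ▷ B) ≫ (λ_ B).hom) ⊗ₘ tpowMap n fun _ => (e ▷ B) ≫ (λ_ B).hom)
    have h := tensorμ_natural e (𝟙 B) (discardAll e n) (𝟙 (tpow B n))
    simp only [id_whiskerRight, tensorHom_id] at h
    rw [← ih, comp_whiskerRight, Category.assoc, Category.assoc, ← reassoc_of% h,
      ← leftUnitor_monoidal, ← id_tensorHom, tensorHom_comp_tensorHom, tensorHom_comp_tensorHom,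
      Category.id_comp]

theorem unzip_discard_right {A B : C} (e : B ⟶ 𝟙_ C) (n : ℕ) :
    unzip A B n ≫ (tpow A n ◁ discardAll e n) ≫ (ρ_ (tpow A n)).hom =
      tpowMap n fun _ => (A ◁ e) ≫ (ρ_ A).hom := by
  induction n with
  | zero =>
    change (λ_ (𝟙_ C)).inv ≫ (𝟙_ C ◁ 𝟙 (𝟙_ C)) ≫ (ρ_ (𝟙_ C)).hom = 𝟙 (𝟙_ C)
    simp [← unitors_equal]
  | succ n ih =>
    change (((A ⊗ B) ◁ unzip A B n) ≫ tensorμ A B (tpow A n) (tpow B n)) ≫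
        ((A ⊗ tpow A n) ◁ ((e ⊗ₘ discardAll e n) ≫ (λ_ (𝟙_ C)).hom)) ≫
          (ρ_ (A ⊗ tpow A n)).hom =
      (((A ◁ e) ≫ (ρ_ A).hom) ⊗ₘ tpowMap n fun _ => (A ◁ e) ≫ (ρ_ A).hom)
    have h := tensorμ_natural (𝟙 A) e (𝟙 (tpow A n)) (discardAll e n)
    simp only [MonoidalCategory.whiskerLeft_id, id_tensorHom] at h
    rw [← ih, whiskerLeft_comp, Category.assoc, Category.assoc, ← reassoc_of% h,
      ← rightUnitor_monoidal, ← id_tensorHom, tensorHom_comp_tensorHom, tensorHom_comp_tensorHom,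
      Category.id_comp]

theorem tpowMap_discardAll {A B : C} (e : A ⟶ 𝟙_ C) (e' : B ⟶ 𝟙_ C) (n : ℕ)
    (f : Fin n → (A ⟶ B)) (h : ∀ i, f i ≫ e' = e) :
    tpowMap n f ≫ discardAll e' n = discardAll e n := by
  induction n with
  | zero => exact Category.comp_id _
  | succ n ih =>
    change (f 0 ⊗ₘ tpowMap n fun i => f i.succ) ≫ (e' ⊗ₘ discardAll e' n) ≫ (λ_ (𝟙_ C)).hom =
      (e ⊗ₘ discardAll e n) ≫ (λ_ (𝟙_ C)).hom
    rw [tensorHom_comp_tensorHom_assoc, ih _ fun i => h i.succ, h]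

/-- Maps that preserve the discarding effects are invisible on the discarded wires, so only the map
on the kept wire survives. -/
theorem tpowMap_keep {A B : C} (e : A ⟶ 𝟙_ C) (e' : B ⟶ 𝟙_ C) (n : ℕ)
    (f : Fin n → (A ⟶ B)) (h : ∀ i, f i ≫ e' = e) (s : Fin n) :
    tpowMap n f ≫ keep e' n s = keep e n s ≫ f s := by
  induction n with
  | zero => exact s.elim0
  | succ n ih =>
    refine Fin.cases ?_ (fun t => ?_) s
    · change (f 0 ⊗ₘ tpowMap n fun i => f i.succ) ≫ (B ◁ discardAll e' n) ≫ (ρ_ B).hom =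
        ((A ◁ discardAll e n) ≫ (ρ_ A).hom) ≫ f 0
      rw [MonoidalCategory.tensorHom_def, Category.assoc, ← whiskerLeft_comp_assoc,
        tpowMap_discardAll e e' n _ fun i => h i.succ, ← whisker_exchange_assoc,
        rightUnitor_naturality, Category.assoc]
    · change (f 0 ⊗ₘ tpowMap n fun i => f i.succ) ≫ (e' ▷ tpow B n) ≫ (λ_ (tpow B n)).hom ≫
          keep e' n t = ((e ▷ tpow A n) ≫ (λ_ (tpow A n)).hom ≫ keep e n t) ≫ f t.succ
      rw [MonoidalCategory.tensorHom_def', Category.assoc, ← comp_whiskerRight_assoc, h,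
        whisker_exchange_assoc, leftUnitor_naturality_assoc, ih _ fun i => h i.succ]
      simp only [Category.assoc]

/-! ### Copying a wire and discarding copies -/

namespace QSCFA

variable {A : C}

theorem comul_counit_left (X : QSCFA A) : X.comul ≫ (X.counit ▷ A) ≫ (λ_ A).hom = 𝟙 A := by
  have h := congrArg DaggerSMC.dag X.one_mul
  rw [DaggerSMC.dag_comp, DaggerSMC.dag_leftUnitor, ← tensorHom_id, DaggerSMC.dag_tensor,
    DaggerSMC.dag_id, tensorHom_id] at h
  rw [comul, counit, reassoc_of% h, Iso.inv_hom_id]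

theorem comul_counit_right (X : QSCFA A) : X.comul ≫ (A ◁ X.counit) ≫ (ρ_ A).hom = 𝟙 A := by
  have h := congrArg DaggerSMC.dag X.mul_one
  rw [DaggerSMC.dag_comp, DaggerSMC.dag_rightUnitor, ← id_tensorHom, DaggerSMC.dag_tensor,
    DaggerSMC.dag_id, id_tensorHom] at h
  rw [comul, counit, reassoc_of% h, Iso.inv_hom_id]

theorem copies_discardAll (X : QSCFA A) (n : ℕ) :
    X.copies n ≫ discardAll X.counit n = X.counit := by
  induction n with
  | zero => exact Category.comp_id _
  | succ n ih =>
    change (X.comul ≫ (A ◁ X.copies n)) ≫ (X.counit ⊗ₘ discardAll X.counit n) ≫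
      (λ_ (𝟙_ C)).hom = X.counit
    rw [MonoidalCategory.tensorHom_def, Category.assoc, Category.assoc, whisker_exchange_assoc,
      ← whiskerLeft_comp_assoc, ih, leftUnitor_naturality, ← Category.assoc, ← Category.assoc,
      Category.assoc X.comul, comul_counit_left, Category.id_comp]

theorem copies_keep (X : QSCFA A) (n : ℕ) (r : Fin n) :
    X.copies n ≫ keep X.counit n r = 𝟙 A := by
  induction n with
  | zero => exact r.elim0
  | succ n ih =>
    refine Fin.cases ?_ (fun t => ?_) r
    · change (X.comul ≫ (A ◁ X.copies n)) ≫ (A ◁ discardAll X.counit n) ≫ (ρ_ A).hom = 𝟙 A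
      rw [Category.assoc, ← whiskerLeft_comp_assoc, copies_discardAll, comul_counit_right]
    · change (X.comul ≫ (A ◁ X.copies n)) ≫ (X.counit ▷ tpow A n) ≫ (λ_ (tpow A n)).hom ≫
        keep X.counit n t = 𝟙 A
      rw [Category.assoc, whisker_exchange_assoc, leftUnitor_naturality_assoc, ih,
        Category.comp_id, comul_counit_left]

theorem copyWire_discard_left (X : QSCFA A) (n : ℕ) (r : Fin n) :
    X.copyWire n r ≫ (X.counit ▷ tpow A n) ≫ (λ_ (tpow A n)).hom = 𝟙 (tpow A n) := by
  induction n with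
  | zero => exact r.elim0
  | succ n ih =>
    refine Fin.cases ?_ (fun t => ?_) r
    · change ((X.comul ▷ tpow A n) ≫ (α_ A A (tpow A n)).hom) ≫ (X.counit ▷ (A ⊗ tpow A n)) ≫
        (λ_ (A ⊗ tpow A n)).hom = 𝟙 (A ⊗ tpow A n)
      rw [← id_whiskerRight, ← X.comul_counit_left]
      monoidal
    · change ((A ◁ X.copyWire n t) ≫ (α_ A A (tpow A n)).inv ≫ ((β_ A A).hom ▷ tpow A n) ≫
        (α_ A A (tpow A n)).hom) ≫ (X.counit ▷ (A ⊗ tpow A n)) ≫ (λ_ (A ⊗ tpow A n)).hom =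
          𝟙 (A ⊗ tpow A n)
      have h : (β_ A A).hom ≫ (X.counit ▷ A) ≫ (λ_ A).hom = (A ◁ X.counit) ≫ (ρ_ A).hom := by
        rw [← BraidedCategory.braiding_naturality_right_assoc, braiding_leftUnitor]
      have h' : ((β_ A A).hom ▷ tpow A n) ≫ (α_ A A (tpow A n)).hom ≫
          (X.counit ▷ (A ⊗ tpow A n)) ≫ (λ_ (A ⊗ tpow A n)).hom =
          ((A ◁ X.counit) ≫ (ρ_ A).hom) ▷ tpow A n := by
        rw [← h]
        monoidal
      simp only [Category.assoc]
      rw [h', ← MonoidalCategory.whiskerLeft_id, ← ih t]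
      monoidal

/-- After everything but the new copy is discarded, the counit law at the copied wire leaves that
wire alone and all the others end in counits. -/
theorem copyWire_discard_right (X : QSCFA A) (n : ℕ) (r : Fin n) :
    X.copyWire n r ≫ (A ◁ discardAll X.counit n) ≫ (ρ_ A).hom = keep X.counit n r := by
  induction n with
  | zero => exact r.elim0
  | succ n ih =>
    refine Fin.cases ?_ (fun t => ?_) r
    · change ((X.comul ▷ tpow A n) ≫ (α_ A A (tpow A n)).hom) ≫
        (A ◁ ((X.counit ⊗ₘ discardAll X.counit n) ≫ (λ_ (𝟙_ C)).hom)) ≫ (ρ_ A).hom =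
          (A ◁ discardAll X.counit n) ≫ (ρ_ A).hom
      have h : (A ◁ discardAll X.counit n) ≫ (ρ_ A).hom =
          ((X.comul ≫ (A ◁ X.counit) ≫ (ρ_ A).hom) ▷ tpow A n) ≫
            (A ◁ discardAll X.counit n) ≫ (ρ_ A).hom := by
        rw [comul_counit_right, id_whiskerRight, Category.id_comp]
      rw [h, MonoidalCategory.tensorHom_def]
      monoidal
    · change ((A ◁ X.copyWire n t) ≫ (α_ A A (tpow A n)).inv ≫ ((β_ A A).hom ▷ tpow A n) ≫
        (α_ A A (tpow A n)).hom) ≫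
        (A ◁ ((X.counit ⊗ₘ discardAll X.counit n) ≫ (λ_ (𝟙_ C)).hom)) ≫ (ρ_ A).hom =
          (X.counit ▷ tpow A n) ≫ (λ_ (tpow A n)).hom ≫ keep X.counit n t
      have h : (β_ A A).hom ≫ (A ◁ X.counit) ≫ (ρ_ A).hom = (X.counit ▷ A) ≫ (λ_ A).hom := by
        rw [← BraidedCategory.braiding_naturality_left_assoc, braiding_rightUnitor]
      have h' : ((β_ A A).hom ▷ tpow A n) ≫ (α_ A A (tpow A n)).hom ≫
        (A ◁ ((X.counit ⊗ₘ discardAll X.counit n) ≫ (λ_ (𝟙_ C)).hom)) ≫ (ρ_ A).hom =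
          (((X.counit ▷ A) ≫ (λ_ A).hom) ▷ tpow A n) ≫ (A ◁ discardAll X.counit n) ≫
            (ρ_ A).hom := by
        rw [← h, MonoidalCategory.tensorHom_def]
        monoidal
      have h'' : (X.counit ▷ tpow A n) ≫ (λ_ (tpow A n)).hom ≫ X.copyWire n t =
          (A ◁ X.copyWire n t) ≫ (X.counit ▷ (A ⊗ tpow A n)) ≫ (λ_ (A ⊗ tpow A n)).hom := by
        rw [whisker_exchange_assoc, leftUnitor_naturality]
      simp only [Category.assoc]
      rw [h', ← ih t, reassoc_of% h'']
      monoidal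

end QSCFA

/-! ### Marginals of the local map and construction of hidden variables -/

theorem copyOut_discard_left {A : C} (X : QSCFA A) (N M : ℕ) (idx : Fin N → Fin M) :
    copyOut X N M idx ≫ (discardAll X.counit N ▷ tpow (tpow A M) N) ≫
      (λ_ (tpow (tpow A M) N)).hom = 𝟙 _ := by
  rw [copyOut, Category.assoc, unzip_discard_left, tpowMap_comp]
  simp only [QSCFA.copyWire_discard_left, tpowMap_id]

theorem copyOut_discard_right {A : C} (X : QSCFA A) (N M : ℕ) (idx : Fin N → Fin M) :
    copyOut X N M idx ≫ (tpow A N ◁ discardAll (discardAll X.counit M) N) ≫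
      (ρ_ (tpow A N)).hom = tpowMap N fun i => keep X.counit M (idx i) := by
  rw [copyOut, Category.assoc, unzip_discard_right, tpowMap_comp]
  simp only [QSCFA.copyWire_discard_right]

/-- Causality of the local map: discarding a measurement discards only copies, which the counit law
erases. -/
theorem localMap_discardAll {A : C} (X : QSCFA A) (N M S : ℕ) (idx : Fin S → Fin N → Fin M) :
    localMap X N M S idx ≫ discardAll (discardAll X.counit N) S =
      discardAll (discardAll X.counit M) N := by
  induction S with
  | zero => exact Category.comp_id _
  | succ S ih =>
    change (copyOut X N M (idx 0) ≫ (tpow A N ◁ localMap X N M S fun s => idx s.succ)) ≫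
      (discardAll X.counit N ⊗ₘ discardAll (discardAll X.counit N) S) ≫ (λ_ (𝟙_ C)).hom = _
    rw [MonoidalCategory.tensorHom_def, Category.assoc, Category.assoc, whisker_exchange_assoc,
      ← whiskerLeft_comp_assoc, ih, leftUnitor_naturality]
    have h := copyOut_discard_left X N M (idx 0)
    rw [reassoc_of% h]

/-- The measurements before `s` are erased by the counit law and those after it by causality. What
remains for system `i` is the single wire named by `idx s i`. -/
theorem localMap_keep {A : C} (X : QSCFA A) (N M S : ℕ) (idx : Fin S → Fin N → Fin M)
    (s : Fin S) :
    localMap X N M S idx ≫ keep (discardAll X.counit N) S s =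
      tpowMap N fun i => keep X.counit M (idx s i) := by
  induction S with
  | zero => exact s.elim0
  | succ S ih =>
    refine Fin.cases ?_ (fun t => ?_) s
    · change (copyOut X N M (idx 0) ≫ (tpow A N ◁ localMap X N M S fun s => idx s.succ)) ≫
        (tpow A N ◁ discardAll (discardAll X.counit N) S) ≫ (ρ_ (tpow A N)).hom = _
      rw [Category.assoc, ← whiskerLeft_comp_assoc, localMap_discardAll, copyOut_discard_right]
    · change (copyOut X N M (idx 0) ≫ (tpow A N ◁ localMap X N M S fun s => idx s.succ)) ≫
        (discardAll X.counit N ▷ tpow (tpow A N) S) ≫ (λ_ (tpow (tpow A N) S)).hom ≫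
          keep (discardAll X.counit N) S t = _
      have h := copyOut_discard_left X N M (idx 0)
      rw [Category.assoc, whisker_exchange_assoc, leftUnitor_naturality_assoc, ih,
        reassoc_of% h]

/-- Phases that are compatible with the measurement structure `X` can be moved past the
measurements. -/
theorem merminMeasurement_eq {A : C} (Z X : QSCFA A) (N : ℕ) (y : Fin N → State A)
    (hcopy : ∀ i, Z.phaseMap (y i) ≫ X.comul =
      X.comul ≫ (Z.phaseMap (y i) ⊗ₘ Z.phaseMap (y i)))
    (hunit : ∀ i, Z.phaseMap (y i) ≫ DaggerSMC.dag (Z.phaseMap (y i)) = 𝟙 A) :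
    merminMeasurement Z X N y =
      (Z.ghz N ≫ (tpowMap N fun _ => X.comul) ≫ unzip A A N ≫
        (tpow A N ◁ DaggerSMC.dag (Z.ghz N)) ≫ (ρ_ (tpow A N)).hom) ≫
        tpowMap N fun i => Z.phaseMap (y i) := by
  -- The phases are copied to both outputs of the measurement.
  have h1 : (tpowMap N fun i => Z.phaseMap (y i)) ≫ (tpowMap N fun _ => X.comul) =
      (tpowMap N fun _ => X.comul) ≫
        tpowMap N fun i => Z.phaseMap (y i) ⊗ₘ Z.phaseMap (y i) := by
    simp only [tpowMap_comp, hcopy]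
  -- On the wires that meet the conjugate state, the copied phase cancels by unitarity against the
  -- adjoint phase, so one copy remains on the outcomes.
  have h2 : (tpowMap N fun i => Z.phaseMap (y i)) ≫
      DaggerSMC.dag (tpowMap N fun i => Z.phaseMap (y i)) = 𝟙 _ := by
    simp only [dag_tpowMap, tpowMap_comp, hunit, tpowMap_id]
  have h3 := tpowMap_unzip N (fun i => Z.phaseMap (y i)) fun i => Z.phaseMap (y i)
  rw [merminMeasurement, phasedGHZ, Category.assoc, reassoc_of% h1, reassoc_of% h3,
    DaggerSMC.dag_comp, MonoidalCategory.tensorHom_def, Category.assoc, ← whiskerLeft_comp_assoc,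
    reassoc_of% h2, ← whisker_exchange_assoc, rightUnitor_naturality]
  simp only [Category.assoc]

/-- A scenario whose phases can be replaced, without changing the sums, by phases that are
compatible with the measurement structure has a local hidden variable model. -/
theorem Scenario.exists_isLHV {A : C} {Z X : QSCFA A} (σ : Scenario Z X) (y : Fin σ.M → State A)
    (hcopy : ∀ r, Z.phaseMap (y r) ≫ X.comul =
      X.comul ≫ (Z.phaseMap (y r) ⊗ₘ Z.phaseMap (y r)))
    (hunit : ∀ r, Z.phaseMap (y r) ≫ DaggerSMC.dag (Z.phaseMap (y r)) = 𝟙 A)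
    (hcounit : ∀ r, Z.phaseMap (y r) ≫ X.counit = X.counit)
    (hsum : ∀ s, (Z.sum σ.N fun i => σ.a (σ.idx s i)) = Z.sum σ.N fun i => y (σ.idx s i)) :
    ∃ Λ' : State (tpow (tpow A σ.M) σ.N), σ.IsLHV Λ' := by
  -- The hidden state: the measured GHZ state without phases, every outcome copied `M` times, with
  -- the phase `y r` applied to the `r`-th copy.
  refine ⟨(Z.ghz σ.N ≫ (tpowMap σ.N fun _ => X.comul) ≫ unzip A A σ.N ≫
    (tpow A σ.N ◁ DaggerSMC.dag (Z.ghz σ.N)) ≫ (ρ_ (tpow A σ.N)).hom) ≫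
    tpowMap σ.N fun _ => X.copies σ.M ≫ tpowMap σ.M fun r => Z.phaseMap (y r), fun s => ?_⟩
  rw [merminMeasurement_congr Z X σ.N (hsum s),
    merminMeasurement_eq Z X σ.N _ (fun i => hcopy _) (fun i => hunit _), localMap_keep,
    Category.assoc _ (tpowMap _ _) (tpowMap _ _), tpowMap_comp]
  congr 2
  funext i
  rw [Category.assoc, tpowMap_keep X.counit X.counit σ.M _ hcounit, ← Category.assoc,
    QSCFA.copies_keep, Category.id_comp]

end Abstract
end Mermin

/-! ### Companions of maps under the rotation of two copies -/

namespace Mermin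

open scoped Matrix Kronecker

/-- The bijection `(x, x') ↦ (x + x', x - x')` on pairs of labels. -/
def rotation (A : Register) : A.Basis × A.Basis ≃ A.Basis × A.Basis where
  toFun p := (p.1 + p.2, p.1 - p.2)
  -- Modulo 3 the inverse of 2 is `-1`, so the half sum is minus the sum and the half difference is
  -- minus the difference.
  invFun p := (-(p.1 + p.2), p.2 - p.1)
  left_inv p := by
    have h : ∀ a b : ZMod 3, -(a + b + (a - b)) = a ∧ a - b - (a + b) = b := by decide
    exact Prod.ext (funext fun i => (h _ _).1) (funext fun i => (h _ _).2)
  right_inv p := by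
    have h : ∀ a b : ZMod 3, -(a + b) + (b - a) = a ∧ -(a + b) - (b - a) = b := by decide
    exact Prod.ext (funext fun i => (h _ _).1) (funext fun i => (h _ _).2)

/-- Two copies of `f`, rotated by `(x, x') ↦ (x + x', x - x')`, are the product of the conjugate of
`f` and of its companion `E`. -/
def IsCompanion {A B : Register} (f E : LinMap A B) : Prop :=
  ∀ y y' x x', f (y + y') (x + x') * f (y - y') (x - x') = star (f y x) * E y' x'

namespace IsCompanion

variable {A B D A' B' : Register}

/-- The sum over pairs of intermediate labels is unchanged if the pairs are rotated, and in rotated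
coordinates both factors separate. -/
theorem comp {f E : LinMap A B} {g E' : LinMap B D} (hf : IsCompanion f E)
    (hg : IsCompanion g E') : IsCompanion (g * f) (E' * E) := by
  intro y y' x x'
  have h : ∑ p : B.Basis × B.Basis, (g (y + y') p.1 * f p.1 (x + x')) *
      (g (y - y') p.2 * f p.2 (x - x')) =
      ∑ p : B.Basis × B.Basis, (star (g y p.1) * star (f p.1 x)) * (E' y' p.2 * E p.2 x') := by
    rw [← (rotation B).sum_comp]
    refine Finset.sum_congr rfl fun p _ => ?_
    have h1 := hg y y' p.1 p.2
    have h2 := hf p.1 p.2 x x'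
    simp only [rotation, Equiv.coe_fn_mk]
    linear_combination (f (p.1 + p.2) (x + x') * f (p.1 - p.2) (x - x')) * h1 +
      (star (g y p.1) * E' y' p.2) * h2
  simp only [Matrix.mul_apply, star_sum, star_mul', Finset.sum_mul_sum]
  simpa only [Fintype.sum_prod_type] using h

theorem tensor {f E : LinMap A B} {g E' : LinMap A' B'} (hf : IsCompanion f E)
    (hg : IsCompanion g E') : IsCompanion (f.tensor g) (E.tensor E') := by
  intro y y' x x'
  have h1 := hf (fun i => y (Sum.inl i)) (fun i => y' (Sum.inl i)) (fun i => x (Sum.inl i))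
    (fun i => x' (Sum.inl i))
  have h2 := hg (fun i => y (Sum.inr i)) (fun i => y' (Sum.inr i)) (fun i => x (Sum.inr i))
    (fun i => x' (Sum.inr i))
  simp only [LinMap.tensor, star_mul']
  refine Eq.trans ?_ ((congrArg₂ (· * ·) h1 h2).trans (mul_mul_mul_comm _ _ _ _))
  exact mul_mul_mul_comm _ _ _ _

theorem adjoint {f E : LinMap A B} (hf : IsCompanion f E) : IsCompanion fᴴ Eᴴ := by
  intro y y' x x'
  have h := congrArg star (hf x x' y y')
  simpa only [star_mul', Matrix.conjTranspose_apply] using h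

theorem exists_smul {f E : LinMap A B} (hf : IsCompanion f E) (c : ℂ) :
    ∃ E', IsCompanion (c • f) E' := by
  by_cases hc : c = 0
  · exact ⟨0, fun y y' x x' => by simp [hc]⟩
  · refine ⟨(c * c / star c) • E, fun y y' x x' => ?_⟩
    have hc' : star c ≠ 0 := star_ne_zero.2 hc
    have h := hf y y' x x'
    simp only [Matrix.smul_apply, smul_eq_mul, star_mul']
    field_simp
    linear_combination h

theorem relabel (e : A.wires ≃ B.wires) :
    IsCompanion (LinMap.relabel e) (LinMap.relabel e) := by
  intro y y' x x'
  have h3 : (x + x' = (y + y') ∘ e ∧ x - x' = (y - y') ∘ e) ↔ (x = y ∘ e ∧ x' = y' ∘ e) := by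
    have h := (rotation A).injective.eq_iff (a := (x, x')) (b := (y ∘ e, y' ∘ e))
    simp only [rotation, Equiv.coe_fn_mk, Prod.mk.injEq] at h
    exact h
  by_cases h : x = y ∘ e ∧ x' = y' ∘ e
  · simp only [LinMap.relabel, if_pos h.1, if_pos h.2, if_pos (h3.2 h).1, if_pos (h3.2 h).2,
      star_one]
  · have h' := fun k => h (h3.1 k)
    simp only [LinMap.relabel, ← ite_and, apply_ite star, star_one, star_zero, mul_ite, mul_one,
      mul_zero]
    rw [if_neg (fun k => h' k.symm), if_neg (fun k => h k.symm)]

theorem ketZero : IsCompanion LinMap.ketZero LinMap.ketZero := by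
  intro y y' x x'
  have h3 : (y + y' = 0 ∧ y - y' = 0) ↔ (y = 0 ∧ y' = 0) := by
    have h := (rotation _).injective.eq_iff (a := (y, y')) (b := (0, 0))
    simp only [rotation, Equiv.coe_fn_mk, Prod.mk.injEq, add_zero, sub_zero] at h
    exact h
  simp only [LinMap.ketZero, ← ite_and, apply_ite star, star_one, star_zero, mul_ite, mul_one,
      mul_zero]
  refine if_congr ?_ rfl rfl
  rw [and_comm, h3, and_comm]

end IsCompanion

/-! ### Clifford unitaries have companions -/

section Pauli

variable {A : Register}

/-- Shifting both rotated labels by `a` shifts only the first original label, and the two phases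
combine to `-2 b · x = b · x` modulo 3. -/
theorem pauli_kronecker_rotation (a b : A.Basis) :
    (pauli a (-b) ⊗ₖ pauli a (-b)).submatrix (rotation A) (rotation A) =
      pauli a b ⊗ₖ (1 : LinMap A A) := by
  ext ⟨y, y'⟩ ⟨x, x'⟩
  have h3 : (y + y' = x + x' + a ∧ y - y' = x - x' + a) ↔ (y = x + a ∧ y' = x') := by
    constructor
    · rintro ⟨h, h'⟩
      have key : ∀ y y' x x' a : ZMod 3, y + y' = x + x' + a → y - y' = x - x' + a →
          y = x + a ∧ y' = x' := by decide
      exact ⟨funext fun i => (key _ _ _ _ _ (congrFun h i) (congrFun h' i)).1,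
        funext fun i => (key _ _ _ _ _ (congrFun h i) (congrFun h' i)).2⟩
    · rintro ⟨rfl, rfl⟩
      exact ⟨add_right_comm _ _ _, add_sub_right_comm _ _ _⟩
  have h4 : (ZMod.stdAddChar (-b ⬝ᵥ (x + x')) : ℂ) * ZMod.stdAddChar (-b ⬝ᵥ (x - x')) =
      ZMod.stdAddChar (b ⬝ᵥ x) := by
    rw [← AddChar.map_add_eq_mul, ← dotProduct_add]
    congr 1
    simp only [neg_dotProduct, dotProduct_add, dotProduct_sub]
    have key : ∀ u v : ZMod 3, -u + -v + (-u - -v) = u := by decide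
    exact key _ _
  simp only [Matrix.submatrix_apply, Matrix.kroneckerMap_apply, rotation, Equiv.coe_fn_mk, pauli,
    Matrix.one_apply, mul_ite, ite_mul, zero_mul, mul_zero, mul_one, ← ite_and, h4]
  exact if_congr (by rw [and_comm, h3, and_comm]) rfl rfl

theorem pauli_map_star (a b : A.Basis) : (pauli a (-b)).map star = pauli a b := by
  ext y x
  simp only [pauli, Matrix.map_apply, apply_ite star, star_zero, neg_dotProduct]
  congr 1
  rw [AddChar.map_neg_eq_conj]
  simp

/-- Commuting with the phase operators kills the blocks off the diagonal in the first factor;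
commuting with the shifts makes the diagonal blocks equal. -/
theorem eq_one_kronecker_of_commute_pauli {M : Matrix (A.Basis × A.Basis) (A.Basis × A.Basis) ℂ}
    (h : ∀ a b : A.Basis, M * (pauli a b ⊗ₖ (1 : LinMap A A)) =
      (pauli a b ⊗ₖ (1 : LinMap A A)) * M) :
    ∃ m : LinMap A A, M = (1 : LinMap A A) ⊗ₖ m := by
  have hl : ∀ a b y y' x x', (M * (pauli a b ⊗ₖ (1 : LinMap A A))) (y, y') (x, x') =
      M (y, y') (x + a, x') * ZMod.stdAddChar (b ⬝ᵥ x) := by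
    intro a b y y' x x'
    rw [Matrix.mul_apply, Finset.sum_eq_single (x + a, x')]
    · simp [pauli]
    · rintro ⟨z, z'⟩ - hz
      simp only [Matrix.kroneckerMap_apply, pauli, Matrix.one_apply, mul_ite, mul_one, mul_zero,
        ← ite_and]
      rw [if_neg]
      rintro ⟨rfl, rfl⟩
      exact hz rfl
    · simp
  have hr : ∀ a b y y' x x', ((pauli a b ⊗ₖ (1 : LinMap A A)) * M) (y, y') (x, x') =
      ZMod.stdAddChar (b ⬝ᵥ (y - a)) * M (y - a, y') (x, x') := by
    intro a b y y' x x'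
    rw [Matrix.mul_apply, Finset.sum_eq_single (y - a, y')]
    · simp [pauli]
    · rintro ⟨z, z'⟩ - hz
      simp only [Matrix.kroneckerMap_apply, pauli, Matrix.one_apply, mul_ite, mul_one, mul_zero,
        ite_mul, zero_mul, ← ite_and]
      rw [if_neg]
      rintro ⟨rfl, rfl⟩
      exact hz (by simp)
    · simp
  refine ⟨fun y' x' => M (0, y') (0, x'), ?_⟩
  ext ⟨y, y'⟩ ⟨x, x'⟩
  change M (y, y') (x, x') = (1 : LinMap A A) y x * M (0, y') (0, x')
  rw [Matrix.one_apply]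
  split_ifs with hyx
  · subst hyx
    have h1 := congrFun (congrFun (h y 0) (y, y')) (0, x')
    rw [hl, hr] at h1
    simpa using h1
  · obtain ⟨i, hi⟩ := Function.ne_iff.1 hyx
    have h1 := congrFun (congrFun (h 0 (Pi.single i 1)) (y, y')) (x, x')
    rw [hl, hr] at h1
    simp only [add_zero, sub_zero, single_dotProduct, one_mul] at h1
    have h2 : (ZMod.stdAddChar (x i) : ℂ) ≠ ZMod.stdAddChar (y i) :=
      fun k => hi (ZMod.injective_stdAddChar k).symm
    rw [zero_mul]
    by_contra h3
    exact h2 (mul_left_cancel₀ h3 (h1.trans (mul_comm _ _)))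

/-- The rotated `U ⊗ U` and the conjugate `W` of `U` on the first factor transform the Pauli
operators of that factor in the same way. Hence undoing `W` leaves an operator that commutes with
all of them and so acts on the second factor only. -/
theorem IsCompanion.exists_clifford {U : LinMap A A} (hU : IsClifford U) :
    ∃ E, IsCompanion U E := by
  obtain ⟨hU1, hU2⟩ := hU
  have hUU : Uᴴ * U = 1 := Matrix.mem_unitaryGroup_iff'.1 hU1
  set W : LinMap A A := U.map star with hW
  have hWW : W * Wᴴ = 1 := by
    have h : (U * Uᴴ).map star = 1 := by
      rw [show U * Uᴴ = 1 from Matrix.mem_unitaryGroup_iff.1 hU1]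
      exact Matrix.map_one _ (star_zero _) (star_one _)
    rw [← h]
    ext y x
    simp [Matrix.mul_apply, hW]
  have hWW' : Wᴴ * W = 1 := mul_eq_one_comm.1 hWW
  set N : Matrix (A.Basis × A.Basis) (A.Basis × A.Basis) ℂ :=
    (U ⊗ₖ U).submatrix (rotation A) (rotation A) with hN
  obtain ⟨m, hm⟩ := eq_one_kronecker_of_commute_pauli (M := (Wᴴ ⊗ₖ Wᴴ) * N) (by
    intro a b
    obtain ⟨k, a', b', hk⟩ := hU2 a (-b)
    obtain ⟨b', rfl⟩ : ∃ b'' : A.Basis, b' = -b'' := ⟨-b', (neg_neg _).symm⟩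
    set c : ℂ := ZMod.stdAddChar k with hc
    -- Two copies of `U` give the factor `c * c` and the conjugate gives `star c`; the two agree
    -- because `c` is a cube root of unity.
    have hc3 : c * c * c = 1 := by
      rw [hc, ← AddChar.map_add_eq_mul, ← AddChar.map_add_eq_mul]
      have key : ∀ k : ZMod 3, k + k + k = 0 := by decide
      rw [key, AddChar.map_zero_eq_one]
    have hcc : c * star c = 1 := by
      have h := AddChar.map_neg_eq_conj (ZMod.stdAddChar (N := 3)) k
      rw [hc, ← starRingEnd_apply, ← h, ← AddChar.map_add_eq_mul, add_neg_cancel,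
        AddChar.map_zero_eq_one]
    have h1 : U * pauli a (-b) = c • (pauli a' (-b') * U) := by
      rw [← Matrix.smul_mul, ← hk, Matrix.mul_assoc, hUU, Matrix.mul_one]
    have h2 : W * pauli a b = star c • (pauli a' b' * W) := by
      rw [← pauli_map_star a b, ← pauli_map_star a' b']
      ext y x
      have := congrArg star (congrFun (congrFun h1 y) x)
      simpa [Matrix.mul_apply, hW, mul_comm] using this
    have h3 : Wᴴ * pauli a' b' = c • (pauli a b * Wᴴ) := by
      calc Wᴴ * pauli a' b' = (c * star c) • (Wᴴ * (pauli a' b' * W) * Wᴴ) := by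
            rw [hcc, one_smul, Matrix.mul_assoc, Matrix.mul_assoc, hWW, Matrix.mul_one]
        _ = c • (Wᴴ * (W * pauli a b) * Wᴴ) := by
            rw [h2, Matrix.mul_smul, Matrix.smul_mul, smul_smul]
        _ = c • (pauli a b * Wᴴ) := by rw [← Matrix.mul_assoc, hWW', Matrix.one_mul]
    have h4 : N * (pauli a b ⊗ₖ (1 : LinMap A A)) =
        (c * c) • ((pauli a' b' ⊗ₖ (1 : LinMap A A)) * N) := by
      rw [hN, ← pauli_kronecker_rotation, ← pauli_kronecker_rotation,
        Matrix.submatrix_mul_equiv, Matrix.submatrix_mul_equiv, ← Matrix.mul_kronecker_mul,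
        ← Matrix.mul_kronecker_mul, h1, Matrix.smul_kronecker, Matrix.kronecker_smul, smul_smul]
      rfl
    rw [Matrix.mul_assoc, h4, Matrix.mul_smul, ← Matrix.mul_assoc, ← Matrix.mul_assoc,
      ← Matrix.mul_kronecker_mul, ← Matrix.mul_kronecker_mul, h3, Matrix.one_mul, Matrix.mul_one,
      Matrix.smul_kronecker, Matrix.smul_mul, smul_smul, hc3, one_smul])
  refine ⟨W * m, fun y y' x x' => ?_⟩
  have h5 : N = W ⊗ₖ (W * m) := by
    calc N = (W ⊗ₖ W) * ((Wᴴ ⊗ₖ Wᴴ) * N) := by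
          rw [← Matrix.mul_assoc, ← Matrix.mul_kronecker_mul, hWW, Matrix.one_kronecker_one,
            Matrix.one_mul]
      _ = W ⊗ₖ (W * m) := by rw [hm, ← Matrix.mul_kronecker_mul, Matrix.mul_one]
  exact congrFun (congrFun h5 (y, y')) (x, x')

end Pauli

/-- Every stabilizer map has a companion. -/
theorem IsStabilizer.exists_isCompanion {A B : Register} {f : LinMap A B} (hf : IsStabilizer f) :
    ∃ E, IsCompanion f E := by
  induction hf with
  | ketZero => exact ⟨_, IsCompanion.ketZero⟩
  | clifford U hU => exact IsCompanion.exists_clifford hU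
  | relabel e => exact ⟨_, IsCompanion.relabel e⟩
  | smul c f _ ih =>
    obtain ⟨E, hE⟩ := ih
    exact hE.exists_smul c
  | comp f g _ _ ihf ihg =>
    obtain ⟨E, hE⟩ := ihf
    obtain ⟨E', hE'⟩ := ihg
    exact ⟨_, hE.comp hE'⟩
  | tensor f g _ _ ihf ihg =>
    obtain ⟨E, hE⟩ := ihf
    obtain ⟨E', hE'⟩ := ihg
    exact ⟨_, hE.tensor hE'⟩
  | adjoint f _ ih =>
    obtain ⟨E, hE⟩ := ih
    exact ⟨_, hE.adjoint⟩

end Mermin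

/-! ### Vectors, contractions and products of vectors -/

namespace Mermin

open CategoryTheory MonoidalCategory
open scoped Matrix

/-! ### Vectors -/

section Vectors

variable {A B D A' B' : Register}

/-- The tensor product of two vectors. -/
def tprod (a : A.Basis → ℂ) (b : B.Basis → ℂ) : (A.tensor B).Basis → ℂ :=
  fun x => a (fun i => x (Sum.inl i)) * b (fun i => x (Sum.inr i))

/-- The linear map from the empty register that prepares the vector `v`. -/
def ofKet (v : A.Basis → ℂ) : LinMap Register.empty A := fun y _ => v y

theorem exists_eq_ofKet (f : LinMap Register.empty A) : ∃ v, f = ofKet v :=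
  ⟨fun y => f y fun i => i.elim, by
    ext y x
    exact congrArg (f y) (funext fun i => i.elim)⟩

theorem mul_ofKet (f : LinMap A B) (v : A.Basis → ℂ) : f * ofKet v = ofKet (f *ᵥ v) := rfl

theorem smul_ofKet (c : ℂ) (v : A.Basis → ℂ) : c • ofKet v = ofKet (c • v) := rfl

theorem ofKet_injective : Function.Injective (ofKet : (A.Basis → ℂ) → LinMap Register.empty A) :=
  fun _ _ h => funext fun y => congrFun (congrFun h y) fun i => i.elim

theorem relabel_mulVec (e : A.wires ≃ B.wires) (v : A.Basis → ℂ) :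
    (LinMap.relabel e : LinMap A B) *ᵥ v = fun y => v (y ∘ e) := by
  funext y
  simp [Matrix.mulVec, dotProduct, LinMap.relabel]

theorem sum_tensor_basis {M : Type*} [AddCommMonoid M] (F : (A.tensor B).Basis → M) :
    ∑ x, F x = ∑ a : A.Basis, ∑ b : B.Basis, F (Sum.elim a b) := by
  rw [← (Equiv.sumArrowEquivProdArrow A.wires B.wires (ZMod 3)).symm.sum_comp,
    Fintype.sum_prod_type]
  rfl

theorem tensor_mulVec (f : LinMap A B) (g : LinMap A' B') (v : (A.tensor A').Basis → ℂ)
    (y : (B.tensor B').Basis) :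
    (f.tensor g *ᵥ v) y = ∑ a, ∑ a', f (fun i => y (Sum.inl i)) a *
      (g (fun i => y (Sum.inr i)) a' * v (Sum.elim a a')) := by
  rw [Matrix.mulVec, dotProduct, sum_tensor_basis]
  simp only [LinMap.tensor, Sum.elim_inl, Sum.elim_inr, mul_assoc]

theorem tensor_mulVec_tprod (f : LinMap A B) (g : LinMap A' B') (a : A.Basis → ℂ)
    (b : A'.Basis → ℂ) : f.tensor g *ᵥ tprod a b = tprod (f *ᵥ a) (g *ᵥ b) := by
  funext y
  rw [tensor_mulVec, tprod, Matrix.mulVec, Matrix.mulVec, dotProduct, dotProduct,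
    Finset.sum_mul_sum]
  refine Finset.sum_congr rfl fun u _ => Finset.sum_congr rfl fun v _ => ?_
  simp only [tprod, Sum.elim_inl, Sum.elim_inr]
  ring

theorem refl_tensor_mulVec (g : LinMap A' B') (v : (B.tensor A').Basis → ℂ)
    (x : B.Basis) (y : B'.Basis) :
    (LinMap.tensor (LinMap.relabel (Equiv.refl B.wires) : LinMap B B) g *ᵥ v) (Sum.elim x y) =
      (g *ᵥ fun z => v (Sum.elim x z)) y := by
  rw [tensor_mulVec, relabel_refl]
  change ∑ a, ∑ a', (1 : LinMap B B) x a * (g y a' * v (Sum.elim a a')) = _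
  simp [Matrix.one_apply, Matrix.mulVec, dotProduct]

/-- Contraction of the first factor with the conjugate of a vector. -/
def contract (a : A.Basis → ℂ) (w : (A.tensor B).Basis → ℂ) : B.Basis → ℂ :=
  fun y => ∑ x, star (a x) * w (Sum.elim x y)

theorem contract_smul (a : A.Basis → ℂ) (c : ℂ) (w : (A.tensor B).Basis → ℂ) :
    contract a (c • w) = c • contract a w := by
  funext y
  simp only [contract, Pi.smul_apply, smul_eq_mul, Finset.mul_sum]
  exact Finset.sum_congr rfl fun x _ => by ring

/-- The product of vectors given by `m`. -/
def mulV (m : LinMap (A.tensor A) A) (a b : A.Basis → ℂ) : A.Basis → ℂ := m *ᵥ tprod a b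

/-- Multiplication by a vector from the left. -/
def mulL (m : LinMap (A.tensor A) A) (a : A.Basis → ℂ) : LinMap A A :=
  fun y x => ∑ z, m y (Sum.elim z x) * a z

theorem mulL_mulVec (m : LinMap (A.tensor A) A) (a b : A.Basis → ℂ) :
    mulL m a *ᵥ b = mulV m a b := by
  funext y
  rw [mulV, Matrix.mulVec, Matrix.mulVec, dotProduct, dotProduct, sum_tensor_basis,
    Finset.sum_comm]
  refine Finset.sum_congr rfl fun x _ => ?_
  rw [mulL, Finset.sum_mul]
  exact Finset.sum_congr rfl fun z _ => mul_assoc _ _ _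

theorem contract_adjoint (m : LinMap (A.tensor A) A) (a w : A.Basis → ℂ) :
    contract a (mᴴ *ᵥ w) = (mulL m a)ᴴ *ᵥ w := by
  funext y
  simp only [contract, Matrix.mulVec, dotProduct, Matrix.conjTranspose_apply, mulL, star_sum,
    Finset.mul_sum, Finset.sum_mul, star_mul']
  rw [Finset.sum_comm]
  exact Finset.sum_congr rfl fun x _ => Finset.sum_congr rfl fun z _ => by ring

theorem mulV_smul_left (m : LinMap (A.tensor A) A) (c : ℂ) (a b : A.Basis → ℂ) :
    mulV m (c • a) b = c • mulV m a b := by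
  rw [mulV, mulV, ← Matrix.mulVec_smul]
  congr 1
  funext x
  exact mul_assoc _ _ _

theorem mulV_smul_right (m : LinMap (A.tensor A) A) (c : ℂ) (a b : A.Basis → ℂ) :
    mulV m a (c • b) = c • mulV m a b := by
  rw [← mulL_mulVec, ← mulL_mulVec, Matrix.mulVec_smul]

theorem mulV_add_right (m : LinMap (A.tensor A) A) (a b b' : A.Basis → ℂ) :
    mulV m a (b + b') = mulV m a b + mulV m a b' := by
  rw [← mulL_mulVec, ← mulL_mulVec, ← mulL_mulVec, Matrix.mulVec_add]

theorem mulV_add_left (m : LinMap (A.tensor A) A) (a a' b : A.Basis → ℂ) :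
    mulV m (a + a') b = mulV m a b + mulV m a' b := by
  rw [mulV, mulV, mulV, ← Matrix.mulVec_add]
  congr 1
  funext x
  exact add_mul _ _ _

theorem contract_assoc (m : LinMap (A.tensor A) A) (a d : A.Basis → ℂ)
    (w : (A.tensor A).Basis → ℂ) :
    contract a (LinMap.tensor (LinMap.relabel (Equiv.refl A.wires) : LinMap A A) m *ᵥ
      (LinMap.assoc A A A *ᵥ tprod w d)) = mulV m (contract a w) d := by
  funext y
  simp only [contract, refl_tensor_mulVec, LinMap.assoc, relabel_mulVec]
  simp only [mulV, Matrix.mulVec, dotProduct, Finset.mul_sum]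
  rw [Finset.sum_comm]
  refine Finset.sum_congr rfl fun z _ => ?_
  rw [tprod, contract, Finset.sum_mul, Finset.mul_sum]
  refine Finset.sum_congr rfl fun x _ => ?_
  have h : w (Sum.elim x fun i => z (Sum.inl i)) * d (fun i => z (Sum.inr i)) =
    (tprod w d : ((A.tensor A).tensor A).Basis → ℂ) (Sum.elim x z ∘ Equiv.sumAssoc _ _ _) := by
    rw [tprod]
    congr 2
    funext i
    rcases i with i | i <;> rfl
  rw [← h]
  ring

end Vectors

/-! ### Frobenius laws without global phases -/

theorem StabHom.mk_eq_mk_iff {A B : Register} {f g : LinMap A B} {hf : IsStabilizer f}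
    {hg : IsStabilizer g} : StabHom.mk f hf = StabHom.mk g hg ↔ ∃ c : ℂ, ‖c‖ = 1 ∧ g = c • f :=
  ⟨fun h => Quotient.exact h, fun h => Quotient.sound h⟩

/-- A multiplication `m` and a unit `u` that satisfy the laws of a commutative dagger Frobenius
algebra exactly, without global phases. -/
structure IsFrobenius {A : Register} (m : LinMap (A.tensor A) A) (u : A.Basis → ℂ) : Prop where
  comm : ∀ a b, mulV m b a = mulV m a b
  assoc : ∀ a b c, mulV m (mulV m a b) c = mulV m a (mulV m b c)
  one_mul : ∀ a, mulV m u a = a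
  frobenius : ∀ a c d, (mulL m a)ᴴ *ᵥ mulV m c d = mulV m ((mulL m a)ᴴ *ᵥ c) d

theorem IsFrobenius.one_ne_zero {A : Register} {m : LinMap (A.tensor A) A} {u : A.Basis → ℂ}
    (h : ∀ a, mulV m u a = a) : u ≠ 0 := by
  rintro rfl
  have h1 := h 1
  rw [← zero_smul ℂ (0 : A.Basis → ℂ), mulV_smul_left, zero_smul] at h1
  exact zero_ne_one h1

theorem eq_one_of_eq_smul {V : Type*} [AddCommGroup V] [Module ℂ V] {v : V} (hv : v ≠ 0) {c : ℂ}
    (h : v = c • v) : c = 1 := by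
  have h1 : (1 - c) • v = 0 := by rw [sub_smul, one_smul, ← h, sub_self]
  rcases smul_eq_zero.1 h1 with h2 | h2
  · exact (sub_eq_zero.1 h2).symm
  · exact absurd h2 hv

/-- The phase in the unit law is absorbed into the unit. In every other law, inserting the unit
throughout gives the same nonzero vector on both sides, so the phase there is 1. -/
theorem QSCFA.exists_isFrobenius {A : Register} (Z : QSCFA (C := QutritStab) A)
    {m : LinMap (A.tensor A) A} {hm : IsStabilizer m} (h : Z.mul = StabHom.mk m hm) :
    ∃ u, IsFrobenius m u ∧ ∃ hu, Z.one = StabHom.mk (ofKet u) hu := by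
  obtain ⟨f, hf, hZf⟩ := StabHom.exists_rep Z.one
  obtain ⟨v, rfl⟩ := exists_eq_ofKet f
  have hone := Z.one_mul
  have hcomm := Z.mul_comm
  have hassoc := Z.mul_assoc
  have hfrob := Z.frobenius_right
  rw [h] at hone hcomm hassoc hfrob
  rw [hZf] at hone
  obtain ⟨c, hc, hone⟩ := StabHom.mk_eq_mk_iff.1 hone
  have hone' : ∀ a, a = c • mulV m v a := by
    intro a
    have h1 := congrArg (· *ᵥ tprod (fun _ => 1) a) hone
    simp only [Matrix.smul_mulVec, ← Matrix.mulVec_mulVec, relabel_mulVec,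
      tensor_mulVec_tprod] at h1
    have h2 : ofKet v *ᵥ (fun _ => 1) = v := by
      funext y
      simp [ofKet, Matrix.mulVec, dotProduct]
    rw [h2] at h1
    refine Eq.trans ?_ h1
    funext y
    exact (_root_.one_mul _).symm
  have hc0 : c ≠ 0 := fun h => by simp [h] at hc
  have hu : ∀ a, mulV m (c • v) a = a := fun a => by rw [mulV_smul_left, ← hone']
  have hu0 := IsFrobenius.one_ne_zero hu
  refine ⟨c • v, ⟨?_, ?_, hu, ?_⟩, .smul c _ hf, hZf.trans (StabHom.mk_eq_mk_iff.2 ⟨c, hc, rfl⟩)⟩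
  · obtain ⟨k, -, hk⟩ := StabHom.mk_eq_mk_iff.1 hcomm
    have hk' : ∀ a b, mulV m a b = k • mulV m b a := by
      intro a b
      have h1 := congrArg (· *ᵥ tprod a b) hk
      simp only [Matrix.smul_mulVec, ← Matrix.mulVec_mulVec, relabel_mulVec] at h1
      refine h1.trans (congrArg (fun t => k • (m *ᵥ t)) ?_)
      funext x
      exact _root_.mul_comm _ _
    have hk1 : k = 1 := eq_one_of_eq_smul hu0 (by have := hk' (c • v) (c • v); rwa [hu] at this)
    intro a b
    rw [hk' b a, hk1, one_smul]
  · obtain ⟨k, -, hk⟩ := StabHom.mk_eq_mk_iff.1 hassoc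
    have hk' : ∀ a b d, mulV m a (mulV m b d) = k • mulV m (mulV m a b) d := by
      intro a b d
      have h1 := congrArg (· *ᵥ tprod (tprod a b) d) hk
      simp only [Matrix.smul_mulVec, ← Matrix.mulVec_mulVec, relabel_mulVec,
        tensor_mulVec_tprod] at h1
      refine Eq.trans ?_ h1
      have h2 : (fun y => tprod (tprod a b) d (y ∘ Equiv.sumAssoc A.wires A.wires A.wires)) =
          tprod a (tprod b d) := by
        funext y
        exact _root_.mul_assoc _ _ _
      rw [h2, tensor_mulVec_tprod, relabel_mulVec]
      rfl
    have hk1 : k = 1 := eq_one_of_eq_smul hu0 (by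
      have := hk' (c • v) (c • v) (c • v); rwa [hu, hu, hu] at this)
    intro a b d
    rw [hk' a b d, hk1, one_smul]
  · obtain ⟨k, -, hk⟩ := StabHom.mk_eq_mk_iff.1 hfrob
    have hk' : ∀ a b d, (mulL m a)ᴴ *ᵥ mulV m b d = k • mulV m ((mulL m a)ᴴ *ᵥ b) d := by
      intro a b d
      have h1 := congrArg (fun t => contract a (t *ᵥ tprod b d)) hk
      simp only [Matrix.smul_mulVec, ← Matrix.mulVec_mulVec] at h1
      have h2 : LinMap.tensor mᴴ (LinMap.relabel (Equiv.refl A.wires) : LinMap A A) *ᵥ tprod b d =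
          tprod (mᴴ *ᵥ b) d := by
        rw [tensor_mulVec_tprod, relabel_mulVec]
        rfl
      rw [contract_adjoint] at h1
      refine h1.trans ?_
      rw [h2, contract_smul, ← contract_adjoint, ← contract_assoc]
      rfl
    have hk1 : k = 1 := by
      have h1 : mulL m (c • v) = 1 := by
        refine Matrix.ext_of_mulVec_single fun i => ?_
        rw [mulL_mulVec, hu, Matrix.one_mulVec]
      have := hk' (c • v) (c • v) (c • v)
      rw [h1, Matrix.conjTranspose_one, Matrix.one_mulVec, hu, Matrix.one_mulVec, hu] at this
      exact eq_one_of_eq_smul hu0 this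
    intro a b d
    rw [hk' a b d, hk1, one_smul]

end Mermin

/-! ### Points of a commutative dagger Frobenius algebra -/

namespace Mermin

open scoped Matrix ComplexOrder

section Points

variable {A B : Register} {m : LinMap (A.tensor A) A} {u : A.Basis → ℂ}

theorem mulV_zero_left (m : LinMap (A.tensor A) A) (a : A.Basis → ℂ) : mulV m 0 a = 0 := by
  have h := mulV_smul_left m 0 0 a
  rwa [zero_smul, zero_smul] at h

theorem mulV_zero_right (m : LinMap (A.tensor A) A) (a : A.Basis → ℂ) : mulV m a 0 = 0 := by
  have h := mulV_smul_right m 0 a 0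
  rwa [zero_smul, zero_smul] at h

theorem tprod_single (z : (A.tensor B).Basis) :
    tprod (Pi.single (fun i => z (Sum.inl i)) 1) (Pi.single (fun i => z (Sum.inr i)) 1) =
      (Pi.single z 1 : (A.tensor B).Basis → ℂ) := by
  funext x
  simp only [tprod, Pi.single_apply, mul_ite, mul_one, mul_zero, ← ite_and]
  refine if_congr ⟨fun h => ?_, ?_⟩ rfl rfl
  · funext i
    rcases i with i | i
    · exact congrFun h.2 i
    · exact congrFun h.1 i
  · rintro rfl
    exact ⟨rfl, rfl⟩

/-- Points: the nonzero vectors that are copied by the adjoint of the multiplication `m`. -/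
def IsPoint (m : LinMap (A.tensor A) A) (e : A.Basis → ℂ) : Prop :=
  mᴴ *ᵥ e = tprod e e ∧ e ≠ 0

theorem star_dotProduct_mulVec (f : LinMap A B) (w : B.Basis → ℂ) (v : A.Basis → ℂ) :
    star w ⬝ᵥ f *ᵥ v = star (fᴴ *ᵥ w) ⬝ᵥ v := by
  rw [Matrix.star_mulVec, Matrix.conjTranspose_conjTranspose, Matrix.dotProduct_mulVec]

theorem star_tprod_dotProduct (a a' : A.Basis → ℂ) (b b' : B.Basis → ℂ) :
    star (tprod a b) ⬝ᵥ tprod a' b' = (star a ⬝ᵥ a') * (star b ⬝ᵥ b') := by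
  rw [dotProduct, sum_tensor_basis, dotProduct, dotProduct, Finset.sum_mul_sum]
  refine Finset.sum_congr rfl fun x _ => Finset.sum_congr rfl fun y _ => ?_
  simp only [Pi.star_apply, tprod, star_mul', Sum.elim_inl, Sum.elim_inr]
  ring

theorem star_tprod_dotProduct' (a : A.Basis → ℂ) (b : B.Basis → ℂ)
    (w : (A.tensor B).Basis → ℂ) :
    star (tprod a b) ⬝ᵥ w = star b ⬝ᵥ contract a w := by
  rw [dotProduct, sum_tensor_basis, dotProduct, Finset.sum_comm]
  refine Finset.sum_congr rfl fun x _ => ?_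
  rw [contract, Finset.mul_sum]
  refine Finset.sum_congr rfl fun y _ => ?_
  simp only [Pi.star_apply, tprod, star_mul', Sum.elim_inl, Sum.elim_inr]
  ring

theorem IsPoint.dotProduct_mulV {e : A.Basis → ℂ} (he : IsPoint m e) (a b : A.Basis → ℂ) :
    star e ⬝ᵥ mulV m a b = (star e ⬝ᵥ a) * (star e ⬝ᵥ b) := by
  rw [mulV, star_dotProduct_mulVec, he.1, star_tprod_dotProduct]

theorem dotProduct_self_ne_zero {e : A.Basis → ℂ} (he : e ≠ 0) : star e ⬝ᵥ e ≠ 0 :=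
  fun h => he (dotProduct_star_self_eq_zero.1 h)

theorem IsPoint.dotProduct_one {e : A.Basis → ℂ} (he : IsPoint m e) (hm : IsFrobenius m u) :
    star e ⬝ᵥ u = 1 := by
  have h := he.dotProduct_mulV u e
  rw [hm.one_mul] at h
  exact mul_right_cancel₀ (dotProduct_self_ne_zero he.2) (h.symm.trans (one_mul _).symm)

/-- Proportional points are equal. -/
theorem IsPoint.eq_of_smul {e f : A.Basis → ℂ} (he : IsPoint m e) (hf : IsPoint m f) {c : ℂ}
    (h : e = c • f) : e = f := by
  have hc : c ≠ 0 := by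
    rintro rfl
    exact he.2 (h.trans (zero_smul _ _))
  have h1 : tprod e e = c • tprod f f := by
    rw [← he.1, ← hf.1, h, Matrix.mulVec_smul]
  have h2 : tprod e e = c • (c • tprod f f) := by
    funext x
    simp only [h, tprod, Pi.smul_apply, smul_eq_mul]
    ring
  have h3 : tprod f f ≠ 0 := by
    obtain ⟨x, hx⟩ := Function.ne_iff.1 hf.2
    refine Function.ne_iff.2 ⟨Sum.elim x x, mul_ne_zero hx hx⟩
  have h4 := eq_one_of_eq_smul h3 (smul_right_injective _ hc (h1.symm.trans h2))
  rw [h, h4, one_smul]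

theorem mulL_adjoint_point {e : A.Basis → ℂ} (he : IsPoint m e) (a : A.Basis → ℂ) :
    (mulL m a)ᴴ *ᵥ e = star (star e ⬝ᵥ a) • e := by
  rw [← contract_adjoint, he.1]
  funext y
  simp only [contract, tprod, Sum.elim_inl, Sum.elim_inr, Pi.smul_apply, smul_eq_mul, dotProduct,
    star_sum, Finset.sum_mul, Pi.star_apply, star_mul', star_star]
  exact Finset.sum_congr rfl fun x _ => by ring

namespace IsFrobenius

/-- With commutativity, the Frobenius law makes all multiplications commute with the adjoints of
multiplications; in particular multiplications are normal operators. -/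
theorem mulL_comm (hm : IsFrobenius m u) (a b c : A.Basis → ℂ) :
    mulV m a ((mulL m b)ᴴ *ᵥ c) = (mulL m b)ᴴ *ᵥ mulV m a c := by
  rw [hm.comm, ← hm.frobenius, hm.comm]

/-- A normal operator has the eigenvectors of its adjoint, with conjugate eigenvalues, and a point
is an eigenvector of the adjoint. -/
theorem mulV_point (hm : IsFrobenius m u) {e : A.Basis → ℂ} (he : IsPoint m e)
    (a : A.Basis → ℂ) : mulV m a e = (star e ⬝ᵥ a) • e := by
  have h1 := mulL_adjoint_point he a
  -- The defect `w` is again an eigenvector of the adjoint, which forces it to be orthogonal to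
  -- itself.
  set w := mulV m a e - (star e ⬝ᵥ a) • e with hw
  have h2 : (mulL m a)ᴴ *ᵥ w = star (star e ⬝ᵥ a) • w := by
    rw [hw, Matrix.mulVec_sub, ← hm.mulL_comm, h1, mulV_smul_right, Matrix.mulVec_smul, h1,
      smul_sub, smul_comm]
  have h3 : star w ⬝ᵥ mulV m a e = (star e ⬝ᵥ a) * (star w ⬝ᵥ e) := by
    rw [← mulL_mulVec, star_dotProduct_mulVec, h2, star_smul, star_star, smul_dotProduct,
      smul_eq_mul]
  have h4 : star w ⬝ᵥ w = 0 := by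
    conv_lhs => rw [hw, dotProduct_sub, h3, dotProduct_smul, smul_eq_mul, sub_self]
  exact sub_eq_zero.1 (dotProduct_star_self_eq_zero.1 h4)

/-- The product of two points is a multiple of either one, so points that are not orthogonal are
proportional, hence equal. -/
theorem point_orthogonal (hm : IsFrobenius m u) {e f : A.Basis → ℂ} (he : IsPoint m e)
    (hf : IsPoint m f) (h : star e ⬝ᵥ f ≠ 0) : e = f := by
  have h1 := hm.mulV_point he f
  rw [hm.comm, hm.mulV_point hf] at h1
  refine he.eq_of_smul hf (c := (star e ⬝ᵥ f)⁻¹ * (star f ⬝ᵥ e)) ?_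
  rw [mul_smul, h1, smul_smul, inv_mul_cancel₀ h, one_smul]

/-- Multiplication by `v` is normal with square zero, and a nilpotent normal operator vanishes. This
makes the algebra reduced. -/
theorem eq_zero_of_mulV_self (hm : IsFrobenius m u) {v : A.Basis → ℂ} (hv : mulV m v v = 0) :
    v = 0 := by
  set L := mulL m v with hL
  have h1 : L * L = 0 := by
    refine Matrix.ext_of_mulVec_single fun i => ?_
    rw [← Matrix.mulVec_mulVec, hL, mulL_mulVec, mulL_mulVec, ← hm.assoc, hv, Matrix.zero_mulVec,
      mulV_zero_left]
  have h2 : L * Lᴴ = Lᴴ * L := by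
    refine Matrix.ext_of_mulVec_single fun i => ?_
    rw [← Matrix.mulVec_mulVec, ← Matrix.mulVec_mulVec, hL, mulL_mulVec, mulL_mulVec, hm.mulL_comm]
  have h3 : (Lᴴ * L)ᴴ * (Lᴴ * L) = 0 := by
    rw [Matrix.conjTranspose_mul, Matrix.conjTranspose_conjTranspose, Matrix.mul_assoc,
      ← Matrix.mul_assoc L, h2, Matrix.mul_assoc Lᴴ, h1, Matrix.mul_zero, Matrix.mul_zero]
  have h4 : L = 0 :=
    Matrix.conjTranspose_mul_self_eq_zero.1 (Matrix.conjTranspose_mul_self_eq_zero.1 h3)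
  rw [← hm.one_mul v, hm.comm, ← mulL_mulVec, ← hL, h4, Matrix.zero_mulVec]

/-- The vectors, as a commutative algebra with multiplication `m`. -/
def Alg (_ : IsFrobenius m u) : Type := A.Basis → ℂ

section

variable (hm : IsFrobenius m u)

noncomputable instance : AddCommGroup hm.Alg := inferInstanceAs (AddCommGroup (A.Basis → ℂ))

noncomputable instance : Module ℂ hm.Alg := inferInstanceAs (Module ℂ (A.Basis → ℂ))

instance : Module.Finite ℂ hm.Alg := inferInstanceAs (Module.Finite ℂ (A.Basis → ℂ))

noncomputable instance : CommRing hm.Alg where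
  __ := (inferInstance : AddCommGroup hm.Alg)
  mul a b := mulV m a b
  one := u
  mul_assoc := hm.assoc
  one_mul := hm.one_mul
  mul_one a := (hm.comm _ _).trans (hm.one_mul a)
  mul_comm a b := hm.comm _ _
  left_distrib := mulV_add_right m
  right_distrib := mulV_add_left m
  zero_mul := mulV_zero_left m
  mul_zero := mulV_zero_right m

noncomputable instance : Algebra ℂ hm.Alg :=
  Algebra.ofModule (fun c a b => mulV_smul_left m c a b) fun c a b => mulV_smul_right m c a b

instance : IsReduced hm.Alg :=
  (isReduced_iff_pow_one_lt 2 one_lt_two).2 fun v hv =>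
    hm.eq_zero_of_mulV_self (v := v) (by rw [pow_two] at hv; exact hv)

end

/-- In a reduced ring some prime ideal avoids `v`; the quotient is a domain that is finite over `ℂ`,
hence is `ℂ` itself. -/
theorem exists_algHom (hm : IsFrobenius m u) {v : hm.Alg} (hv : v ≠ 0) :
    ∃ φ : hm.Alg →ₐ[ℂ] ℂ, φ v ≠ 0 := by
  have h1 : ¬ IsNilpotent v := fun h => hv h.eq_zero
  rw [nilpotent_iff_mem_prime] at h1
  push Not at h1
  obtain ⟨P, hP, hvP⟩ := h1
  have h2 : Function.Bijective (algebraMap ℂ (hm.Alg ⧸ P)) :=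
    IsAlgClosed.algebraMap_bijective_of_isIntegral
  let e : ℂ ≃ₐ[ℂ] (hm.Alg ⧸ P) := AlgEquiv.ofBijective (Algebra.ofId ℂ _) h2
  refine ⟨(e.symm : (hm.Alg ⧸ P) →ₐ[ℂ] ℂ).comp (Ideal.Quotient.mkₐ ℂ P), fun h => hvP ?_⟩
  have h3 : e.symm (Ideal.Quotient.mkₐ ℂ P v) = 0 := h
  rw [map_eq_zero_iff _ e.symm.injective] at h3
  exact Ideal.Quotient.eq_zero_iff_mem.1 h3

/-- Points separate the vectors. -/
theorem exists_isPoint (hm : IsFrobenius m u) {v : A.Basis → ℂ} (hv : v ≠ 0) :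
    ∃ e, IsPoint m e ∧ star e ⬝ᵥ v ≠ 0 := by
  obtain ⟨φ, hφ⟩ := hm.exists_algHom (v := v) hv
  let ψ : (A.Basis → ℂ) →ₗ[ℂ] ℂ := φ.toLinearMap
  have hψ : ∀ w : A.Basis → ℂ, ψ w = star (fun x => star (ψ (Pi.single x 1))) ⬝ᵥ w := by
    intro w
    conv_lhs => rw [← Finset.univ_sum_single w, map_sum]
    refine Finset.sum_congr rfl fun x _ => ?_
    have : Pi.single x (w x) = w x • (Pi.single x 1 : A.Basis → ℂ) := by
      rw [← Pi.single_smul, smul_eq_mul, mul_one]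
    rw [this, map_smul, smul_eq_mul, mul_comm, Pi.star_apply, star_star]
  have hmul : ∀ a b : A.Basis → ℂ, ψ (mulV m a b) = ψ a * ψ b := fun a b => map_mul φ _ _
  -- The vector that represents the character as an inner product is a point, because
  -- multiplicativity of the character says exactly that the vector is copied.
  refine ⟨fun x => star (ψ (Pi.single x 1)), ⟨?_, ?_⟩, ?_⟩
  · funext z
    have h2 := hmul (Pi.single (fun i => z (Sum.inl i)) 1) (Pi.single (fun i => z (Sum.inr i)) 1)
    rw [mulV, tprod_single, hψ, star_dotProduct_mulVec, dotProduct_single, mul_one] at h2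
    have h3 := congrArg star h2
    rw [Pi.star_apply, star_star] at h3
    rw [h3, star_mul']
    rfl
  · intro h
    apply hφ
    have := hψ v
    rw [h, star_zero, zero_dotProduct] at this
    exact this
  · rw [← hψ]
    exact hφ

theorem eq_of_forall_point (hm : IsFrobenius m u) {v w : A.Basis → ℂ}
    (h : ∀ e, IsPoint m e → star e ⬝ᵥ v = star e ⬝ᵥ w) : v = w := by
  by_contra hvw
  obtain ⟨e, he, h'⟩ := hm.exists_isPoint (sub_ne_zero.2 hvw)
  exact h' (by rw [dotProduct_sub, h e he, sub_self])

theorem eq_of_forall_point₂ (hm : IsFrobenius m u) {v w : (A.tensor A).Basis → ℂ}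
    (h : ∀ e f, IsPoint m e → IsPoint m f →
      star (tprod e f) ⬝ᵥ v = star (tprod e f) ⬝ᵥ w) : v = w := by
  have h1 : ∀ e, IsPoint m e → contract e v = contract e w := fun e he =>
    hm.eq_of_forall_point fun f hf => by
      rw [← star_tprod_dotProduct', ← star_tprod_dotProduct', h e f he hf]
  funext z
  have h2 : (fun x => v (Sum.elim x fun i => z (Sum.inr i))) =
      fun x => w (Sum.elim x fun i => z (Sum.inr i)) :=
    hm.eq_of_forall_point fun e he => congrFun (h1 e he) fun i => z (Sum.inr i)
  have h3 := congrFun h2 fun i => z (Sum.inl i)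
  rwa [show (Sum.elim (fun i => z (Sum.inl i)) fun i => z (Sum.inr i)) = z from
    Sum.elim_comp_inl_inr z] at h3

end IsFrobenius

end Points

end Mermin

/-! ### Strongly complementary pairs in exact form -/

namespace Mermin

open CategoryTheory MonoidalCategory
open scoped Matrix ComplexOrder

/-- Two exact commutative Frobenius algebras for which the unit and the multiplication of the second
one preserve the points of the first one. -/
structure IsComplementary {A : Register} (mZ : LinMap (A.tensor A) A) (uZ : A.Basis → ℂ)
    (mX : LinMap (A.tensor A) A) (uX : A.Basis → ℂ) : Prop where
  Z : IsFrobenius mZ uZ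
  X : IsFrobenius mX uX
  mul_point : ∀ {e f}, IsPoint mZ e → IsPoint mZ f → IsPoint mZ (mulV mX e f)
  one_point : IsPoint mZ uX

section Extraction

variable {A B : Register}

theorem ofKet_tensor (a : A.Basis → ℂ) (b : B.Basis → ℂ) :
    (ofKet a).tensor (ofKet b) * (LinMap.relabel (Equiv.emptySum Empty Empty).symm :
      LinMap Register.empty (Register.empty.tensor Register.empty)) = ofKet (tprod a b) := by
  ext y x
  rw [mul_relabel_apply]
  rfl

theorem ofKet_adjoint_mulVec (u e : A.Basis → ℂ) :
    (ofKet u)ᴴ *ᵥ e = fun _ => star u ⬝ᵥ e := rfl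

theorem tensorμ_eq_relabel (A : Register) :
    (tensorμ A A A A : (A.tensor A).tensor (A.tensor A) ⟶ (A.tensor A).tensor (A.tensor A)) =
      StabHom.relabel (A := (A.tensor A).tensor (A.tensor A))
        (B := (A.tensor A).tensor (A.tensor A))
        (Equiv.sumSumSumComm A.wires A.wires A.wires A.wires) := by
  change StabHom.comp (StabHom.assoc A A (A.tensor A))
    (StabHom.comp (StabHom.tensor (StabHom.id A) (StabHom.assocInv A A A))
    (StabHom.comp (StabHom.tensor (StabHom.id A)
      (StabHom.tensor (StabHom.braiding A A) (StabHom.id A)))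
    (StabHom.comp (StabHom.tensor (StabHom.id A) (StabHom.assoc A A A))
      (StabHom.assocInv A A (A.tensor A))))) = _
  simp only [StabHom.assoc, StabHom.assocInv, StabHom.braiding, StabHom.id,
    StabHom.tensor_relabel, StabHom.comp_relabel]
  refine StabHom.relabel_congr fun i => ?_
  rcases i with (i | i) | (i | i) <;> rfl

/-- Evaluated at points, the bialgebra law says that their `X`-product is copied up to a phase, and
the counit law that it is not zero. Rescaling the multiplication of `X` removes the phase. -/
theorem StronglyComplementary.exists_isComplementary {Z X : QSCFA (C := QutritStab) A}
    (hZX : StronglyComplementary Z X) :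
    ∃ mZ uZ mX uX, IsComplementary mZ uZ mX uX ∧ ∃ hmZ huZ hmX huX,
      Z.mul = StabHom.mk mZ hmZ ∧ Z.one = StabHom.mk (ofKet uZ) huZ ∧
      X.mul = StabHom.mk mX hmX ∧ X.one = StabHom.mk (ofKet uX) huX := by
  obtain ⟨mZ, hmZ, hZmul⟩ := StabHom.exists_rep Z.mul
  obtain ⟨uZ, hZ, huZ, hZone⟩ := Z.exists_isFrobenius hZmul
  obtain ⟨m, hm, hXmul⟩ := StabHom.exists_rep X.mul
  have hbi := hZX.bialgebra
  have hcounit := hZX.counit_copy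
  have hunit := hZX.unit_copy
  rw [tensorμ_eq_relabel, QSCFA.comul, hZmul, hXmul] at hbi
  rw [QSCFA.counit, hZone, hXmul] at hcounit
  obtain ⟨c, hc, hbi⟩ := StabHom.mk_eq_mk_iff.1 hbi
  obtain ⟨d, hd, hcounit⟩ := StabHom.mk_eq_mk_iff.1 hcounit
  have hc0 : c ≠ 0 := fun h => by simp [h] at hc
  have hd0 : d ≠ 0 := fun h => by simp [h] at hd
  have hbi' : ∀ e f, IsPoint mZ e → IsPoint mZ f →
      tprod (mulV m e f) (mulV m e f) = c • (mZᴴ *ᵥ mulV m e f) := by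
    intro e f he hf
    have h1 := congrArg (· *ᵥ tprod e f) hbi
    simp only [Matrix.smul_mulVec, ← Matrix.mulVec_mulVec] at h1
    refine Eq.trans ?_ h1
    have h2 : LinMap.tensor mZᴴ mZᴴ *ᵥ tprod e f = tprod (tprod e e) (tprod f f) := by
      rw [tensor_mulVec_tprod, he.1, hf.1]
    have h3 : (LinMap.relabel (A := (A.tensor A).tensor (A.tensor A))
        (B := (A.tensor A).tensor (A.tensor A))
        (Equiv.sumSumSumComm A.wires A.wires A.wires A.wires)) *ᵥ tprod (tprod e e) (tprod f f) =
        tprod (tprod e f) (tprod e f) := by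
      rw [relabel_mulVec]
      funext y
      exact mul_mul_mul_comm _ _ _ _
    refine Eq.trans ?_ (congrArg (fun t => LinMap.tensor m m *ᵥ
      ((LinMap.relabel (A := (A.tensor A).tensor (A.tensor A))
        (B := (A.tensor A).tensor (A.tensor A))
        (Equiv.sumSumSumComm A.wires A.wires A.wires A.wires)) *ᵥ t)) h2.symm)
    rw [h3, tensor_mulVec_tprod]
    rfl
  have hne : ∀ e f, IsPoint mZ e → IsPoint mZ f → mulV m e f ≠ 0 := by
    intro e f he hf h0
    have h1 := congrArg (· *ᵥ tprod e f) hcounit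
    simp only [Matrix.smul_mulVec, ← Matrix.mulVec_mulVec] at h1
    have h2 : LinMap.tensor (ofKet uZ)ᴴ (ofKet uZ)ᴴ *ᵥ tprod e f =
        tprod (fun _ => 1) (fun _ => 1) := by
      have h3 : ∀ e, IsPoint mZ e → (ofKet uZ)ᴴ *ᵥ e = fun _ => 1 := by
        intro e he
        rw [ofKet_adjoint_mulVec, Matrix.star_dotProduct, he.dotProduct_one hZ, star_one]
      rw [tensor_mulVec_tprod, h3 e he, h3 f hf]
    rw [h2, relabel_mulVec, show m *ᵥ tprod e f = 0 from h0, Matrix.mulVec_zero, smul_zero] at h1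
    have h4 := congrFun h1 fun i => i.elim
    simp [tprod] at h4
  -- The phase `c` of the bialgebra law does not depend on the points, so one rescaling makes all
  -- products of points into points.
  set mX : LinMap (A.tensor A) A := c⁻¹ • m with hmX
  have hmX' : IsStabilizer mX := .smul _ _ hm
  have hXmul' : X.mul = StabHom.mk mX hmX' :=
    hXmul.trans (StabHom.mk_eq_mk_iff.2 ⟨c⁻¹, by simp [hc], rfl⟩)
  obtain ⟨uX, hX, huX, hXone⟩ := X.exists_isFrobenius hXmul'
  have hmulX : ∀ e f, mulV mX e f = c⁻¹ • mulV m e f := fun e f => Matrix.smul_mulVec _ _ _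
  have hpoint : ∀ {e f}, IsPoint mZ e → IsPoint mZ f → IsPoint mZ (mulV mX e f) := by
    intro e f he hf
    refine ⟨?_, ?_⟩
    · rw [hmulX, Matrix.mulVec_smul]
      have h1 := hbi' e f he hf
      funext z
      have h2 := congrFun h1 z
      simp only [tprod, Pi.smul_apply, smul_eq_mul] at h2 ⊢
      field_simp
      exact h2.symm
    · rw [hmulX]
      exact smul_ne_zero (inv_ne_zero hc0) (hne e f he hf)
  refine ⟨mZ, uZ, mX, uX, ⟨hZ, hX, hpoint, ?_⟩, hmZ, huZ, hmX', huX, hZmul, hZone, hXmul', hXone⟩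
  rw [QSCFA.comul, hZmul, hXone] at hunit
  obtain ⟨k, hk, hunit⟩ := StabHom.mk_eq_mk_iff.1 hunit
  have hk0 : k ≠ 0 := fun h => by simp [h] at hk
  have h1 : tprod uX uX = k • (mZᴴ *ᵥ uX) := by
    apply ofKet_injective
    rw [← ofKet_tensor]
    exact hunit
  have hu0 := IsFrobenius.one_ne_zero hX.one_mul
  have h2 : IsPoint mZ (k⁻¹ • uX) := by
    refine ⟨?_, smul_ne_zero (inv_ne_zero hk0) hu0⟩
    rw [Matrix.mulVec_smul]
    funext z
    have h2 := congrFun h1 z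
    simp only [tprod, Pi.smul_apply, smul_eq_mul] at h2 ⊢
    field_simp
    exact h2.symm
  -- The multiple `k⁻¹ • uX` of the unit is a point and its square is a point proportional to it.
  -- Proportional points are equal, so `k⁻¹ = 1`.
  have h3 : mulV mX (k⁻¹ • uX) (k⁻¹ • uX) = k⁻¹ • (k⁻¹ • uX) := by
    rw [mulV_smul_left, mulV_smul_right, hX.one_mul]
  have h4 := (hpoint h2 h2).eq_of_smul h2 h3
  rw [h3] at h4
  have h5 := eq_one_of_eq_smul (smul_ne_zero (inv_ne_zero hk0) hu0) h4.symm
  rwa [h5, one_smul] at h2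

end Extraction

/-! ### The finite group of points and its order -/

namespace IsComplementary

variable {A : Register} {mZ mX : LinMap (A.tensor A) A} {uZ uX : A.Basis → ℂ}

/-- The group of points. -/
def Pt (_ : IsComplementary mZ uZ mX uX) : Type := {e : A.Basis → ℂ // IsPoint mZ e}

variable (h : IsComplementary mZ uZ mX uX)

/-- If no product `k + g` were the unit, all these products would be points orthogonal to `uX`. The
adjoint of multiplication by `g` would then kill `uX`, hence everything by the Frobenius law, and
`g` would be zero. -/
theorem exists_neg (g : h.Pt) : ∃ k : h.Pt, mulV mX k.1 g.1 = uX := by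
  by_contra! hk
  have h1 : ∀ f, IsPoint mZ f → star f ⬝ᵥ ((mulL mX g.1)ᴴ *ᵥ uX) = 0 := by
    intro f hf
    by_contra h2
    apply hk ⟨f, hf⟩
    refine h.Z.point_orthogonal (h.mul_point hf g.2) h.one_point fun h3 => h2 ?_
    rw [star_dotProduct_mulVec, Matrix.conjTranspose_conjTranspose, mulL_mulVec, ← h3, h.X.comm]
  have h2 : (mulL mX g.1)ᴴ *ᵥ uX = 0 :=
    h.Z.eq_of_forall_point fun f hf => by rw [h1 f hf, dotProduct_zero]
  have h3 : (mulL mX g.1)ᴴ = 0 := by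
    refine Matrix.ext_of_mulVec_single fun i => ?_
    have h4 := h.X.frobenius g.1 uX (Pi.single i 1)
    rw [h.X.one_mul, h2, mulV_zero_left] at h4
    rw [h4, Matrix.zero_mulVec]
  apply g.2.2
  rw [← h.X.one_mul g.1, h.X.comm, ← mulL_mulVec, Matrix.conjTranspose_eq_zero.1 h3,
    Matrix.zero_mulVec]

instance : Add h.Pt := ⟨fun g k => ⟨mulV mX g.1 k.1, h.mul_point g.2 k.2⟩⟩

instance : Zero h.Pt := ⟨⟨uX, h.one_point⟩⟩

noncomputable instance : Neg h.Pt := ⟨fun g => (h.exists_neg g).choose⟩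

noncomputable instance : AddCommGroup h.Pt where
  add_assoc g k l := Subtype.ext (h.X.assoc _ _ _)
  zero_add g := Subtype.ext (h.X.one_mul _)
  add_zero g := Subtype.ext ((h.X.comm _ _).trans (h.X.one_mul _))
  add_comm g k := Subtype.ext (h.X.comm _ _)
  neg_add_cancel g := Subtype.ext (h.exists_neg g).choose_spec
  nsmul := nsmulRec
  zsmul := zsmulRec

theorem coe_add (g k : h.Pt) : (g + k).1 = mulV mX g.1 k.1 := rfl

theorem linearIndependent_points : LinearIndependent ℂ fun g : h.Pt => g.1 := by
  rw [linearIndependent_iff']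
  intro s c hc g hg
  have h1 := congrArg (star g.1 ⬝ᵥ ·) hc
  simp only [dotProduct_sum, dotProduct_smul, dotProduct_zero] at h1
  rw [Finset.sum_eq_single g] at h1
  · exact (smul_eq_zero.1 h1).resolve_right (dotProduct_self_ne_zero g.2.2)
  · intro k _ hk
    by_contra h2
    exact hk (Subtype.ext (h.Z.point_orthogonal g.2 k.2 fun h3 => h2 (by rw [h3, smul_zero])).symm)
  · exact fun h2 => absurd hg h2

instance : Finite h.Pt := h.linearIndependent_points.finite

/-- Points are linearly independent and separate vectors, so their number is the dimension of the
register. -/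
theorem card_pt : Nat.card h.Pt = 3 ^ Fintype.card A.wires := by
  have := Fintype.ofFinite h.Pt
  have h1 := h.linearIndependent_points.fintype_card_le_finrank
  let L : (A.Basis → ℂ) →ₗ[ℂ] (h.Pt → ℂ) :=
    { toFun := fun v g => star g.1 ⬝ᵥ v
      map_add' := fun v w => funext fun g => dotProduct_add _ _ _
      map_smul' := fun c v => funext fun g => dotProduct_smul _ _ _ }
  have h2 : Function.Injective L := fun v w hvw =>
    h.Z.eq_of_forall_point fun e he => congrFun hvw ⟨e, he⟩
  have h3 := LinearMap.finrank_le_finrank_of_injective h2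
  rw [Module.finrank_fintype_fun_eq_card] at h1 h3
  rw [Module.finrank_fintype_fun_eq_card] at h3
  rw [Nat.card_eq_fintype_card, le_antisymm h1 h3]
  simp

theorem odd_card_pt : Odd (Nat.card h.Pt) := by
  rw [card_pt]
  exact Odd.pow (by decide)

end IsComplementary

end Mermin

/-! ### Functions of two variables in rotated coordinates -/

namespace Mermin

open scoped Matrix ComplexOrder

section Rotation

variable {A B : Register}

/-- The companion identity for a function `ζ` of two labels: applying `f` in both variables amounts,
in rotated coordinates, to the conjugate of `f` in one variable and the companion in the other. -/
theorem IsCompanion.rotate {f E : LinMap A B} (hf : IsCompanion f E)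
    (ζ : A.Basis → A.Basis → ℂ) (y y' : B.Basis) :
    (f *ᵥ fun s => (f *ᵥ ζ s) (y - y')) (y + y') =
      ∑ x, star (f y x) * (E *ᵥ fun x' => ζ (x + x') (x - x')) y' := by
  have h : ∑ p : A.Basis × A.Basis, f (y + y') p.1 * (f (y - y') p.2 * ζ p.1 p.2) =
      ∑ p : A.Basis × A.Basis, star (f y p.1) * (E y' p.2 * ζ (p.1 + p.2) (p.1 - p.2)) := by
    rw [← (rotation A).sum_comp]
    refine Finset.sum_congr rfl fun p _ => ?_
    have h1 := hf y y' p.1 p.2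
    simp only [rotation, Equiv.coe_fn_mk]
    linear_combination ζ (p.1 + p.2) (p.1 - p.2) * h1
  rw [Fintype.sum_prod_type, Fintype.sum_prod_type] at h
  simpa only [Matrix.mulVec, dotProduct, Finset.mul_sum] using h

theorem IsCompanion.unique {f E E' : LinMap A B} (h : IsCompanion f E) (h' : IsCompanion f E')
    (hf : f ≠ 0) : E = E' := by
  obtain ⟨y, hy⟩ := Function.ne_iff.1 hf
  obtain ⟨x, hx⟩ := Function.ne_iff.1 hy
  ext y' x'
  exact mul_left_cancel₀ (star_ne_zero.2 hx) ((h y y' x x').symm.trans (h' y y' x x'))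

theorem mulVec_mul_const (f : LinMap A B) (v : A.Basis → ℂ) (c : ℂ) (y : B.Basis) :
    (f *ᵥ fun x => v x * c) y = (f *ᵥ v) y * c := by
  simp only [Matrix.mulVec, dotProduct, Finset.sum_mul, mul_assoc]

theorem mulVec_const_mul (f : LinMap A B) (v : A.Basis → ℂ) (c : ℂ) (y : B.Basis) :
    (f *ᵥ fun x => c * v x) y = c * (f *ᵥ v) y := by
  simp only [Matrix.mulVec, dotProduct, Finset.mul_sum, mul_left_comm]

/-- A nonzero vector that is copied by a tensor product of two counital comultiplications is a
product of two vectors that are copied by the factors. -/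
theorem exists_factors {f₁ f₂ : LinMap A (A.tensor A)} {ε₁ ε₂ : A.Basis → ℂ}
    (h₁ : ∀ (v : A.Basis → ℂ) b, ∑ a, ε₁ a * (f₁ *ᵥ v) (Sum.elim a b) = v b)
    (h₂ : ∀ (v : A.Basis → ℂ) a, ∑ b, ε₂ b * (f₂ *ᵥ v) (Sum.elim a b) = v a)
    {ξ : A.Basis → A.Basis → ℂ} (hξ0 : ∃ x x', ξ x x' ≠ 0)
    (hξ : ∀ Y Y' : (A.tensor A).Basis, (f₁ *ᵥ fun x => (f₂ *ᵥ ξ x) Y') Y =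
      ξ (fun i => Y (Sum.inl i)) (fun i => Y' (Sum.inl i)) *
        ξ (fun i => Y (Sum.inr i)) (fun i => Y' (Sum.inr i))) :
    ∃ η ψ : A.Basis → ℂ, (∀ x x', ξ x x' = η x * ψ x') ∧ f₁ *ᵥ η = tprod η η ∧
      f₂ *ᵥ ψ = tprod ψ ψ ∧ η ≠ 0 ∧ ψ ≠ 0 := by
  -- The candidates for the two factors are the marginals of `ξ` under the two counits; removing one
  -- copy by a counit at a time shows that `ξ` is their product.
  set ψ : A.Basis → ℂ := fun a' => ∑ a, ε₁ a * ξ a a' with hψ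
  set η : A.Basis → ℂ := fun b => ∑ b', ε₂ b' * ξ b b' with hη
  have step1 : ∀ b Y', (f₂ *ᵥ ξ b) Y' =
      ψ (fun i => Y' (Sum.inl i)) * ξ b (fun i => Y' (Sum.inr i)) := by
    intro b Y'
    rw [← h₁ (fun x => (f₂ *ᵥ ξ x) Y') b, hψ, Finset.sum_mul]
    refine Finset.sum_congr rfl fun a _ => ?_
    rw [hξ, mul_assoc]
    rfl
  have step2 : ∀ x x', ξ x x' = η x * ψ x' := by
    intro x x'
    rw [← h₂ (ξ x) x', hη, Finset.sum_mul]
    refine Finset.sum_congr rfl fun b _ => ?_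
    rw [step1]
    change ε₂ b * (ψ x' * ξ x b) = ε₂ b * ξ x b * ψ x'
    ring
  obtain ⟨x0, x0', h0⟩ := hξ0
  rw [step2] at h0
  have hη0 : η x0 ≠ 0 := left_ne_zero_of_mul h0
  have hψ0 : ψ x0' ≠ 0 := right_ne_zero_of_mul h0
  have hξeq : ∀ x, ξ x = fun x' => η x * ψ x' := fun x => funext (step2 x)
  have step3 : f₂ *ᵥ ψ = tprod ψ ψ := by
    funext Y'
    have h := step1 x0 Y'
    rw [hξeq, mulVec_const_mul] at h
    refine mul_left_cancel₀ hη0 (h.trans ?_)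
    simp only [tprod]
    ring
  refine ⟨η, ψ, step2, ?_, step3, fun h => hη0 (congrFun h _), fun h => hψ0 (congrFun h _)⟩
  funext Y
  have h := hξ Y (Sum.elim x0' x0')
  simp only [hξeq, mulVec_const_mul, step3] at h
  rw [mulVec_mul_const] at h
  refine mul_right_cancel₀ (mul_ne_zero hψ0 hψ0) (Eq.trans h ?_)
  simp only [tprod, Sum.elim_inl, Sum.elim_inr]
  ring

theorem IsFrobenius.counit_left {m : LinMap (A.tensor A) A} {u : A.Basis → ℂ}
    (hm : IsFrobenius m u) (v : A.Basis → ℂ) (b : A.Basis) :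
    ∑ a, star (u a) * (mᴴ *ᵥ v) (Sum.elim a b) = v b := by
  have h1 : mulL m u = 1 := by
    refine Matrix.ext_of_mulVec_single fun i => ?_
    rw [mulL_mulVec, hm.one_mul, Matrix.one_mulVec]
  have h2 := congrFun (contract_adjoint m u v) b
  rwa [h1, Matrix.conjTranspose_one, Matrix.one_mulVec] at h2

theorem IsFrobenius.adjoint_swap {m : LinMap (A.tensor A) A} {u : A.Basis → ℂ}
    (hm : IsFrobenius m u) (v : A.Basis → ℂ) (a b : A.Basis) :
    (mᴴ *ᵥ v) (Sum.elim a b) = (mᴴ *ᵥ v) (Sum.elim b a) := by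
  have h1 : ∀ y, m y (Sum.elim a b) = m y (Sum.elim b a) := by
    intro y
    have h := congrFun (hm.comm (Pi.single a 1) (Pi.single b 1)) y
    have h2 : ∀ a b : A.Basis, mulV m (Pi.single a 1) (Pi.single b 1) y = m y (Sum.elim a b) := by
      intro a b
      have h3 := tprod_single (A := A) (B := A) (Sum.elim a b)
      simp only [Sum.elim_inl, Sum.elim_inr] at h3
      rw [mulV]
      exact (congrArg (fun t => (m *ᵥ t) y) h3).trans (by
        rw [Matrix.mulVec_single_one]; rfl)
    rw [h2, h2] at h
    exact h.symm
  simp only [Matrix.mulVec, dotProduct, Matrix.conjTranspose_apply, h1]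

theorem IsFrobenius.counit_right {m : LinMap (A.tensor A) A} {u : A.Basis → ℂ}
    (hm : IsFrobenius m u) (v : A.Basis → ℂ) (a : A.Basis) :
    ∑ b, star (u b) * (mᴴ *ᵥ v) (Sum.elim a b) = v a := by
  rw [← hm.counit_left v a]
  exact Finset.sum_congr rfl fun b _ => by rw [hm.adjoint_swap]

end Rotation

end Mermin

/-! ### Rotating pairs of points -/

namespace Mermin

open scoped Matrix ComplexOrder

namespace IsComplementary

variable {A : Register} {mZ mX : LinMap (A.tensor A) A} {uZ uX : A.Basis → ℂ}

/-- Companions of composites are composites of companions, so `K` and `F` inherit the counit law, by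
uniqueness of the companion of a nonzero map. -/
theorem companion_counit (h : IsComplementary mZ uZ mX uX) {F : LinMap A (A.tensor A)}
    (hF : IsCompanion mZᴴ F) {K : LinMap A Register.empty} (hK : IsCompanion (ofKet uZ)ᴴ K)
    (v : A.Basis → ℂ) (a : A.Basis) :
    ∑ b, K (fun i => i.elim) b * (F *ᵥ v) (Sum.elim a b) = v a := by
  have h1 : LinMap.tensor (LinMap.relabel (Equiv.refl A.wires) : LinMap A A) (ofKet uZ)ᴴ * mZᴴ =
      (LinMap.relabel (Equiv.sumEmpty A.wires Empty).symm :
        LinMap A (A.tensor Register.empty)) := by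
    refine Matrix.ext_of_mulVec_single fun i => ?_
    rw [← Matrix.mulVec_mulVec, relabel_mulVec]
    funext y
    obtain ⟨p, q, rfl⟩ : ∃ (p : A.Basis) (q : Register.empty.Basis), y = Sum.elim p q :=
      ⟨_, _, (Sum.elim_comp_inl_inr y).symm⟩
    rw [refl_tensor_mulVec, ofKet_adjoint_mulVec]
    exact h.Z.counit_right _ p
  have h2 : LinMap.tensor (LinMap.relabel (Equiv.refl A.wires) : LinMap A A) K * F =
      (LinMap.relabel (Equiv.sumEmpty A.wires Empty).symm :
        LinMap A (A.tensor Register.empty)) := by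
    have h3 := hF.comp ((IsCompanion.relabel (Equiv.refl A.wires)).tensor hK)
    rw [h1] at h3
    refine h3.unique (IsCompanion.relabel _) fun h0 => ?_
    have h4 : (LinMap.relabel (Equiv.sumEmpty A.wires Empty).symm :
        LinMap A (A.tensor Register.empty)) 0 0 = 1 := if_pos rfl
    rw [h0] at h4
    exact zero_ne_one h4
  have h3 := congrFun (congrArg (· *ᵥ v) h2) (Sum.elim a fun i => i.elim)
  simp only [← Matrix.mulVec_mulVec, relabel_mulVec] at h3
  rw [refl_tensor_mulVec] at h3
  exact h3

/-- The product of two points is copied by two copies of the comultiplication. In rotated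
coordinates these are its conjugate and its companion, so the copied function splits into a
conjugate point and a vector copied by `F`. -/
theorem exists_rotation_points (h : IsComplementary mZ uZ mX uX) {F : LinMap A (A.tensor A)}
    (hF : IsCompanion mZᴴ F) {K : LinMap A Register.empty} (hK : IsCompanion (ofKet uZ)ᴴ K)
    (g k : h.Pt) : ∃ (p : h.Pt) (ψ : A.Basis → ℂ), F *ᵥ ψ = tprod ψ ψ ∧ ψ ≠ 0 ∧
      ∀ x x', g.1 (x + x') * k.1 (x - x') = star (p.1 x) * ψ x' := by
  obtain ⟨η, ψ, h1, h2, h3, h4, h5⟩ := exists_factors (f₁ := mZᴴ.map star) (f₂ := F)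
    (ε₁ := uZ) (ε₂ := K fun i => i.elim) (ξ := fun x x' => g.1 (x + x') * k.1 (x - x'))
    (fun v b => by
      have h1 := congrArg star (h.Z.counit_left (star v) b)
      simp only [star_sum, star_mul', star_star, Pi.star_apply] at h1
      rw [← h1]
      refine Finset.sum_congr rfl fun a _ => ?_
      simp [Matrix.mulVec, dotProduct])
    (h.companion_counit hF hK) (by
      obtain ⟨s, hs⟩ := Function.ne_iff.1 g.2.2
      obtain ⟨t, ht⟩ := Function.ne_iff.1 k.2.2
      have h1 := (rotation A).apply_symm_apply (s, t)
      set p := (rotation A).symm (s, t)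
      have h2 : p.1 + p.2 = s := congrArg Prod.fst h1
      have h3 : p.1 - p.2 = t := congrArg Prod.snd h1
      exact ⟨p.1, p.2, by rw [h2, h3]; exact mul_ne_zero hs ht⟩)
    (fun Y Y' => by
      have h1 := hF.rotate (fun s t => g.1 s * k.1 t) Y Y'
      simp only [mulVec_const_mul, k.2.1] at h1
      rw [mulVec_mul_const, g.2.1] at h1
      refine h1.symm.trans ?_
      simp only [tprod]
      exact mul_mul_mul_comm _ _ _ _)
  refine ⟨⟨star η, ?_, fun h0 => h4 (by rw [← star_star η, h0, star_zero])⟩, ψ, h3, h5,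
    fun x x' => (h1 x x').trans (congrArg (· * ψ x') (star_star (η x)).symm)⟩
  funext Y
  have h6 := congrArg star (congrFun h2 Y)
  rw [tprod, star_mul'] at h6
  refine Eq.trans ?_ h6
  simp [Matrix.mulVec, dotProduct]

/-- The converse of `exists_rotation_points`: rotated back, the product of a conjugate point and a
vector copied by `F` is copied by two comultiplications and splits into two points. -/
theorem exists_preimage_points (h : IsComplementary mZ uZ mX uX) {F : LinMap A (A.tensor A)}
    (hF : IsCompanion mZᴴ F) (p : h.Pt) {ψ : A.Basis → ℂ} (hψ : F *ᵥ ψ = tprod ψ ψ)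
    (hψ0 : ψ ≠ 0) : ∃ g k : h.Pt, ∀ x x', g.1 (x + x') * k.1 (x - x') = star (p.1 x) * ψ x' := by
  let ζ : A.Basis → A.Basis → ℂ := fun s t =>
    star (p.1 ((rotation A).symm (s, t)).1) * ψ ((rotation A).symm (s, t)).2
  have hζ : ∀ x x', ζ (x + x') (x - x') = star (p.1 x) * ψ x' := by
    intro x x'
    have h1 : (rotation A).symm (x + x', x - x') = (x, x') :=
      (rotation A).symm_apply_apply (x, x')
    simp only [ζ, h1]
  obtain ⟨g, k, h1, h2, h3, h4, h5⟩ := exists_factors (f₁ := mZᴴ) (f₂ := mZᴴ)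
    (ε₁ := star uZ) (ε₂ := star uZ) (ξ := ζ) h.Z.counit_left h.Z.counit_right (by
      obtain ⟨s, hs⟩ := Function.ne_iff.1 p.2.2
      obtain ⟨t, ht⟩ := Function.ne_iff.1 hψ0
      exact ⟨s + t, s - t, by rw [hζ]; exact mul_ne_zero (star_ne_zero.2 hs) ht⟩)
    (fun Y Y' => by
      obtain ⟨⟨W, W'⟩, hW⟩ := (rotation (A.tensor A)).surjective (Y, Y')
      obtain rfl : W + W' = Y := congrArg Prod.fst hW
      obtain rfl : W - W' = Y' := congrArg Prod.snd hW
      rw [hF.rotate ζ W W']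
      simp only [hζ, mulVec_const_mul, hψ]
      have h1 := congrArg star (congrFun p.2.1 W)
      have h2 : ∑ x, star (mZᴴ W x) * (star (p.1 x) * tprod ψ ψ W') =
          star ((mZᴴ *ᵥ p.1) W) * tprod ψ ψ W' := by
        simp only [Matrix.mulVec, dotProduct, star_sum, star_mul', Finset.sum_mul, mul_assoc]
      rw [h2, h1]
      have h3 := hζ (fun i => W (Sum.inl i)) (fun i => W' (Sum.inl i))
      have h4 := hζ (fun i => W (Sum.inr i)) (fun i => W' (Sum.inr i))
      refine Eq.trans ?_ (congrArg₂ (· * ·) h3 h4).symm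
      simp only [tprod, star_mul']
      exact mul_mul_mul_comm _ _ _ _)
  exact ⟨⟨g, h2, h4⟩, ⟨k, h3, h5⟩, fun x x' => (h1 _ _).symm.trans (hζ x x')⟩

/-- A product of a conjugate point and a vector determines its factors. -/
theorem eq_of_star_mul_eq (h : IsComplementary mZ uZ mX uX) {p q : h.Pt} {ψ χ : A.Basis → ℂ}
    (hψ : ψ ≠ 0) (hpq : ∀ x x', star (p.1 x) * ψ x' = star (q.1 x) * χ x') : p = q ∧ ψ = χ := by
  obtain ⟨x', hx'⟩ := Function.ne_iff.1 hψ
  have h1 : p = q := by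
    refine Subtype.ext (p.2.eq_of_smul q.2 (c := star (χ x' / ψ x')) ?_)
    funext x
    have h2 := hpq x x'
    apply star_injective
    simp only [Pi.smul_apply, smul_eq_mul, star_mul', star_star]
    rw [div_mul_eq_mul_div, eq_div_iff hx', h2, mul_comm]
  subst h1
  obtain ⟨x, hx⟩ := Function.ne_iff.1 p.2.2
  exact ⟨rfl, funext fun x' => mul_left_cancel₀ (star_ne_zero.2 hx) (hpq x x')⟩

/-- For a stabilizer state, the product of the values at `m + d` and at `m - d` is a product of a
function of `m` and a function of `d`. -/
theorem exists_product (h : IsComplementary mZ uZ mX uX) (hmZ : IsStabilizer mZ)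
    (huZ : IsStabilizer (ofKet uZ)) (hmX : IsStabilizer mX) :
    ∀ α : A.Basis → ℂ, IsStabilizer (ofKet α) → ∃ P R : h.Pt → ℂ, ∀ m d : h.Pt,
      (star (m + d).1 ⬝ᵥ α) * (star (m - d).1 ⬝ᵥ α) = P m * R d := by
  obtain ⟨F, hF⟩ := hmZ.adjoint.exists_isCompanion
  obtain ⟨K, hK⟩ := huZ.adjoint.exists_isCompanion
  obtain ⟨EX, hEX⟩ := hmX.exists_isCompanion
  choose φ ψ hψ hψ0 hφψ using h.exists_rotation_points hF hK
  -- The companion of the `X`-multiplication shows that `φ` is additive in pairs and that `ψ` is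
  -- multiplicative for `EX`.
  have hadd : ∀ g k g' k', φ (g + g') (k + k') = φ g k + φ g' k' ∧
      ψ (g + g') (k + k') = EX *ᵥ tprod (ψ g k) (ψ g' k') := by
    intro g k g' k'
    refine h.eq_of_star_mul_eq (hψ0 _ _) fun y y' => ?_
    rw [← hφψ, coe_add, coe_add, coe_add, mulV, mulV, mulV]
    have h1 := hEX.rotate (fun s t => tprod g.1 g'.1 s * tprod k.1 k'.1 t) y y'
    simp only [mulVec_const_mul] at h1
    rw [mulVec_mul_const] at h1
    refine h1.trans ?_
    have h2 : ∀ x x' : (A.tensor A).Basis,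
        tprod g.1 g'.1 (x + x') * tprod k.1 k'.1 (x - x') =
          star (tprod (φ g k).1 (φ g' k').1 x) * tprod (ψ g k) (ψ g' k') x' := by
      intro x x'
      have h3 := hφψ g k (fun i => x (Sum.inl i)) (fun i => x' (Sum.inl i))
      have h4 := hφψ g' k' (fun i => x (Sum.inr i)) (fun i => x' (Sum.inr i))
      refine Eq.trans (mul_mul_mul_comm _ _ _ _) ((congrArg₂ (· * ·) h3 h4).trans ?_)
      simp only [tprod, star_mul']
      exact mul_mul_mul_comm _ _ _ _
    simp only [h2, mulVec_const_mul]
    simp only [Matrix.mulVec, dotProduct, star_sum, star_mul', Finset.sum_mul, mul_assoc]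
  -- Exchanging the two points replaces `x'` by `-x'`.
  have hswap : ∀ g k, φ k g = φ g k ∧ ψ k g = fun x' => ψ g k (-x') := by
    intro g k
    refine h.eq_of_star_mul_eq (hψ0 _ _) fun x x' => ?_
    rw [← hφψ, ← hφψ, sub_neg_eq_add, ← sub_eq_add_neg, mul_comm]
  -- By additivity and symmetry, `φ` depends only on the sum of its arguments, through this
  -- endomorphism; the existence of preimages makes it bijective.
  let θ : h.Pt →+ h.Pt :=
    { toFun := fun g => φ g 0
      map_zero' := by
        have h1 := (hadd 0 0 0 0).1
        rw [add_zero] at h1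
        exact left_eq_add.1 h1
      map_add' := fun g k => by rw [← (hadd g 0 k 0).1, add_zero] }
  have hθ : ∀ g k, φ g k = θ (g + k) := by
    intro g k
    rw [map_add]
    have h1 := (hadd g 0 0 k).1
    rw [add_zero, zero_add, (hswap k 0).1] at h1
    exact h1
  have hpre : ∀ p, ∃ g k, φ g k = p ∧ ψ g k = ψ 0 0 := by
    intro p
    obtain ⟨g, k, hgk⟩ := h.exists_preimage_points hF p (hψ 0 0) (hψ0 0 0)
    exact ⟨g, k, h.eq_of_star_mul_eq (hψ0 _ _) fun x x' => (hφψ g k x x').symm.trans (hgk x x')⟩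
  have hθsurj : Function.Surjective θ := by
    intro p
    obtain ⟨g, k, h1, -⟩ := hpre p
    exact ⟨g + k, by rw [← hθ, h1]⟩
  have hθinj : Function.Injective θ := Finite.injective_iff_surjective.2 hθsurj
  -- Take a pair with the `φ` of `(m, m)` and the `ψ` of `(0, 0)`. Since `ψ 0 0` is even, exchanging
  -- the pair changes nothing, so the two points are equal; they equal `m` because `θ` is injective
  -- and the order of the group is odd.
  have hdiag : ∀ m, ψ m m = ψ 0 0 := by
    intro m
    obtain ⟨g, k, h1, h2⟩ := hpre (φ m m)
    have h3 : ψ k g = ψ 0 0 := by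
      rw [(hswap g k).2, h2]
      exact (hswap 0 0).2.symm
    have h4 : g = k := by
      have h5 : ∀ s t, g.1 s * k.1 t = k.1 s * g.1 t := by
        intro s t
        obtain ⟨⟨x, x'⟩, hx⟩ := (rotation A).surjective (s, t)
        obtain rfl : x + x' = s := congrArg Prod.fst hx
        obtain rfl : x - x' = t := congrArg Prod.snd hx
        rw [hφψ, hφψ, (hswap g k).1, h2, h3]
      obtain ⟨t, ht⟩ := Function.ne_iff.1 k.2.2
      refine Subtype.ext (g.2.eq_of_smul k.2 (c := g.1 t / k.1 t) (funext fun s => ?_))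
      rw [Pi.smul_apply, smul_eq_mul, div_mul_eq_mul_div, eq_div_iff ht, h5, mul_comm]
    subst h4
    rw [hθ, hθ] at h1
    have h6 : 2 • g = 2 • m := by
      rw [two_nsmul, two_nsmul]
      exact hθinj h1
    have h7 : g = m := by
      have hodd : (Nat.card h.Pt).Coprime 2 := h.odd_card_pt.coprime_two_right
      exact (nsmulCoprime hodd).injective h6
    rw [← h7, h2]
  intro α hα
  obtain ⟨L, hL⟩ := hα.adjoint.exists_isCompanion
  have hval : ∀ g : h.Pt, star g.1 ⬝ᵥ α = star (star α ⬝ᵥ g.1) := fun g =>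
    Matrix.star_dotProduct _ _
  have hprod : ∀ g k, (star α ⬝ᵥ g.1) * (star α ⬝ᵥ k.1) =
      star (star α ⬝ᵥ (φ g k).1) * (L *ᵥ ψ g k) 0 := by
    intro g k
    have h1 := hL.rotate (fun s t => g.1 s * k.1 t) 0 0
    simp only [mulVec_const_mul] at h1
    rw [mulVec_mul_const] at h1
    refine h1.trans ?_
    simp only [hφψ, mulVec_const_mul]
    simp only [dotProduct, star_sum, star_mul', Finset.sum_mul, ← mul_assoc]
    rfl
  -- At `(m + d, m - d)` the factor `φ` sees only the sum, hence `m`. By `hdiag` the diagonal part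
  -- drops out of `ψ`, which then sees only `d`.
  refine ⟨fun m => star α ⬝ᵥ (φ m m).1, fun d => star ((L *ᵥ ψ d (-d)) 0), fun m d => ?_⟩
  have h1 : φ (m + d) (m - d) = φ m m := by
    rw [hθ, hθ, add_add_sub_cancel]
  have h2 : ψ (m + d) (m - d) = ψ d (-d) := by
    rw [sub_eq_add_neg, (hadd m m d (-d)).2, hdiag, ← (hadd 0 0 d (-d)).2, zero_add, zero_add]
  rw [hval, hval, ← star_mul', hprod, h1, h2, star_mul', star_star]

end IsComplementary

end Mermin

/-! ### Stabilizer states as functions on the group of points -/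

namespace Mermin

open CategoryTheory MonoidalCategory
open scoped Matrix ComplexOrder

section States

variable {A B : Register}

theorem IsStabilizer.tprod {a : A.Basis → ℂ} {b : B.Basis → ℂ} (ha : IsStabilizer (ofKet a))
    (hb : IsStabilizer (ofKet b)) : IsStabilizer (ofKet (Mermin.tprod a b)) := by
  rw [← ofKet_tensor]
  exact .comp _ _ (.relabel _) (.tensor _ _ ha hb)

theorem IsStabilizer.mulVec {f : LinMap A B} {v : A.Basis → ℂ} (hf : IsStabilizer f)
    (hv : IsStabilizer (ofKet v)) : IsStabilizer (ofKet (f *ᵥ v)) := .comp _ _ hv hf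

theorem mulL_eq (m : LinMap (A.tensor A) A) (a : A.Basis → ℂ) :
    mulL m a = m * ((ofKet a).tensor (LinMap.relabel (Equiv.refl A.wires) : LinMap A A) *
      (LinMap.relabel (Equiv.emptySum Empty A.wires).symm :
        LinMap A (Register.empty.tensor A))) := by
  refine Matrix.ext_of_mulVec_single fun i => ?_
  rw [mulL_mulVec, mulV, ← Matrix.mulVec_mulVec]
  congr 1
  rw [Matrix.mulVec_single_one]
  funext y
  rw [Matrix.col_apply, mul_relabel_apply, relabel_refl]
  simp only [tprod, LinMap.tensor, ofKet, Matrix.one_apply, Pi.single_apply]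
  rfl

theorem IsStabilizer.mulL {m : LinMap (A.tensor A) A} {a : A.Basis → ℂ} (hm : IsStabilizer m)
    (ha : IsStabilizer (ofKet a)) : IsStabilizer (Mermin.mulL m a) := by
  rw [mulL_eq]
  exact .comp _ _ (.comp _ _ (.relabel _) (.tensor _ _ ha (.relabel _))) hm

end States

namespace IsComplementary

variable {A : Register} {mZ mX : LinMap (A.tensor A) A} {uZ uX : A.Basis → ℂ}
variable (h : IsComplementary mZ uZ mX uX)

/-- The values of a vector at the points. -/
def val (α : A.Basis → ℂ) (g : h.Pt) : ℂ := star g.1 ⬝ᵥ α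

theorem val_injective : Function.Injective h.val := fun _ _ hvw =>
  h.Z.eq_of_forall_point fun e he => congrFun hvw ⟨e, he⟩

theorem val_smul (c : ℂ) (α : A.Basis → ℂ) : h.val (c • α) = c • h.val α :=
  funext fun _ => dotProduct_smul _ _ _

theorem val_one : h.val uZ = 1 := funext fun g => g.2.dotProduct_one h.Z

theorem val_mulV (α β : A.Basis → ℂ) : h.val (mulV mZ α β) = h.val α * h.val β :=
  funext fun g => g.2.dotProduct_mulV α β

theorem val_mulL_adjoint (α v : A.Basis → ℂ) (g : h.Pt) :
    h.val ((mulL mZ α)ᴴ *ᵥ v) g = star (h.val α g) * h.val v g := by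
  rw [val, star_dotProduct_mulVec, Matrix.conjTranspose_conjTranspose, mulL_mulVec,
    h.Z.mulV_point g.2, star_smul, smul_dotProduct, smul_eq_mul]
  rfl

/-- Dually, the `Z`-comultiplication copies the point and the `X`-multiplication adds the two
copies. -/
theorem val_double (α : A.Basis → ℂ) (g : h.Pt) :
    h.val (mZ *ᵥ (mXᴴ *ᵥ α)) g = h.val α (g + g) := by
  rw [val, star_dotProduct_mulVec, g.2.1, star_dotProduct_mulVec,
    Matrix.conjTranspose_conjTranspose]
  rfl

/-- The functions on the points that are given by stabilizer states. -/
def IsValue (F : h.Pt → ℂ) : Prop := ∃ α, IsStabilizer (ofKet α) ∧ h.val α = F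

variable {h}

theorem IsValue.mul (hmZ : IsStabilizer mZ) {F G : h.Pt → ℂ} (hF : h.IsValue F)
    (hG : h.IsValue G) : h.IsValue (F * G) := by
  obtain ⟨α, hα, rfl⟩ := hF
  obtain ⟨β, hβ, rfl⟩ := hG
  exact ⟨_, hmZ.mulVec (hα.tprod hβ), h.val_mulV α β⟩

theorem IsValue.smul {F : h.Pt → ℂ} (hF : h.IsValue F) (c : ℂ) : h.IsValue (c • F) := by
  obtain ⟨α, hα, rfl⟩ := hF
  exact ⟨c • α, .smul c _ hα, h.val_smul c α⟩

theorem IsValue.one (huZ : IsStabilizer (ofKet uZ)) : h.IsValue 1 := ⟨uZ, huZ, h.val_one⟩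

theorem IsValue.pow (hmZ : IsStabilizer mZ) (huZ : IsStabilizer (ofKet uZ)) {F : h.Pt → ℂ}
    (hF : h.IsValue F) (n : ℕ) : h.IsValue (F ^ n) := by
  induction n with
  | zero => exact pow_zero F ▸ IsValue.one huZ
  | succ n ih => exact pow_succ F n ▸ ih.mul hmZ hF

/-- Conjugate values arise by applying the adjoint of multiplication by the state to the unit. -/
theorem IsValue.star (hmZ : IsStabilizer mZ) (huZ : IsStabilizer (ofKet uZ)) {F : h.Pt → ℂ}
    (hF : h.IsValue F) : h.IsValue (star F) := by
  obtain ⟨α, hα, rfl⟩ := hF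
  refine ⟨_, (hmZ.mulL hα).adjoint.mulVec huZ, funext fun g => ?_⟩
  rw [val_mulL_adjoint, val_one, Pi.one_apply, mul_one, Pi.star_apply]

theorem IsValue.double (hmZ : IsStabilizer mZ) (hmX : IsStabilizer mX) {F : h.Pt → ℂ}
    (hF : h.IsValue F) : h.IsValue fun g => F (g + g) := by
  obtain ⟨α, hα, rfl⟩ := hF
  exact ⟨_, hmZ.mulVec (hmX.adjoint.mulVec hα), funext fun g => h.val_double α g⟩

/-- The linear part of a stabilizer phase is a character, and it is a stabilizer phase. -/
theorem IsValue.exists_linear_part (hmZ : IsStabilizer mZ) (huZ : IsStabilizer (ofKet uZ))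
    (hmX : IsStabilizer mX) {F : h.Pt → ℂ} (hF : h.IsValue F) (hF1 : ∀ g, ‖F g‖ = 1) :
    h.IsValue (fun g => F g * Star.star (F (-g))) ∧
      ∀ g k, F (g + k) * Star.star (F (-(g + k))) =
        (F g * Star.star (F (-g))) * (F k * Star.star (F (-k))) := by
  have hs : ∀ g, F g * Star.star (F g) = 1 := by
    intro g
    have h1 := Complex.mul_conj (F g)
    rw [Complex.normSq_eq_norm_sq, hF1] at h1
    simpa using h1
  have hF0 : ∀ g, F g ≠ 0 := fun g h0 => by simpa [h0] using hF1 g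
  obtain ⟨P, R, hPR⟩ : ∃ P R : h.Pt → ℂ, ∀ m d, F (m + d) * F (m - d) = P m * R d := by
    obtain ⟨α, hα, rfl⟩ := hF
    exact h.exists_product hmZ huZ hmX α hα
  -- The unknown factors `P` and `R` are eliminated by evaluating at `m = 0` and at `d = 0`.
  have hquad : ∀ m d, F 0 * F 0 * (F (m + d) * F (m - d)) = F m * F m * (F d * F (-d)) := by
    intro m d
    have h1 := hPR m 0
    have h2 := hPR 0 d
    have h3 := hPR 0 0
    rw [add_zero, sub_zero] at h1 h3
    rw [zero_add, zero_sub] at h2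
    rw [hPR, h1, h2, h3]
    ring
  have hcube : ∀ g, F 0 * (F 0 * F 0) * F (g + g) = F g * F g * (F g * F (-g)) := by
    intro g
    rw [← hquad, sub_self]
    ring
  refine ⟨?_, ?_⟩
  -- The identity `hcube`, conjugated and multiplied by `F g ^ 4`, expresses `star (F (-g))` through
  -- the doubled values; this avoids having to realise negation on points by a stabilizer map.
  · have h1 : (fun g => F g * Star.star (F (-g))) =
        (F 0 * (F 0 * F 0))⁻¹ •
          (F ^ 4 * Star.star (fun g => F (g + g))) := by
      funext g
      have h2 := congrArg Star.star (hcube g)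
      simp only [star_mul'] at h2
      have h3 : (F 0 * Star.star (F 0)) ^ 3 = 1 := by rw [hs, one_pow]
      have h4 : (F g * Star.star (F g)) ^ 3 = 1 := by rw [hs, one_pow]
      have h5 : F 0 * (F 0 * F 0) ≠ 0 := mul_ne_zero (hF0 0) (mul_ne_zero (hF0 0) (hF0 0))
      rw [Pi.smul_apply, smul_eq_mul, eq_inv_mul_iff_mul_eq₀ h5, Pi.mul_apply, Pi.pow_apply,
        Pi.star_apply]
      linear_combination (-F g ^ 4 * F 0 ^ 3) * h2 + F g ^ 4 * Star.star (F (g + g)) * h3 -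
        F g * F 0 ^ 3 * Star.star (F (-g)) * h4
    rw [h1]
    exact ((hF.pow hmZ huZ 4).mul hmZ ((hF.double hmZ hmX).star hmZ huZ)).smul _
  · set l : h.Pt → ℂ := fun g => F g * Star.star (F (-g)) with hl
    have hl0 : l 0 = 1 := by
      simp only [hl, neg_zero, hs]
    -- In `F m * star (F (-m))` the even part of the quadratic exponent cancels, so the dependence
    -- on `d` disappears.
    have hlq : ∀ m d, l (m + d) * l (m - d) = l m * l m := by
      intro m d
      have h1 := hquad m d
      have h2 := congrArg Star.star (hquad (-m) d)
      simp only [star_mul'] at h2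
      rw [show -m + d = d - m by abel, show -m - d = -(m + d) by abel] at h2
      simp only [hl, neg_sub]
      have h3 : (F 0 * Star.star (F 0)) ^ 2 = 1 := by rw [hs, one_pow]
      have h4 : (F d * Star.star (F d)) * (F (-d) * Star.star (F (-d))) = 1 := by
        rw [hs, hs, one_mul]
      have h5 := congrArg₂ (· * ·) h1 h2
      linear_combination h5 - F (m + d) * F (m - d) * Star.star (F (d - m)) *
        Star.star (F (-(m + d))) * h3 + (F m * Star.star (F (-m))) ^ 2 * h4
    intro g k
    have hodd : (Nat.card h.Pt).Coprime 2 := h.odd_card_pt.coprime_two_right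
    -- In a group of odd order `g` and `k` have a midpoint `m`, and both `l (g + k)` and `l g * l k`
    -- equal `l m ^ 2`.
    obtain ⟨m, hm⟩ := (nsmulCoprime hodd).surjective (g + k)
    rw [nsmulCoprime_apply, two_nsmul] at hm
    change l (g + k) = l g * l k
    have h1 := hlq m (g - m)
    have h2 := hlq m m
    rw [sub_self, hl0, mul_one, hm] at h2
    rw [add_sub_cancel, show m - (g - m) = k by rw [sub_sub_eq_add_sub, hm, add_sub_cancel_left]]
      at h1
    rw [h2, h1]

end IsComplementary

/-- Matrices and vectors that represent the structure maps of a complementary pair exactly. -/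
structure IsRealization {A : Register} (Z X : QSCFA (C := QutritStab) A)
    (mZ : LinMap (A.tensor A) A) (uZ : A.Basis → ℂ) (mX : LinMap (A.tensor A) A)
    (uX : A.Basis → ℂ) : Prop where
  toIsComplementary : IsComplementary mZ uZ mX uX
  Z_mul : StabHom.Represents mZ Z.mul
  Z_one : StabHom.Represents (ofKet uZ) Z.one
  X_mul : StabHom.Represents mX X.mul

/-! ### Translation between morphisms and their values at points -/

section Values

variable {A : Register} {Z X : QSCFA (C := QutritStab) A} {mZ mX : LinMap (A.tensor A) A}
  {uZ uX : A.Basis → ℂ}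

theorem add_ofKet {hmZ : IsStabilizer mZ} (hZ : Z.mul = StabHom.mk mZ hmZ) {α β : A.Basis → ℂ}
    (hα : IsStabilizer (ofKet α)) (hβ : IsStabilizer (ofKet β)) :
    Z.add (StabHom.mk (ofKet α) hα) (StabHom.mk (ofKet β) hβ) =
      StabHom.mk (ofKet (mulV mZ α β)) (hmZ.mulVec (hα.tprod hβ)) := by
  rw [QSCFA.add, hZ]
  exact StabHom.mk_congr ((Matrix.mul_assoc _ _ _).trans
    (congrArg (mZ * ·) (ofKet_tensor α β)))

theorem phaseMap_ofKet {hmZ : IsStabilizer mZ} (hZ : Z.mul = StabHom.mk mZ hmZ)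
    {α : A.Basis → ℂ} (hα : IsStabilizer (ofKet α)) :
    Z.phaseMap (StabHom.mk (ofKet α) hα) = StabHom.mk (mulL mZ α) (hmZ.mulL hα) := by
  rw [QSCFA.phaseMap, hZ]
  refine StabHom.mk_congr ?_
  rw [mulL_eq]
  exact Matrix.mul_assoc _ _ _

/-- The state `j` is represented by a vector that takes the values `F`. -/
def HasValues (h : IsRealization Z X mZ uZ mX uX) (j : State A)
    (F : h.toIsComplementary.Pt → ℂ) : Prop :=
  ∃ (α : A.Basis → ℂ) (hα : IsStabilizer (ofKet α)), j = StabHom.mk (ofKet α) hα ∧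
    h.toIsComplementary.val α = F

variable (h : IsRealization Z X mZ uZ mX uX)

theorem exists_hasValues (j : State A) : ∃ F, HasValues h j F := by
  obtain ⟨f, hf, rfl⟩ := StabHom.exists_rep j
  obtain ⟨α, rfl⟩ := exists_eq_ofKet f
  exact ⟨_, α, hf, rfl, rfl⟩

variable {h} {j k : State A} {F G : h.toIsComplementary.Pt → ℂ}

theorem HasValues.isValue (hF : HasValues h j F) : h.toIsComplementary.IsValue F := by
  obtain ⟨α, hα, -, h1⟩ := hF
  exact ⟨α, hα, h1⟩

theorem exists_hasValues_of_isValue (hF : h.toIsComplementary.IsValue F) : ∃ j, HasValues h j F := by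
  obtain ⟨α, hα, h1⟩ := hF
  exact ⟨_, α, hα, rfl, h1⟩

theorem HasValues.eq (hF : HasValues h j F) {c : ℂ} (hc : ‖c‖ = 1) (hG : HasValues h k (c • F)) :
    j = k := by
  obtain ⟨α, hα, rfl, rfl⟩ := hF
  obtain ⟨β, hβ, rfl, h1⟩ := hG
  refine StabHom.mk_eq_mk_iff.2 ⟨c, hc, ?_⟩
  rw [smul_ofKet, h.toIsComplementary.val_injective
    (h1.trans (h.toIsComplementary.val_smul c α).symm)]

theorem HasValues.add (hF : HasValues h j F) (hG : HasValues h k G) :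
    HasValues h (Z.add j k) (F * G) := by
  obtain ⟨α, hα, rfl, rfl⟩ := hF
  obtain ⟨β, hβ, rfl, rfl⟩ := hG
  obtain ⟨hm, hZ⟩ := h.Z_mul
  exact ⟨_, _, add_ofKet hZ hα hβ, h.toIsComplementary.val_mulV α β⟩

theorem HasValues.one : HasValues h Z.one 1 := by
  obtain ⟨hu, hZ⟩ := h.Z_one
  exact ⟨uZ, hu, hZ, h.toIsComplementary.val_one⟩

theorem HasValues.sum (n : ℕ) {a : Fin n → State A}
    {F : Fin n → h.toIsComplementary.Pt → ℂ} (hF : ∀ i, HasValues h (a i) (F i)) :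
    HasValues h (Z.sum n a) (∏ i, F i) := by
  induction n with
  | zero => exact HasValues.one
  | succ n ih =>
    rw [Fin.prod_univ_succ]
    exact (hF 0).add (ih fun i => hF i.succ)

theorem isClassical_mk_iff {hmX : IsStabilizer mX} (hX : X.mul = StabHom.mk mX hmX)
    {α : A.Basis → ℂ} (hα : IsStabilizer (ofKet α)) :
    X.IsClassical (StabHom.mk (ofKet α) hα) ↔
      ∃ c : ℂ, ‖c‖ = 1 ∧ tprod α α = c • (mXᴴ *ᵥ α) := by
  rw [QSCFA.IsClassical, QSCFA.comul, hX]
  refine StabHom.mk_eq_mk_iff.trans (exists_congr fun c => and_congr_right fun _ => ?_)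
  rw [← ofKet_injective.eq_iff, ← ofKet_tensor]
  rfl

theorem isPhaseState_mk_iff (hF : IsFrobenius mZ uZ) {hmZ : IsStabilizer mZ}
    (hZ : Z.mul = StabHom.mk mZ hmZ) {huZ : IsStabilizer (ofKet uZ)}
    (hu : Z.one = StabHom.mk (ofKet uZ) huZ) {α : A.Basis → ℂ} (hα : IsStabilizer (ofKet α)) :
    Z.IsPhaseState (StabHom.mk (ofKet α) hα) ↔
      ∃ c : ℂ, ‖c‖ = 1 ∧ uZ = c • ((mulL mZ α)ᴴ *ᵥ α) := by
  have h1 : (LinMap.relabel (Equiv.sumEmpty A.wires Empty) :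
      LinMap (A.tensor Register.empty) A) *ᵥ
        (LinMap.tensor (LinMap.relabel (Equiv.refl A.wires) : LinMap A A) (ofKet α)ᴴ *ᵥ
          (mZᴴ *ᵥ α)) = (mulL mZ α)ᴴ *ᵥ α := by
    funext y
    rw [← contract_adjoint, relabel_mulVec]
    have h3 : y ∘ Equiv.sumEmpty A.wires Empty = Sum.elim y fun i : Empty => i.elim := by
      funext i
      rcases i with i | i
      · rfl
      · exact i.elim
    refine (congrArg _ h3).trans ((refl_tensor_mulVec _ _ _ _).trans ?_)
    exact Finset.sum_congr rfl fun x _ => congrArg (star (α x) * ·) (hF.adjoint_swap α y x)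
  rw [QSCFA.IsPhaseState, QSCFA.comul, hZ, hu]
  refine StabHom.mk_eq_mk_iff.trans (exists_congr fun c => and_congr_right fun _ => ?_)
  rw [← ofKet_injective.eq_iff, ← h1, Matrix.mulVec_mulVec, Matrix.mulVec_mulVec, ← smul_ofKet,
    ← mul_ofKet]

/-- Pairing the copied state with two points turns the copying law into a character law, up to the
scalar `c`. -/
theorem HasValues.isClassical (hF : HasValues h j F) (hj : X.IsClassical j) :
    ∃ c : ℂ, ∀ g k, F g * F k = c * F (g + k) := by
  obtain ⟨α, hα, rfl, rfl⟩ := hF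
  obtain ⟨hm, hX⟩ := h.X_mul
  obtain ⟨c, -, h2⟩ := (isClassical_mk_iff hX hα).1 hj
  refine ⟨c, fun g k => ?_⟩
  have h3 := congrArg (star (tprod g.1 k.1) ⬝ᵥ ·) h2
  simp only [star_tprod_dotProduct, dotProduct_smul, smul_eq_mul, star_dotProduct_mulVec,
    Matrix.conjTranspose_conjTranspose] at h3
  exact h3

theorem HasValues.norm_eq_one (hF : HasValues h j F) (hj : Z.IsPhaseState j)
    (g : h.toIsComplementary.Pt) : ‖F g‖ = 1 := by
  obtain ⟨α, hα, rfl, rfl⟩ := hF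
  obtain ⟨hm, hZm⟩ := h.Z_mul
  obtain ⟨hu, hZu⟩ := h.Z_one
  obtain ⟨c, hc, h2⟩ := (isPhaseState_mk_iff h.toIsComplementary.Z hZm hZu hα).1 hj
  have h3 := congrFun (congrArg h.toIsComplementary.val h2) g
  rw [IsComplementary.val_smul, IsComplementary.val_one, Pi.smul_apply,
    IsComplementary.val_mulL_adjoint] at h3
  have h4 := congrArg norm h3
  rw [Pi.one_apply, norm_one, smul_eq_mul, norm_mul, norm_mul, norm_star, hc, one_mul] at h4
  nlinarith [norm_nonneg (h.toIsComplementary.val α g)]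

end Values

/-! ### Projection onto classical phases and locality -/

/-- A rescaled character of odd order is determined by its odd part. -/
theorem smul_eq_pow_of_quasi_character {G : Type*} [AddCommGroup G] {n : ℕ}
    (hn : 2 * n = Nat.card G + 1) {Φ : G → ℂ} (hΦ : ∀ g, Φ g * star (Φ g) = 1) {c : ℂ}
    (hc : ∀ g k, Φ g * Φ k = c * Φ (g + k)) :
    star (Φ 0) • Φ = fun g => (Φ g * star (Φ (-g))) ^ n := by
  have h0 : ∀ g, Φ g ≠ 0 := fun g h => by simpa [h] using hΦ g
  have hc0 : c = Φ 0 := by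
    have h1 := hc 0 0
    rw [add_zero] at h1
    exact (mul_right_cancel₀ (h0 0) h1).symm
  -- With `c = Φ 0`, division by this unimodular value turns `Φ` into a genuine character `κ`.
  subst hc0
  set κ : G → ℂ := star (Φ 0) • Φ with hκ
  have hκ' : ∀ g, κ g = star (Φ 0) * Φ g := fun g => rfl
  have hκ0 : κ 0 = 1 := by rw [hκ', mul_comm, hΦ]
  have hadd : ∀ g k, κ (g + k) = κ g * κ k := by
    intro g k
    simp only [hκ']
    linear_combination (-star (Φ 0) ^ 2) * hc g k - star (Φ 0) * Φ (g + k) * hΦ 0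
  have hpow : ∀ (m : ℕ) g, κ (m • g) = κ g ^ m := by
    intro m g
    induction m with
    | zero => rw [zero_smul, hκ0, pow_zero]
    | succ m ih => rw [succ_nsmul, hadd, ih, pow_succ]
  funext g
  have h1 : star (κ (-g)) = κ g := by
    have h2 : κ (-g) * star (κ (-g)) = 1 := by
      simp only [hκ', star_mul', star_star]
      linear_combination (Φ 0 * star (Φ 0)) * hΦ (-g) + hΦ 0
    have h3 : κ (-g) * κ g = 1 := by rw [← hadd, neg_add_cancel, hκ0]
    have h4 : κ (-g) ≠ 0 := fun h => by simp [h] at h3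
    exact mul_left_cancel₀ h4 (h2.trans h3.symm)
  have h2 : Φ g * star (Φ (-g)) = κ g ^ 2 := by
    rw [pow_two]
    nth_rw 2 [← h1]
    simp only [hκ', star_mul', star_star]
    linear_combination (-Φ g * star (Φ (-g))) * hΦ 0
  -- The odd part of `κ` is `κ ^ 2`; its `n`-th power is `κ ^ (|G| + 1) = κ`.
  rw [h2, ← pow_mul, hn, pow_succ, ← hpow, card_nsmul_eq_zero', hκ0, one_mul]

/-- Qutrit stabilizer quantum mechanics is Mermin local. -/
theorem merminLocal_qutritStab : MerminLocal QutritStab := by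
  intro A Z X hZX σ
  obtain ⟨mZ, uZ, mX, uX, h0, hmZ, huZ, hmX, huX, hZm, hZu, hXm, hXu⟩ :=
    hZX.exists_isComplementary
  have h : IsRealization Z X mZ uZ mX uX :=
    ⟨h0, ⟨hmZ, hZm⟩, ⟨huZ, hZu⟩, ⟨hmX, hXm⟩⟩
  choose F hF using fun r => exists_hasValues h (σ.a r)
  have hF1 : ∀ r g, ‖F r g‖ = 1 := fun r g => (hF r).norm_eq_one (σ.a_phase r) g
  choose hlin hchar using fun r => (hF r).isValue.exists_linear_part hmZ huZ hmX (hF1 r)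
  -- The exponent `n` inverts 2 modulo the order of the group; it exists because that order is odd.
  obtain ⟨n, hn⟩ : ∃ n, 2 * n = Nat.card h0.Pt + 1 := by
    obtain ⟨k, hk⟩ := h0.odd_card_pt
    exact ⟨k + 1, by omega⟩
  set l : Fin σ.M → h0.Pt → ℂ := fun r g => F r g * star (F r (-g)) with hl
  have hex : ∀ r, ∃ j, HasValues h j (l r ^ n) := fun r =>
    exists_hasValues_of_isValue ((hlin r).pow hmZ huZ n)
  -- The replacement phases: halved odd parts of the given ones. They are characters, hence
  -- compatible with `X`, and taking them is multiplicative in the phases.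
  choose y hy using hex
  have hs : ∀ r g, F r g * star (F r g) = 1 := by
    intro r g
    have h1 := Complex.mul_conj (F r g)
    rw [Complex.normSq_eq_norm_sq, hF1] at h1
    simpa using h1
  have hy1 : ∀ r g, (l r ^ n) g * star ((l r ^ n) g) = 1 := by
    intro r g
    rw [Pi.pow_apply, star_pow, ← mul_pow]
    have h1 : l r g * star (l r g) = (F r g * star (F r g)) * (F r (-g) * star (F r (-g))) := by
      simp only [hl, star_mul', star_star]
      ring
    rw [h1, hs, hs, one_mul, one_pow]
  have hyadd : ∀ r g k, (l r ^ n) (g + k) = (l r ^ n) g * (l r ^ n) k := by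
    intro r g k
    rw [Pi.pow_apply, Pi.pow_apply, Pi.pow_apply, ← mul_pow]
    exact congrArg (· ^ n) (hchar r g k)
  refine σ.exists_isLHV y (fun r => ?_) (fun r => ?_) (fun r => ?_) (fun s => ?_)
  · obtain ⟨α, hα, h1, h2⟩ := hy r
    rw [h1, phaseMap_ofKet hZm, QSCFA.comul, hXm]
    refine StabHom.mk_congr ?_
    refine Matrix.ext_of_mulVec_single fun i => ?_
    rw [← Matrix.mulVec_mulVec, ← Matrix.mulVec_mulVec]
    refine h0.Z.eq_of_forall_point₂ fun e f he hf => ?_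
    have h3 := hyadd r ⟨e, he⟩ ⟨f, hf⟩
    rw [← h2] at h3
    rw [star_dotProduct_mulVec, star_dotProduct_mulVec, star_dotProduct_mulVec,
      star_dotProduct_mulVec, Matrix.conjTranspose_conjTranspose, tensor_conjTranspose,
      tensor_mulVec_tprod, mulL_adjoint_point he, mulL_adjoint_point hf]
    change star ((mulL mZ α)ᴴ *ᵥ mulV mX e f) ⬝ᵥ _ = star (mulV mX _ _) ⬝ᵥ _
    rw [mulL_adjoint_point (h0.mul_point he hf), mulV_smul_left, mulV_smul_right, smul_smul,
      ← star_mul']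
    exact congrArg (fun t => star (star t • mulV mX e f) ⬝ᵥ _) h3
  · obtain ⟨α, hα, h1, h2⟩ := hy r
    rw [h1, phaseMap_ofKet hZm]
    refine StabHom.mk_congr ?_
    rw [relabel_refl]
    refine Matrix.ext_of_mulVec_single fun i => ?_
    rw [← Matrix.mulVec_mulVec]
    refine h0.val_injective (funext fun g => ?_)
    rw [h0.val_mulL_adjoint, mulL_mulVec, h0.val_mulV, Matrix.one_mulVec,
      h2, Pi.mul_apply, ← mul_assoc, mul_comm (star _), hy1, one_mul]
  · obtain ⟨α, hα, h1, h2⟩ := hy r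
    rw [h1, phaseMap_ofKet hZm, QSCFA.counit, hXu]
    refine StabHom.mk_congr ?_
    refine Matrix.ext_of_mulVec_single fun i => ?_
    rw [← Matrix.mulVec_mulVec, ofKet_adjoint_mulVec, ofKet_adjoint_mulVec,
      star_dotProduct_mulVec, mulL_adjoint_point h0.one_point]
    have h3 : star uX ⬝ᵥ α = 1 := by
      have h4 := hyadd r 0 0
      rw [add_zero] at h4
      have h5 := hy1 r 0
      rw [h4, star_mul'] at h5
      have h6 := hy1 r 0
      have h7 : (l r ^ n) 0 = 1 := by
        have h8 : (l r ^ n) 0 ≠ 0 := fun h8 => by simp [h8] at h6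
        exact mul_left_cancel₀ h8 (h4.symm.trans (mul_one _).symm)
      exact (congrFun h2 0).trans h7
    rw [h3, star_one, one_smul]
  · have h1 := HasValues.sum σ.N fun i => hF (σ.idx s i)
    have h2 := HasValues.sum σ.N fun i => hy (σ.idx s i)
    obtain ⟨c, hc⟩ := h1.isClassical (σ.sum_classical s)
    set Φ : h0.Pt → ℂ := ∏ i, F (σ.idx s i) with hΦ
    have hΦs : ∀ g, Φ g * star (Φ g) = 1 := by
      intro g
      rw [hΦ, Finset.prod_apply, star_prod, ← Finset.prod_mul_distrib]
      exact Finset.prod_eq_one fun i _ => hs _ _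
    have hprod : (∏ i, l (σ.idx s i) ^ n) = fun g => (Φ g * star (Φ (-g))) ^ n := by
      funext g
      rw [Finset.prod_apply, hΦ, Finset.prod_apply, Finset.prod_apply, star_prod,
        ← Finset.prod_mul_distrib, ← Finset.prod_pow]
      rfl
    rw [hprod] at h2
    have hΦn : ‖star (Φ 0)‖ = 1 := by
      have h3 := congrArg norm (hΦs 0)
      rw [norm_mul, norm_star, norm_one] at h3
      rw [norm_star]
      nlinarith [norm_nonneg (Φ 0)]
    -- Old and new sums differ by the factor `star (Φ 0)`, which has norm 1, so they are the same
    -- morphism.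
    refine h1.eq hΦn ?_
    have h3 : star (Φ 0) • Φ = fun g => (Φ g * star (Φ (-g))) ^ n :=
      smul_eq_pow_of_quasi_character hn hΦs hc
    rwa [h3]

end Mermin

/-! ### Clifford gates and stabilizer maps for the standard pair -/

namespace Mermin

open scoped Matrix

section Gates

variable {A B : Register}

theorem mul_pauli_apply (U : LinMap A B) (a b : A.Basis) (y : B.Basis) (x : A.Basis) :
    (U * pauli a b) y x = U y (x + a) * ZMod.stdAddChar (b ⬝ᵥ x) := by
  simp [Matrix.mul_apply, pauli]

theorem pauli_mul_apply (U : LinMap A B) (a b : B.Basis) (y : B.Basis) (x : A.Basis) :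
    (pauli a b * U) y x = ZMod.stdAddChar (b ⬝ᵥ (y - a)) * U (y - a) x := by
  rw [Matrix.mul_apply, Finset.sum_eq_single (y - a)]
  · simp [pauli]
  · intro z _ hz
    have : y ≠ z + a := by
      rintro rfl
      simp at hz
    simp [pauli, this]
  · simp

theorem IsClifford.of_mul_pauli {U : LinMap A A} (hU : U * Uᴴ = 1)
    (h : ∀ a b : A.Basis, ∃ (k : ZMod 3) (a' b' : A.Basis),
      U * pauli a b = (ZMod.stdAddChar k : ℂ) • (pauli a' b' * U)) : IsClifford U := by
  refine ⟨Matrix.mem_unitaryGroup_iff.2 hU, fun a b => ?_⟩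
  obtain ⟨k, a', b', hk⟩ := h a b
  exact ⟨k, a', b', by rw [hk, Matrix.smul_mul, Matrix.mul_assoc, hU, Matrix.mul_one]⟩

/-- The linear map that sends `|x⟩` to `|φ x⟩`. -/
def basisMap (φ : A.Basis → B.Basis) : LinMap A B := fun y x => if y = φ x then 1 else 0

theorem mul_basisMap_apply {D : Register} (f : LinMap B D) (φ : A.Basis → B.Basis) (y : D.Basis)
    (x : A.Basis) : (f * basisMap φ) y x = f y (φ x) := by
  simp [Matrix.mul_apply, basisMap]

theorem basisMap_mul {D : Register} (ψ : B.Basis → D.Basis) (φ : A.Basis → B.Basis) :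
    basisMap ψ * basisMap φ = basisMap fun x => ψ (φ x) := by
  ext y x
  rw [mul_basisMap_apply, basisMap, basisMap]

theorem basisMap_tensor {A' B' : Register} (φ : A.Basis → B.Basis) (ψ : A'.Basis → B'.Basis) :
    (basisMap φ).tensor (basisMap ψ) = basisMap fun x : (A.tensor A').Basis =>
      (Sum.elim (φ fun i => x (Sum.inl i)) (ψ fun i => x (Sum.inr i)) : (B.tensor B').Basis) := by
  ext y x
  simp only [LinMap.tensor, basisMap, mul_ite, mul_one, mul_zero, ← ite_and]
  refine if_congr ⟨fun h => ?_, ?_⟩ rfl rfl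
  · rw [← h.1, ← h.2]
    exact (Sum.elim_comp_inl_inr y).symm
  · rintro rfl
    exact ⟨rfl, rfl⟩

theorem relabel_eq_basisMap (e : A.wires ≃ B.wires) :
    LinMap.relabel e = basisMap fun x => x ∘ e.symm := by
  ext y x
  exact if_congr ⟨fun h => by rw [h]; funext i; simp, fun h => by rw [h]; funext i; simp⟩ rfl rfl

/-- Linear permutations of the computational basis are Clifford unitaries. -/
theorem isClifford_basisMap (τ : A.Basis ≃ₗ[ZMod 3] A.Basis) : IsClifford (basisMap τ) := by
  refine .of_mul_pauli ?_ fun a b =>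
    ⟨0, τ a, b ᵥ* LinearMap.toMatrix' τ.symm.toLinearMap, ?_⟩
  · have h : (basisMap τ : LinMap A A)ᴴ = basisMap τ.symm := by
      ext y x
      simp only [basisMap, Matrix.conjTranspose_apply, apply_ite star, star_one, star_zero]
      exact if_congr ((τ.symm_apply_eq.symm.trans eq_comm)) rfl rfl
    ext y x
    rw [h, mul_basisMap_apply, Matrix.one_apply, basisMap, τ.apply_symm_apply]
  · ext y x
    have h : ∀ w, b ᵥ* LinearMap.toMatrix' τ.symm.toLinearMap ⬝ᵥ w = b ⬝ᵥ τ.symm w := fun w => by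
      rw [← Matrix.dotProduct_mulVec, LinearMap.toMatrix'_mulVec]
      rfl
    rw [mul_pauli_apply, AddChar.map_zero_eq_one, one_smul, pauli_mul_apply, h, basisMap, basisMap,
      map_add]
    by_cases hy : y = τ x + τ a
    · rw [if_pos hy, if_pos (by rw [hy, add_sub_cancel_right]), hy, add_sub_cancel_right,
        τ.symm_apply_apply, mul_comm]
    · rw [if_neg hy, if_neg fun h => hy (sub_eq_iff_eq_add.1 h), mul_zero, zero_mul]

/-- The shear `(u, v) ↦ (u, v + u)`. -/
def shear (A : Register) : (A.tensor A).Basis ≃ₗ[ZMod 3] (A.tensor A).Basis where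
  toFun x := Sum.elim (fun i => x (Sum.inl i)) fun i => x (Sum.inr i) + x (Sum.inl i)
  invFun x := Sum.elim (fun i => x (Sum.inl i)) fun i => x (Sum.inr i) - x (Sum.inl i)
  map_add' x y := by
    funext i
    rcases i with i | i
    · rfl
    · exact add_add_add_comm _ _ _ _
  map_smul' c x := by
    funext i
    rcases i with i | i
    · rfl
    · exact (mul_add _ _ _).symm
  left_inv x := by
    funext i
    rcases i with i | i
    · rfl
    · exact add_sub_cancel_right _ _
  right_inv x := by
    funext i
    rcases i with i | i
    · rfl
    · exact sub_add_cancel _ _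

end Gates

section Qutrit

theorem sum_qutrit_basis (F : Register.qutrit.Basis → ℂ) :
    ∑ x, F x = ∑ k : ZMod 3, F fun _ => k :=
  (Equiv.sum_comp (Equiv.funUnique Unit (ZMod 3)).symm F).symm

/-- The unnormalised Fourier matrix. -/
noncomputable def fourier : LinMap Register.qutrit Register.qutrit :=
  fun y x => ZMod.stdAddChar (y () * x ())

theorem star_stdAddChar (k : ZMod 3) :
    star (ZMod.stdAddChar k : ℂ) = ZMod.stdAddChar (-k) := (AddChar.map_neg_eq_conj _ _).symm

theorem isStabilizer_fourier : IsStabilizer fourier := by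
  have h3 : (√3 : ℂ) * (√3 : ℂ) = 3 := by
    rw [← Complex.ofReal_mul, Real.mul_self_sqrt (by norm_num)]
    norm_num
  have h0 : (√3 : ℂ) ≠ 0 := fun h => by simp [h] at h3
  have h1 : IsClifford ((√3 : ℂ)⁻¹ • fourier) := by
    -- The Fourier transform exchanges shifts and phases; the scalar comes from reordering the two.
    refine .of_mul_pauli ?_ fun a b => ⟨-(a () * b ()), -b, a, ?_⟩
    · ext y x
      rw [Matrix.conjTranspose_smul, Matrix.smul_mul, Matrix.mul_smul, smul_smul,
        Matrix.smul_apply, Matrix.mul_apply, sum_qutrit_basis, Matrix.one_apply, star_inv₀,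
        Complex.star_def, Complex.conj_ofReal, ← mul_inv, h3]
      have h2 := AddChar.sum_mulShift (y () - x ()) (ZMod.isPrimitive_stdAddChar 3)
      have h4 : ∀ k : ZMod 3, fourier y (fun _ => k) * fourierᴴ (fun _ => k) x =
          ZMod.stdAddChar (k * (y () - x ())) := by
        intro k
        rw [Matrix.conjTranspose_apply, fourier, fourier, star_stdAddChar,
          ← AddChar.map_add_eq_mul]
        congr 1
        ring
      simp only [h4, h2, sub_eq_zero, smul_eq_mul]
      have h5 : y = x ↔ y () = x () := ⟨fun h => h ▸ rfl, fun h => funext fun _ => h⟩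
      simp only [h5]
      split_ifs <;> simp
    · ext y x
      rw [Matrix.smul_mul, Matrix.mul_smul, smul_comm]
      simp only [Matrix.smul_apply, mul_pauli_apply, pauli_mul_apply, smul_eq_mul, fourier,
        ← AddChar.map_add_eq_mul]
      congr 2
      simp only [dotProduct, Finset.univ_unique, PUnit.default_eq_unit, Finset.sum_singleton,
        Pi.add_apply, Pi.sub_apply, Pi.neg_apply]
      ring
  have h2 := IsStabilizer.smul (√3 : ℂ) _ (.clifford _ h1)
  rwa [smul_smul, mul_inv_cancel₀ h0, one_smul] at h2

/-- The state with the quadratic phases `l * x + q * x ^ 2`. -/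
noncomputable def phaseVec (l q : ZMod 3) : Register.qutrit.Basis → ℂ :=
  fun x => ZMod.stdAddChar (l * x () + q * x () ^ 2)

theorem isClifford_diagonal (l q : ZMod 3) :
    IsClifford (A := Register.qutrit) (Matrix.diagonal (phaseVec l q)) := by
  refine .of_mul_pauli ?_ fun a b =>
    -- Expanding `q (x + a)²`, the cross term `2 q a x` is linear in `x` and so is a Pauli phase,
    -- while the constant terms give the scalar.
    ⟨l * a () + q * a () ^ 2, a, b + fun i => 2 * q * a i, ?_⟩
  · rw [Matrix.diagonal_conjTranspose, Matrix.diagonal_mul_diagonal, ← Matrix.diagonal_one]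
    congr 1
    funext x
    rw [Pi.star_apply, phaseVec, star_stdAddChar, ← AddChar.map_add_eq_mul, add_neg_cancel,
      AddChar.map_zero_eq_one]
  · ext y x
    rw [mul_pauli_apply, Matrix.smul_apply, pauli_mul_apply, smul_eq_mul]
    by_cases h : y = x + a
    · subst h
      rw [add_sub_cancel_right, Matrix.diagonal_apply_eq, Matrix.diagonal_apply_eq, phaseVec,
        phaseVec, ← AddChar.map_add_eq_mul, ← AddChar.map_add_eq_mul, ← AddChar.map_add_eq_mul]
      congr 1
      simp only [dotProduct, Finset.univ_unique, PUnit.default_eq_unit, Finset.sum_singleton,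
        Pi.add_apply]
      ring
    · rw [Matrix.diagonal_apply_ne _ h, Matrix.diagonal_apply_ne _ fun h' =>
        h (sub_eq_iff_eq_add.1 h'), mul_zero, mul_zero, zero_mul]

theorem zOne_eq : zOne = ofKet (phaseVec 0 0) := by
  ext y x
  simp [zOne, ofKet, phaseVec]

theorem isStabilizer_zOne : IsStabilizer zOne := by
  have h : zOne = fourier * LinMap.ketZero := by
    ext y x
    rw [Matrix.mul_apply, Finset.sum_eq_single 0]
    · simp [zOne, fourier, LinMap.ketZero]
    · intro z _ hz
      simp [LinMap.ketZero, hz]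
    · simp
  rw [h]
  exact .comp _ _ .ketZero isStabilizer_fourier

theorem isStabilizer_phaseVec (l q : ZMod 3) : IsStabilizer (ofKet (phaseVec l q)) := by
  have h : ofKet (phaseVec l q) = Matrix.diagonal (phaseVec l q) * zOne := by
    ext y x
    simp [Matrix.diagonal_mul, zOne, ofKet]
  rw [h]
  exact .comp _ _ isStabilizer_zOne (.clifford _ (isClifford_diagonal l q))

theorem qutrit_basis_ext {a b : Register.qutrit.Basis} : a = b ↔ a () = b () :=
  ⟨fun h => h ▸ rfl, fun h => funext fun _ => h⟩

theorem zMul_apply (y a b : Register.qutrit.Basis) :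
    zMul y (Sum.elim a b) = if a = y ∧ b = y then 1 else 0 :=
  if_congr (and_congr qutrit_basis_ext.symm qutrit_basis_ext.symm) rfl rfl

theorem xMul_apply (y a b : Register.qutrit.Basis) :
    xMul y (Sum.elim a b) = if a + b = y then 1 else 0 :=
  if_congr (qutrit_basis_ext (a := a + b)).symm rfl rfl

theorem zMul_conjTranspose : zMulᴴ = basisMap fun x => Sum.elim x x := by
  ext y x
  rw [Matrix.conjTranspose_apply, ← Sum.elim_comp_inl_inr y, zMul_apply, basisMap]
  simp only [apply_ite star, star_one, star_zero]
  refine if_congr ⟨fun h => by rw [h.1, h.2], fun h => ?_⟩ rfl rfl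
  exact ⟨congrArg (· ∘ Sum.inl) h, congrArg (· ∘ Sum.inr) h⟩

theorem xMul_eq : xMul = basisMap fun x : (Register.qutrit.tensor Register.qutrit).Basis =>
    (x ∘ Sum.inl + x ∘ Sum.inr : Register.qutrit.Basis) := by
  ext y x
  rw [← Sum.elim_comp_inl_inr x, xMul_apply, basisMap]
  exact if_congr eq_comm rfl rfl

theorem ketZero_eq : LinMap.ketZero = basisMap fun _ => 0 := rfl

theorem zOne_conjTranspose : zOneᴴ = (basisMap fun _ (i : Empty) => i.elim :
    LinMap Register.qutrit Register.empty) := by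
  ext y x
  rw [Matrix.conjTranspose_apply, basisMap, if_pos (Subsingleton.elim (α := Empty → ZMod 3) _ _)]
  simp [zOne]

/-- Copying the computational basis is the shear applied to `|x⟩ ⊗ |0⟩`. -/
theorem isStabilizer_zMul : IsStabilizer zMul := by
  have h : zMulᴴ = basisMap (shear Register.qutrit) *
      ((LinMap.relabel (Equiv.refl Register.qutrit.wires) : LinMap _ _).tensor LinMap.ketZero *
        (LinMap.relabel (Equiv.sumEmpty Unit Empty).symm :
          LinMap Register.qutrit (Register.qutrit.tensor Register.empty))) := by
    rw [zMul_conjTranspose, ketZero_eq, relabel_eq_basisMap, relabel_eq_basisMap, basisMap_tensor,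
      basisMap_mul, basisMap_mul]
    refine congrArg basisMap (funext fun x => funext fun i => ?_)
    rcases i with i | i
    · rfl
    · exact (zero_add _).symm
  rw [← Matrix.conjTranspose_conjTranspose zMul, h]
  exact .adjoint _ (.comp _ _ (.comp _ _ (.relabel _) (.tensor _ _ (.relabel _) .ketZero))
    (.clifford _ (isClifford_basisMap _)))

/-- Addition is the shear, followed by summation over the first wire with the adjoint of `zOne`. -/
theorem isStabilizer_xMul : IsStabilizer xMul := by
  have h : xMul = (LinMap.relabel (Equiv.emptySum Empty Unit) :
          LinMap (Register.empty.tensor Register.qutrit) Register.qutrit) *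
        LinMap.tensor zOneᴴ (LinMap.relabel (Equiv.refl Register.qutrit.wires) : LinMap _ _) *
      basisMap (shear Register.qutrit) := by
    rw [xMul_eq, zOne_conjTranspose, relabel_eq_basisMap, relabel_eq_basisMap, basisMap_tensor,
      basisMap_mul, basisMap_mul]
    exact congrArg basisMap (funext fun x => funext fun i => add_comm _ _)
  rw [h]
  exact .comp _ _ (.clifford _ (isClifford_basisMap _))
    (.comp _ _ (.tensor _ _ (.adjoint _ isStabilizer_zOne) (.relabel _)) (.relabel _))

end Qutrit

end Mermin

/-! ### The standard pair verified on matrix entries -/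

namespace Mermin

open CategoryTheory MonoidalCategory
open scoped Matrix

section Entries

variable {A B D A' B' : Register}

theorem tensor_apply_elim (f : LinMap A B) (g : LinMap A' B') (y : B.Basis) (y' : B'.Basis)
    (x : A.Basis) (x' : A'.Basis) :
    f.tensor g (Sum.elim y y') (Sum.elim x x') = f y x * g y' x' := rfl

theorem mul_tensor_refl_apply (g : LinMap (A.tensor D) B) (f : LinMap A' A) (y : B.Basis)
    (x : A'.Basis) (d : D.Basis) :
    (g * f.tensor (LinMap.relabel (Equiv.refl D.wires) : LinMap D D)) y (Sum.elim x d) =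
      ∑ z, g y (Sum.elim z d) * f z x := by
  rw [Matrix.mul_apply, sum_tensor_basis, relabel_refl]
  refine Finset.sum_congr rfl fun a _ => ?_
  rw [Finset.sum_eq_single d]
  · rw [tensor_apply_elim, Matrix.one_apply_eq, mul_one]
  · intro b _ hb
    rw [tensor_apply_elim, Matrix.one_apply_ne hb, mul_zero, mul_zero]
  · simp

theorem mul_refl_tensor_apply (g : LinMap (D.tensor A) B) (f : LinMap A' A) (y : B.Basis)
    (d : D.Basis) (x : A'.Basis) :
    (g * LinMap.tensor (LinMap.relabel (Equiv.refl D.wires) : LinMap D D) f) y (Sum.elim d x) =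
      ∑ z, g y (Sum.elim d z) * f z x := by
  rw [Matrix.mul_apply, sum_tensor_basis, relabel_refl, Finset.sum_eq_single d]
  · refine Finset.sum_congr rfl fun a _ => ?_
    rw [tensor_apply_elim, Matrix.one_apply_eq, one_mul]
  · intro b _ hb
    refine Finset.sum_eq_zero fun a _ => ?_
    rw [tensor_apply_elim, Matrix.one_apply_ne hb, zero_mul, mul_zero]
  · simp

theorem elim_comp_sumAssoc_symm (a : A.Basis) (b : B.Basis) (d : D.Basis) :
    (Sum.elim (Sum.elim a b) d ∘ (Equiv.sumAssoc A.wires B.wires D.wires).symm :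
      (A.tensor (B.tensor D)).Basis) = Sum.elim a (Sum.elim b d) := by
  funext i
  rcases i with i | i | i <;> rfl

theorem elim_comp_sumAssoc (a : A.Basis) (b : B.Basis) (d : D.Basis) :
    (Sum.elim a (Sum.elim b d) ∘ Equiv.sumAssoc A.wires B.wires D.wires :
      ((A.tensor B).tensor D).Basis) = Sum.elim (Sum.elim a b) d := by
  funext i
  rcases i with (i | i) | i <;> rfl

theorem ext_elim {f g : LinMap (A.tensor D) B}
    (h : ∀ y a d, f y (Sum.elim a d) = g y (Sum.elim a d)) : f = g := by
  ext y x
  rw [← Sum.elim_comp_inl_inr x]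
  exact h _ _ _

theorem ext_elim₂ {f g : LinMap (A.tensor D) (B.tensor B')}
    (h : ∀ y y' a d, f (Sum.elim y y') (Sum.elim a d) = g (Sum.elim y y') (Sum.elim a d)) :
    f = g := by
  refine ext_elim fun y a d => ?_
  rw [← Sum.elim_comp_inl_inr y]
  exact h _ _ _ _

end Entries

/-- The entrywise laws of a quasi-special commutative dagger Frobenius algebra with the structure
constants `k`. -/
structure FrobeniusEntries {A : Register} (m : LinMap (A.tensor A) A) (u : A.Basis → ℂ)
    (k : A.Basis → A.Basis → A.Basis → ℂ) : Prop where
  stab_mul : IsStabilizer m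
  stab_one : IsStabilizer (ofKet u)
  apply : ∀ y a b, m y (Sum.elim a b) = k y a b
  comm : ∀ y a b, k y a b = k y b a
  assoc : ∀ y a b d, ∑ z, k y z d * k z a b = ∑ z, k y a z * k z b d
  one_mul : ∀ y a, ∑ z, k y z a * u z = if y = a then 1 else 0
  frobenius : ∀ y y' a b, ∑ z, k y' z b * star (k a y z) = ∑ z, star (k z y y') * k z a b
  special : ∃ c : ℂ, c ≠ 0 ∧ ∀ y x, ∑ a, ∑ b, k y a b * star (k x a b) = if y = x then c else 0

/-- The algebra given by its matrix entries. -/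
def FrobeniusEntries.toQSCFA {A : Register} {m : LinMap (A.tensor A) A} {u : A.Basis → ℂ}
    {k : A.Basis → A.Basis → A.Basis → ℂ} (h : FrobeniusEntries m u k) :
    QSCFA (C := QutritStab) A where
  mul := StabHom.mk m h.stab_mul
  one := StabHom.mk (ofKet u) h.stab_one
  mul_assoc := by
    refine StabHom.mk_congr (f := m * m.tensor (LinMap.relabel (Equiv.refl A.wires)))
      (g := (m * LinMap.tensor (LinMap.relabel (Equiv.refl A.wires)) m) * LinMap.assoc A A A) ?_
    refine ext_elim fun y p d => ?_
    rw [← Sum.elim_comp_inl_inr p, mul_tensor_refl_apply, LinMap.assoc, mul_relabel_apply,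
      elim_comp_sumAssoc_symm, mul_refl_tensor_apply]
    exact (Finset.sum_congr rfl fun z _ => congrArg₂ _ (h.apply _ _ _) (h.apply _ _ _)).trans
      ((h.assoc _ _ _ _).trans (Finset.sum_congr rfl fun z _ =>
        congrArg₂ _ (h.apply _ _ _) (h.apply _ _ _)).symm)
  one_mul := by
    refine StabHom.mk_congr
      (f := m * LinMap.tensor (ofKet u) (LinMap.relabel (Equiv.refl A.wires)))
      (g := LinMap.leftUnitor A) ?_
    refine ext_elim fun y p d => ?_
    rw [mul_tensor_refl_apply]
    refine (Finset.sum_congr rfl fun z _ => congrArg (· * u z) (h.apply _ _ _)).trans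
      ((h.one_mul y d).trans (if_congr ⟨fun h => ?_, fun h => ?_⟩ rfl rfl))
    · subst h
      funext i
      rcases i with i | i
      · exact i.elim
      · rfl
    · exact (congrArg (· ∘ Sum.inr) h).symm
  mul_one := by
    refine StabHom.mk_congr
      (f := m * LinMap.tensor (LinMap.relabel (Equiv.refl A.wires)) (ofKet u))
      (g := LinMap.rightUnitor A) ?_
    refine ext_elim fun y d p => ?_
    rw [mul_refl_tensor_apply]
    refine (Finset.sum_congr rfl fun z _ => congrArg (· * u z)
      ((h.apply _ _ _).trans (h.comm _ _ _))).trans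
      ((h.one_mul y d).trans (if_congr ⟨fun h => ?_, fun h => ?_⟩ rfl rfl))
    · subst h
      funext i
      rcases i with i | i
      · rfl
      · exact i.elim
    · exact (congrArg (· ∘ Sum.inl) h).symm
  mul_comm := by
    refine StabHom.mk_congr (f := m * LinMap.braiding A A) ?_
    refine ext_elim fun y a b => ?_
    have h1 : (Sum.elim a b ∘ (Equiv.sumComm A.wires A.wires).symm : (A.tensor A).Basis) =
        Sum.elim b a := by
      funext i
      rcases i with i | i <;> rfl
    rw [LinMap.braiding, mul_relabel_apply, h1, h.apply, h.apply, h.comm]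
  frobenius_left := by
    refine StabHom.mk_congr
      (f := (m.tensor (LinMap.relabel (Equiv.refl A.wires)) *
        (LinMap.relabel (Equiv.sumAssoc A.wires A.wires A.wires).symm :
          LinMap (A.tensor (A.tensor A)) ((A.tensor A).tensor A))) *
        LinMap.tensor (LinMap.relabel (Equiv.refl A.wires) : LinMap A A) mᴴ) (g := mᴴ * m) ?_
    refine ext_elim₂ fun y y' a b => ?_
    rw [mul_refl_tensor_apply, sum_tensor_basis, Matrix.mul_apply]
    have h1 := h.frobenius y' y b a
    have h2 : ∀ p q, (m.tensor (LinMap.relabel (Equiv.refl A.wires)) *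
        (LinMap.relabel (Equiv.sumAssoc A.wires A.wires A.wires).symm :
          LinMap (A.tensor (A.tensor A)) ((A.tensor A).tensor A))) (Sum.elim y y')
            (Sum.elim a (Sum.elim p q)) * mᴴ (Sum.elim p q) b =
        if y' = q then k y p a * star (k b y' p) else 0 := by
      intro p q
      rw [mul_relabel_apply, Equiv.symm_symm, elim_comp_sumAssoc, tensor_apply_elim, relabel_refl,
        Matrix.one_apply, Matrix.conjTranspose_apply, h.apply, h.apply, h.comm b, h.comm y]
      split_ifs with h3
      · rw [mul_one, h3]
      · rw [mul_zero, zero_mul]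
    simp only [h2, Finset.sum_ite_eq, Finset.mem_univ, if_true]
    simp only [Matrix.conjTranspose_apply]
    refine h1.trans (Finset.sum_congr rfl fun z _ => ?_)
    rw [h.apply, h.apply, h.comm z y', h.comm z b]
  frobenius_right := by
    refine StabHom.mk_congr
      (f := (LinMap.tensor (LinMap.relabel (Equiv.refl A.wires)) m * LinMap.assoc A A A) *
        LinMap.tensor mᴴ (LinMap.relabel (Equiv.refl A.wires) : LinMap A A)) (g := mᴴ * m) ?_
    refine ext_elim₂ fun y y' a b => ?_
    rw [mul_tensor_refl_apply, sum_tensor_basis, Matrix.mul_apply, Finset.sum_comm]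
    have h1 := h.frobenius y y' a b
    have h2 : ∀ p q, (LinMap.tensor (LinMap.relabel (Equiv.refl A.wires) : LinMap A A) m *
        LinMap.assoc A A A) (Sum.elim y y') (Sum.elim (Sum.elim p q) b) * mᴴ (Sum.elim p q) a =
        if y = p then k y' q b * star (k a y q) else 0 := by
      intro p q
      rw [LinMap.assoc, mul_relabel_apply, elim_comp_sumAssoc_symm, tensor_apply_elim, relabel_refl,
        Matrix.one_apply, Matrix.conjTranspose_apply, h.apply, h.apply]
      split_ifs with h3
      · rw [_root_.one_mul, h3]
      · rw [zero_mul, zero_mul]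
    simp only [h2, Finset.sum_ite_eq, Finset.mem_univ, if_true]
    simp only [Matrix.conjTranspose_apply]
    refine h1.trans (Finset.sum_congr rfl fun z _ => ?_)
    rw [h.apply, h.apply]
  quasiSpecial := by
    obtain ⟨c, hc, h1⟩ := h.special
    have h2 : ∀ a b : ℂ, a * b = 1 → (a • LinMap.relabel (Equiv.refl Register.empty.wires)) *
        (b • LinMap.relabel (Equiv.refl Register.empty.wires) :
          LinMap Register.empty Register.empty) =
          LinMap.relabel (Equiv.refl Register.empty.wires) := by
      intro a b hab
      rw [Matrix.smul_mul, Matrix.mul_smul, smul_smul, hab, one_smul, relabel_refl, mul_one]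
    refine ⟨StabHom.mk (c • LinMap.relabel (Equiv.refl Empty)) (.smul _ _ (.relabel _)),
      ⟨StabHom.mk (c⁻¹ • LinMap.relabel (Equiv.refl Empty)) (.smul _ _ (.relabel _)),
        StabHom.mk_congr (h2 _ _ (inv_mul_cancel₀ hc)),
        StabHom.mk_congr (h2 _ _ (mul_inv_cancel₀ hc))⟩, ?_⟩
    refine StabHom.mk_congr (f := m * mᴴ) (g := (LinMap.leftUnitor A *
      LinMap.tensor (c • LinMap.relabel (Equiv.refl Register.empty.wires) :
        LinMap Register.empty Register.empty) (LinMap.relabel (Equiv.refl A.wires))) *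
          (LinMap.relabel (Equiv.emptySum Empty A.wires).symm :
            LinMap A (Register.empty.tensor A))) ?_
    ext y x
    rw [mul_relabel_apply, LinMap.leftUnitor, relabel_mul_apply, relabel_refl, relabel_refl,
      Matrix.mul_apply, sum_tensor_basis]
    have h3 : ∀ a b, m y (Sum.elim a b) * mᴴ (Sum.elim a b) x = k y a b * star (k x a b) := by
      intro a b
      rw [Matrix.conjTranspose_apply, h.apply, h.apply]
    simp only [h3, h1]
    change _ = (c * (1 : LinMap Register.empty Register.empty) _ _) * (1 : LinMap A A) y x
    rw [Subsingleton.elim (α := Empty → ZMod 3) (fun i => (y ∘ _) (Sum.inl i)) (fun i => (x ∘ _)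
      (Sum.inl i)), Matrix.one_apply_eq, mul_one, Matrix.one_apply]
    split_ifs
    · rw [mul_one]
    · rw [mul_zero]

theorem frobeniusEntries_zMul : FrobeniusEntries zMul (phaseVec 0 0)
    fun y a b => if a = y ∧ b = y then 1 else 0 where
  stab_mul := isStabilizer_zMul
  stab_one := isStabilizer_phaseVec 0 0
  apply := zMul_apply
  comm y a b := if_congr and_comm rfl rfl
  assoc y a b d := by
    simp only [ite_and, mul_ite, mul_one, mul_zero, Finset.sum_ite_eq, Finset.mem_univ, if_true]
    split_ifs <;> simp_all
  one_mul y a := by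
    simp only [ite_and, zero_mul, Finset.sum_ite_eq', Finset.mem_univ, if_true, phaseVec,
      AddChar.map_zero_eq_one, add_zero, mul_one]
    exact if_congr eq_comm rfl rfl
  frobenius y y' a b := by
    simp only [ite_and, apply_ite star, star_one, star_zero, mul_ite, mul_one, mul_zero,
      Finset.sum_ite_eq, Finset.mem_univ, if_true]
    split_ifs <;> simp_all [eq_comm]
  special := by
    refine ⟨1, one_ne_zero, fun y x => ?_⟩
    have h : ∀ a b : Register.qutrit.Basis, (if a = y ∧ b = y then (1 : ℂ) else 0) *
        star (if a = x ∧ b = x then (1 : ℂ) else 0) =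
        if y = b then if y = a then if y = x then 1 else 0 else 0 else 0 := by
      intro a b
      by_cases ha : y = a
      · by_cases hb : y = b
        · subst ha
          subst hb
          simp [apply_ite star]
        · simp [hb, Ne.symm hb]
      · simp [ha, Ne.symm ha]
    simp only [h, Finset.sum_ite_eq, Finset.mem_univ, if_true]

theorem ketZero_eq_ofKet : LinMap.ketZero = ofKet (Pi.single 0 1) := by
  ext y x
  exact (Pi.single_apply _ _ _).symm

theorem frobeniusEntries_xMul : FrobeniusEntries xMul (Pi.single 0 1)
    fun y a b => if a + b = y then 1 else 0 where
  stab_mul := isStabilizer_xMul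
  stab_one := ketZero_eq_ofKet ▸ .ketZero
  apply := xMul_apply
  comm y a b := by rw [add_comm]
  assoc y a b d := by
    simp [add_assoc]
  one_mul y a := by
    simp [Pi.single_apply, eq_comm]
  frobenius y y' a b := by
    have h : ∀ z, y + z = a ↔ z = a - y := fun z => eq_sub_iff_add_eq'.symm
    simp only [h, apply_ite star, star_one, star_zero, mul_ite, mul_one, mul_zero,
      Finset.sum_ite_eq', Finset.sum_ite_eq, Finset.mem_univ, if_true]
    refine if_congr ?_ rfl rfl
    rw [sub_add_eq_add_sub, sub_eq_iff_eq_add', eq_comm]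
  special := by
    -- There are 3 pairs of labels with a given sum.
    refine ⟨3, three_ne_zero, fun y x => ?_⟩
    have h : ∀ y a b : Register.qutrit.Basis, a + b = y ↔ b = y - a := fun y a b =>
      eq_sub_iff_add_eq'.symm
    simp only [h, apply_ite star, star_one, star_zero, mul_ite, mul_one, mul_zero,
      Finset.sum_ite_eq', Finset.mem_univ, if_true, sub_left_inj, Finset.sum_const,
      Finset.card_univ, Fintype.card_fun, ZMod.card, Fintype.card_unit, pow_one]
    by_cases hyx : y = x
    · subst hyx
      simp
    · simp [hyx, Ne.symm hyx]

/-- All four maps involved send basis vectors to basis vectors, so the three laws are identities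
between functions on labels. -/
theorem stronglyComplementary_qutrit :
    StronglyComplementary frobeniusEntries_zMul.toQSCFA frobeniusEntries_xMul.toQSCFA where
  bialgebra := by
    rw [tensorμ_eq_relabel]
    refine StabHom.mk_congr (f := zMulᴴ * xMul) (g := (xMul.tensor xMul *
      (LinMap.relabel (Equiv.sumSumSumComm Unit Unit Unit Unit) :
        LinMap ((Register.qutrit.tensor Register.qutrit).tensor
          (Register.qutrit.tensor Register.qutrit)) ((Register.qutrit.tensor
            Register.qutrit).tensor (Register.qutrit.tensor Register.qutrit)))) *
      LinMap.tensor zMulᴴ zMulᴴ) ?_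
    rw [zMul_conjTranspose, xMul_eq, relabel_eq_basisMap, basisMap_tensor, basisMap_tensor,
      basisMap_mul, basisMap_mul, basisMap_mul]
    refine congrArg basisMap (funext fun x => funext fun i => ?_)
    rcases i with i | i <;> rfl
  unit_copy := by
    refine StabHom.mk_congr (f := zMulᴴ * ofKet (Pi.single 0 1))
      (g := LinMap.tensor (ofKet (Pi.single 0 1)) (ofKet (Pi.single 0 1)) *
        (LinMap.relabel (Equiv.emptySum Empty Empty).symm :
          LinMap Register.empty (Register.empty.tensor Register.empty))) ?_
    rw [← ketZero_eq_ofKet, zMul_conjTranspose, ketZero_eq, relabel_eq_basisMap, basisMap_tensor,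
      basisMap_mul, basisMap_mul]
  counit_copy := by
    refine StabHom.mk_congr (f := (ofKet (phaseVec 0 0))ᴴ * xMul)
      (g := (LinMap.relabel (Equiv.emptySum Empty Empty) :
          LinMap (Register.empty.tensor Register.empty) Register.empty) *
        LinMap.tensor (ofKet (phaseVec 0 0))ᴴ (ofKet (phaseVec 0 0))ᴴ) ?_
    rw [← zOne_eq, zOne_conjTranspose, xMul_eq, relabel_eq_basisMap, basisMap_tensor,
      basisMap_mul, basisMap_mul]
    exact congrArg basisMap (funext fun x => funext fun i => i.elim)

end Mermin

/-! ### The phase group of a qutrit -/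

namespace Mermin

open CategoryTheory MonoidalCategory
open scoped Matrix

/-- A subgroup that is a retract is a trivial algebraic extension. -/
theorem trivialAlgebraicExtension_of_retraction {G : Type*} [AddCommGroup G] {H : AddSubgroup G}
    (π : G →+ H) (hπ : ∀ h : H, π h = h) : TrivialAlgebraicExtension H := by
  rintro k l n h ⟨x, hx⟩
  refine ⟨fun j => π (x j), fun p => ?_⟩
  rw [← hπ (h p), ← hx p, map_sum]
  exact Finset.sum_congr rfl fun j _ => (map_zsmul π _ _).symm

/-- The structure `Z` of the qutrit. -/
noncomputable abbrev qutritZ : QSCFA (C := QutritStab) Register.qutrit := frobeniusEntries_zMul.toQSCFA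

/-- The structure `X` of the qutrit. -/
noncomputable abbrev qutritX : QSCFA (C := QutritStab) Register.qutrit := frobeniusEntries_xMul.toQSCFA

variable {α : Register.qutrit.Basis → ℂ}

theorem mulL_zMul (a : Register.qutrit.Basis → ℂ) : mulL zMul a = Matrix.diagonal a := by
  ext y x
  have h : ∀ z, zMul y (Sum.elim z x) * a z = if z = y then if x = y then a z else 0 else 0 := by
    intro z
    rw [zMul_apply, ite_and]
    split_ifs <;> simp
  rw [mulL, Finset.sum_congr rfl fun z _ => h z, Finset.sum_ite_eq', if_pos (Finset.mem_univ _),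
    Matrix.diagonal_apply]
  exact if_congr eq_comm rfl rfl

theorem mulV_zMul (a b : Register.qutrit.Basis → ℂ) : mulV zMul a b = a * b := by
  rw [← mulL_mulVec, mulL_zMul]
  exact funext fun y => Matrix.mulVec_diagonal _ _ _

theorem mulL_zMul_adjoint (a b : Register.qutrit.Basis → ℂ) :
    (mulL zMul a)ᴴ *ᵥ b = star a * b := by
  rw [mulL_zMul, Matrix.diagonal_conjTranspose]
  exact funext fun y => Matrix.mulVec_diagonal _ _ _

theorem phaseVec_zero_zero : phaseVec 0 0 = 1 := by
  funext x
  simp [phaseVec]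

theorem isFrobenius_zMul : IsFrobenius zMul (phaseVec 0 0) where
  comm a b := by rw [mulV_zMul, mulV_zMul, mul_comm]
  assoc a b c := by simp only [mulV_zMul, mul_assoc]
  one_mul a := by rw [mulV_zMul, phaseVec_zero_zero, one_mul]
  frobenius a c d := by simp only [mulV_zMul, mulL_zMul_adjoint, mul_assoc]

theorem xMul_adjoint_mulVec (α : Register.qutrit.Basis → ℂ) (x y : Register.qutrit.Basis) :
    (xMulᴴ *ᵥ α) (Sum.elim x y) = α (x + y) := by
  have h : ∀ i, xMulᴴ (Sum.elim x y) i * α i = if x + y = i then α i else 0 := by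
    intro i
    rw [Matrix.conjTranspose_apply, xMul_apply]
    split_ifs <;> simp
  rw [Matrix.mulVec, dotProduct, Finset.sum_congr rfl fun i _ => h i, Finset.sum_ite_eq,
    if_pos (Finset.mem_univ _)]

theorem isClassical_qutritX_iff (hα : IsStabilizer (ofKet α)) :
    qutritX.IsClassical (StabHom.mk (ofKet α) hα) ↔
      ∃ c : ℂ, ‖c‖ = 1 ∧ ∀ x y, α x * α y = c * α (x + y) := by
  rw [isClassical_mk_iff (X := qutritX) rfl]
  refine exists_congr fun c => and_congr_right fun _ => ⟨fun h x y => ?_, fun h => ?_⟩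
  · rw [← xMul_adjoint_mulVec α]
    exact congrFun h (Sum.elim x y)
  · funext p
    rw [← Sum.elim_comp_inl_inr p]
    exact (h _ _).trans (congrArg (c * ·) (xMul_adjoint_mulVec _ _ _).symm)

theorem isPhaseState_qutritZ_iff (hα : IsStabilizer (ofKet α)) :
    qutritZ.IsPhaseState (StabHom.mk (ofKet α) hα) ↔ ∀ x, ‖α x‖ = 1 := by
  rw [isPhaseState_mk_iff (Z := qutritZ) isFrobenius_zMul rfl rfl, mulL_zMul_adjoint,
    phaseVec_zero_zero]
  refine ⟨?_, fun h => ⟨1, norm_one, funext fun x => ?_⟩⟩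
  · rintro ⟨c, hc, h⟩ x
    have h1 := congrArg norm (congrFun h x)
    rw [Pi.smul_apply, Pi.mul_apply, Pi.star_apply, Pi.one_apply, smul_eq_mul, norm_mul, norm_mul,
      norm_star, hc, norm_one, one_mul] at h1
    nlinarith [norm_nonneg (α x)]
  · rw [one_smul, Pi.mul_apply, Pi.star_apply, Pi.one_apply, mul_comm, Complex.star_def,
      Complex.mul_conj, Complex.normSq_eq_norm_sq, h]
    simp

theorem exists_stdAddChar_eq {z : ℂ} (hz : z ^ 3 = 1) : ∃ k : ZMod 3, z = ZMod.stdAddChar k := by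
  set ω : ℂ := ZMod.stdAddChar (1 : ZMod 3) with hω
  have h2 : (ZMod.stdAddChar (2 : ZMod 3) : ℂ) = ω ^ 2 := by
    rw [hω, pow_two, ← AddChar.map_add_eq_mul]
    rfl
  have h3 : ω ^ 3 = 1 := by
    rw [hω, ← AddChar.map_nsmul_eq_pow, ← AddChar.map_zero_eq_one (ZMod.stdAddChar (N := 3))]
    rfl
  have h1 : ω - 1 ≠ 0 := by
    rw [sub_ne_zero, hω, ← AddChar.map_zero_eq_one (ZMod.stdAddChar (N := 3))]
    exact fun h => one_ne_zero (ZMod.injective_stdAddChar h)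
  have h4 : 1 + ω + ω ^ 2 = 0 := by
    refine mul_left_cancel₀ h1 ?_
    linear_combination h3
  have h5 : (z - 1) * ((z - ω) * (z - ω ^ 2)) = 0 := by
    linear_combination hz - h3 - (z ^ 2 - ω * z) * h4
  rcases mul_eq_zero.1 h5 with h | h
  · exact ⟨0, by rw [AddChar.map_zero_eq_one, sub_eq_zero.1 h]⟩
  · rcases mul_eq_zero.1 h with h | h
    · exact ⟨1, sub_eq_zero.1 h⟩
    · exact ⟨2, by rw [h2, sub_eq_zero.1 h]⟩

theorem phaseVec_zero (l q : ZMod 3) : phaseVec l q 0 = 1 := by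
  simp [phaseVec]

theorem norm_phaseVec (l q : ZMod 3) (x : Register.qutrit.Basis) : ‖phaseVec l q x‖ = 1 :=
  AddChar.norm_apply _ _

theorem phaseVec_mul (l q l' q' : ZMod 3) :
    phaseVec l q * phaseVec l' q' = phaseVec (l + l') (q + q') := by
  funext x
  rw [Pi.mul_apply, phaseVec, phaseVec, phaseVec, ← AddChar.map_add_eq_mul]
  congr 1
  ring

theorem phaseVec_injective {l q l' q' : ZMod 3} (h : phaseVec l q = phaseVec l' q') :
    l = l' ∧ q = q' := by
  have h1 := ZMod.injective_stdAddChar (congrFun h fun _ => 1)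
  have h2 := ZMod.injective_stdAddChar (congrFun h fun _ => 2)
  have key : ∀ l q l' q' : ZMod 3, l * 1 + q * 1 ^ 2 = l' * 1 + q' * 1 ^ 2 →
    l * 2 + q * 2 ^ 2 = l' * 2 + q' * 2 ^ 2 → l = l' ∧ q = q' := by decide
  exact key _ _ _ _ h1 h2

/-- Unimodular stabilizer states of a qutrit have quadratic phases. -/
theorem exists_eq_smul_phaseVec (hα : IsStabilizer (ofKet α)) (h1 : ∀ x, ‖α x‖ = 1) :
    ∃ l q, α = α 0 • phaseVec l q := by
  obtain ⟨E, hE⟩ := hα.exists_isCompanion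
  have hE' : ∀ y, α y * α y * α y = E 0 (fun i => i.elim) := by
    intro y
    -- Without a difference of labels the companion identity reads `α² = star α * E`; multiplication
    -- by `α` shows that the cube is constant.
    have h2 := hE y 0 (fun i => i.elim) (fun i => i.elim)
    simp only [ofKet, add_zero, sub_zero] at h2
    have h3 := Complex.mul_conj (α y)
    rw [Complex.normSq_eq_norm_sq, h1, one_pow, Complex.ofReal_one] at h3
    simp only [Complex.star_def] at h2
    linear_combination α y * h2 + E 0 (fun i => i.elim) * h3
  have hcube : ∀ y, (α y / α 0) ^ 3 = 1 := by
    intro y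
    have h0 : α 0 ≠ 0 := fun h => by simpa [h] using h1 0
    rw [div_pow, div_eq_one_iff_eq (pow_ne_zero _ h0)]
    linear_combination hE' y - hE' 0
  obtain ⟨s, hs⟩ := exists_stdAddChar_eq (hcube fun _ => 1)
  obtain ⟨t, ht⟩ := exists_stdAddChar_eq (hcube fun _ => 2)
  have h0 : α 0 ≠ 0 := fun h => by simpa [h] using h1 0
  -- Interpolation at the labels 1 and 2: these solve `l + q = s` and `2 l + 4 q = t` modulo 3.
  refine ⟨t - s, 2 * s - t, funext fun x => ?_⟩
  obtain ⟨k, rfl⟩ : ∃ k, x = fun _ => k := ⟨x (), rfl⟩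
  rw [Pi.smul_apply, smul_eq_mul, phaseVec]
  rw [div_eq_iff h0] at hs ht
  have key : ∀ s t : ZMod 3, (t - s) * 1 + (2 * s - t) * 1 ^ 2 = s ∧
    (t - s) * 2 + (2 * s - t) * 2 ^ 2 = t := by decide
  fin_cases k
  · refine ((mul_one _).symm.trans (congrArg _ ?_))
    exact (phaseVec_zero (t - s) (2 * s - t)).symm
  · exact hs.trans (by rw [mul_comm]; congr 2; exact (key s t).1.symm)
  · exact ht.trans (by rw [mul_comm]; congr 2; exact (key s t).2.symm)

/-- The phase states of the qutrit. -/
noncomputable def qutritPhase : ZMod 3 × ZMod 3 ≃ qutritZ.PhaseState :=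
  Equiv.ofBijective (fun p => ⟨StabHom.mk (ofKet (phaseVec p.1 p.2))
    (isStabilizer_phaseVec p.1 p.2), (isPhaseState_qutritZ_iff _).2 (norm_phaseVec _ _)⟩) (by
    constructor
    · rintro ⟨l, q⟩ ⟨l', q'⟩ h
      obtain ⟨c, hc, h1⟩ := StabHom.mk_eq_mk_iff.1 (congrArg Subtype.val h)
      -- Both vectors have the value 1 at the label 0, which leaves no freedom for a global phase.
      have h2 : phaseVec l' q' = c • phaseVec l q := ofKet_injective h1
      have h3 : c = 1 := by
        have h4 := congrFun h2 0
        rw [Pi.smul_apply, phaseVec_zero, phaseVec_zero, smul_eq_mul, mul_one] at h4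
        exact h4.symm
      rw [h3, one_smul] at h2
      exact Prod.ext (phaseVec_injective h2).1.symm (phaseVec_injective h2).2.symm
    · rintro ⟨j, hj⟩
      obtain ⟨f, hf, rfl⟩ := StabHom.exists_rep j
      obtain ⟨α, rfl⟩ := exists_eq_ofKet f
      have h1 := (isPhaseState_qutritZ_iff hf).1 hj
      obtain ⟨l, q, hlq⟩ := exists_eq_smul_phaseVec hf h1
      exact ⟨(l, q), Subtype.ext (StabHom.mk_eq_mk_iff.2 ⟨α 0, h1 0, congrArg ofKet hlq⟩)⟩)

theorem qutritPhase_add (p p' : ZMod 3 × ZMod 3) :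
    (qutritPhase (p + p')).1 = qutritZ.add (qutritPhase p).1 (qutritPhase p').1 := by
  refine Eq.symm ((add_ofKet rfl _ _).trans (StabHom.mk_congr ?_))
  rw [mulV_zMul, phaseVec_mul]
  rfl

theorem isClassical_qutritPhase (p : ZMod 3 × ZMod 3) :
    qutritX.IsClassical (qutritPhase p).1 ↔ p.2 = 0 := by
  refine (isClassical_qutritX_iff (isStabilizer_phaseVec p.1 p.2)).trans ⟨?_, fun h => ?_⟩
  · rintro ⟨c, -, h⟩
    have h0 := h 0 0
    rw [add_zero, phaseVec_zero, mul_one, mul_one] at h0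
    have h1 := h (fun _ => 1) fun _ => 1
    rw [← h0, one_mul, phaseVec, ← AddChar.map_add_eq_mul] at h1
    have h2 := ZMod.injective_stdAddChar h1
    -- At two labels equal to 1, additivity of the exponent means `2 q = 4 q`, so `q = 0`.
    have key : ∀ l q : ZMod 3, l * 1 + q * 1 ^ 2 + (l * 1 + q * 1 ^ 2) =
      l * (1 + 1) + q * (1 + 1) ^ 2 → q = 0 := by decide
    exact key _ _ h2
  · refine ⟨1, norm_one, fun x y => ?_⟩
    rw [one_mul, phaseVec, phaseVec, phaseVec, ← AddChar.map_add_eq_mul, h, Pi.add_apply]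
    congr 1
    ring

/-- For a copied vector the norms of the entries are multiplicative on a group of exponent 3. If the
entry at 0 vanishes then all do; otherwise every norm has cube 1. -/
theorem represents_zero_or_isPhaseState (j : State (C := QutritStab) Register.qutrit)
    (hj : qutritX.IsClassical j) : StabHom.Represents 0 j ∨ qutritZ.IsPhaseState j := by
  obtain ⟨f, hf, rfl⟩ := StabHom.exists_rep j
  obtain ⟨α, rfl⟩ := exists_eq_ofKet f
  obtain ⟨c, hc, h⟩ := (isClassical_qutritX_iff hf).1 hj
  have hc0 : c ≠ 0 := fun h => by simp [h] at hc
  by_cases h0 : α 0 = 0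
  · left
    have h1 : α = 0 := by
      funext x
      have h2 := h x 0
      rw [h0, mul_zero, add_zero] at h2
      exact (mul_eq_zero.1 h2.symm).resolve_left hc0
    subst h1
    exact ⟨hf, rfl⟩
  · right
    rw [isPhaseState_qutritZ_iff]
    have hn : ∀ x y, ‖α x‖ * ‖α y‖ = ‖α (x + y)‖ := by
      intro x y
      rw [← norm_mul, h, norm_mul, hc, one_mul]
    have hn0 : ‖α 0‖ = 1 := by
      have h1 := hn 0 0
      rw [add_zero] at h1
      exact mul_left_cancel₀ (norm_ne_zero_iff.2 h0) (h1.trans (mul_one _).symm)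
    intro x
    have h3 : x + x + x = 0 := by
      have key : ∀ k : ZMod 3, k + k + k = 0 := by decide
      exact funext fun i => key _
    have h4 : ‖α x‖ ^ 3 = 1 := by
      rw [← hn0, ← h3, ← hn, ← hn]
      ring
    exact (pow_eq_one_iff_of_nonneg (norm_nonneg _) three_ne_zero).1 h4

/-- The strongly complementary pair on a single qutrit and its phase group. -/
theorem exists_qutrit_pair :
    ∃ Z X : QSCFA (C := QutritStab) Register.qutrit,
      StabHom.Represents zMul Z.mul ∧ StabHom.Represents zOne Z.one ∧
      StabHom.Represents xMul X.mul ∧ StabHom.Represents LinMap.ketZero X.one ∧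
      StronglyComplementary Z X ∧
      (∀ j, X.IsClassical j → StabHom.Represents 0 j ∨ Z.IsPhaseState j) ∧
      ∃ (_ : AddCommGroup Z.PhaseState) (K : AddSubgroup Z.PhaseState),
        (∀ α β : Z.PhaseState, (α + β).1 = Z.add α.1 β.1) ∧
        (∀ α : Z.PhaseState, α ∈ K ↔ X.IsClassical α.1) ∧
        (∃ e : Z.PhaseState ≃+ ZMod 3 × ZMod 3, ∀ α, α ∈ K ↔ (e α).2 = 0) ∧
        TrivialAlgebraicExtension K := by
  let _ : AddCommGroup qutritZ.PhaseState := qutritPhase.symm.addCommGroup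
  let e : qutritZ.PhaseState ≃+ ZMod 3 × ZMod 3 := qutritPhase.symm.addEquiv
  let K : AddSubgroup qutritZ.PhaseState :=
    ((AddMonoidHom.snd (ZMod 3) (ZMod 3)).comp e.toAddMonoidHom).ker
  have hK : ∀ α, α ∈ K ↔ (e α).2 = 0 := fun α => Iff.rfl
  have he : ∀ p, e.symm p = qutritPhase p := fun p => rfl
  refine ⟨qutritZ, qutritX, ⟨isStabilizer_zMul, rfl⟩, ⟨isStabilizer_zOne, ?_⟩,
    ⟨isStabilizer_xMul, rfl⟩, ⟨.ketZero, ?_⟩, stronglyComplementary_qutrit,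
    represents_zero_or_isPhaseState, inferInstance, K, fun α β => ?_, fun α => ?_, ⟨e, hK⟩, ?_⟩
  · exact StabHom.mk_congr zOne_eq.symm
  · exact StabHom.mk_congr ketZero_eq_ofKet.symm
  · obtain ⟨p, rfl⟩ := e.symm.surjective α
    obtain ⟨p', rfl⟩ := e.symm.surjective β
    rw [← map_add, he, he, he, qutritPhase_add]
  · obtain ⟨p, rfl⟩ := e.symm.surjective α
    rw [hK, e.apply_symm_apply, he, isClassical_qutritPhase]
  -- The retraction forgets the quadratic coefficient: `(l, q) ↦ (l, 0)`.
  · let π : qutritZ.PhaseState →+ K :=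
      (e.symm.toAddMonoidHom.comp ((AddMonoidHom.inl (ZMod 3) (ZMod 3)).comp
        ((AddMonoidHom.fst (ZMod 3) (ZMod 3)).comp e.toAddMonoidHom))).codRestrict K fun α => by
          rw [hK]
          exact congrArg Prod.snd (e.apply_symm_apply ((e α).1, 0))
    refine trivialAlgebraicExtension_of_retraction π fun h => Subtype.ext ?_
    change e.symm ((e h.1).1, 0) = h.1
    rw [e.symm_apply_eq]
    exact Prod.ext rfl ((hK _).1 h.2).symm

end Mermin

theorem mainTheorem6 :
    -- the standard strongly complementary pair on a single qutrit
    (∃ Z X : Mermin.QSCFA (C := Mermin.QutritStab) Mermin.Register.qutrit,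
      Mermin.StabHom.Represents Mermin.zMul Z.mul ∧
      Mermin.StabHom.Represents Mermin.zOne Z.one ∧
      Mermin.StabHom.Represents Mermin.xMul X.mul ∧
      Mermin.StabHom.Represents Mermin.LinMap.ketZero X.one ∧
      Mermin.StronglyComplementary Z X ∧
      -- all nonzero classical points of `X` are phase states of `Z`
      (∀ j, X.IsClassical j → Mermin.StabHom.Represents 0 j ∨ Z.IsPhaseState j) ∧
      -- the phase group of `Z`, with the subgroup `K` of classical points of `X`
      ∃ (_ : AddCommGroup Z.PhaseState) (K : AddSubgroup Z.PhaseState),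
        (∀ α β : Z.PhaseState, (α + β).1 = Z.add α.1 β.1) ∧
        (∀ α : Z.PhaseState, α ∈ K ↔ X.IsClassical α.1) ∧
        (∃ e : Z.PhaseState ≃+ ZMod 3 × ZMod 3, ∀ α, α ∈ K ↔ (e α).2 = 0) ∧
        Mermin.TrivialAlgebraicExtension K) ∧
    Mermin.MerminLocal Mermin.QutritStab := by
  exact ⟨Mermin.exists_qutrit_pair, Mermin.merminLocal_qutritStab⟩
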